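/- Let $\mathbf H^2$ be the hyperbolic plane of curvature $-1$, and let $\mathbf H^2\times\mathbf R$ carry the product metric $d$ and the product volume. For integers $p_1,p_2\ge 3$ with $\frac1{p_1}+\frac1{p_2}<\frac12$, let $ABC$ be a hyperbolic triangle with angles $\frac{\pi}{2},\frac{\pi}{p_1},\frac{\pi}{p_2}$ at $A,B,C$. For $h>0$ let $\Gamma=\Gamma_{(2,p_1,p_2)}(h)$ be the group of isometries of $\mathbf H^2\times\mathbf R$ generated by the rotation through $\pi$ about $A$, the rotation through $2\pi/p_1$ about $B$ (both acting trivially on $\mathbf R$) and the translation by $h$ along $\mathbf R$. For a kernel point $K\in\mathbf H^2\times\mathbf R$ let $\mathcal D(K)=\{X: d(K,X)\le d(gK,X)\ \forall g\in\Gamma\}$ be its Dirichlet–Voronoi cell, let $\mathcal B_K$ be the greatest closed geodesic ball with centre $K$ contained in $\mathcal D(K)$, and let $\delta(K)=\mathrm{vol}(\mathcal B_K)/\mathrm{vol}(\mathcal D(K))$ be the density of the packing formed by the $\Gamma$-images of $\mathcal B_K$. The packing is called multiply transitive if the stabilizer of $K$ in $\Gamma$ is non-trivial (equivalently, the $\mathbf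 H^2$-component of $K$ lies in the orbit of one of the rotation centres $A,B,C$). Theorem 4.4. Among all these multiply transitive geodesic ball packings (over all $p_1,p_2$, all $h>0$ and all such $K$) there is one of greatest density $\delta^{opt}$, and $$0.607267\le\delta^{opt}<0.607268 .$$ It is attained for the parameters $(2,p_1,p_2)=(2,9,3)$, with the ball centred at the vertex $B$ and a suitable $h$. Up to exchanging the roles of $(p_1,B)$ and $(p_2,C)$, which only relabels the same packing as $(2,3,9)$ with the ball centred at $C$, it is attained only for these parameters and with $K$ over the orbit of $B$. -/

import Mathlib

open MeasureTheory
open scoped MatrixGroups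

noncomputable section

/-! ### The hyperbolic plane: angles and rotations

The hyperbolic plane of curvature `-1` is `UpperHalfPlane`, with its metric and its invariant area
`dx dy / y ^ 2`. -/

/-- The Cayley transform: the coordinate of `z` in the conformal disk model of the hyperbolic plane
centred at `P`. The point `P` goes to `0` and the geodesic rays from `P` go to the Euclidean
rays from `0`. -/
def diskCoord (P z : UpperHalfPlane) : ℂ :=
  ((z : ℂ) - (P : ℂ)) / ((z : ℂ) - (starRingEnd ℂ) (P : ℂ))

/-- The angle at the vertex `P` between the geodesic rays from `P` to `Q` and from `P` to `R`. -/
def hypAngle (Q P R : UpperHalfPlane) : ℝ :=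
  InnerProductGeometry.angle (diskCoord P Q) (diskCoord P R)

/-- The matrix of the rotation about `i` through the angle `θ` (counterclockwise). -/
def rotMatrix (θ : ℝ) : SL(2, ℝ) :=
  ⟨!![Real.cos (θ / 2), Real.sin (θ / 2); -Real.sin (θ / 2), Real.cos (θ / 2)], by
    rw [Matrix.det_fin_two_of]
    nlinarith [Real.sin_sq_add_cos_sq (θ / 2)]⟩

/-- The rotation of the hyperbolic plane about the point `P` through the angle `θ`
(see `diskCoord_hypRotation`). -/
def hypRotation (P : UpperHalfPlane) (θ : ℝ) : UpperHalfPlane ≃ᵢ UpperHalfPlane :=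
  IsometryEquiv.constSMul (P.toSL2R * rotMatrix θ * P.toSL2R⁻¹)

/-- In the disk model centred at `P`, the rotation about `P` through `θ` is `w ↦ exp (i θ) w`. -/
theorem diskCoord_hypRotation (P z : UpperHalfPlane) (θ : ℝ) :
    diskCoord P (hypRotation P θ z) = Complex.exp (θ * Complex.I) * diskCoord P z := by
  have key : ∀ w : UpperHalfPlane,
      diskCoord P (P.toSL2R • w) = diskCoord UpperHalfPlane.I w := by
    intro w
    have hy : (P.im : ℂ) ≠ 0 := by exact_mod_cast P.im_ne_zero
    have hr : ((√P.im : ℝ) : ℂ) ≠ 0 := by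
      exact_mod_cast (Real.sqrt_pos.2 P.im_pos).ne'
    have hrr : ((√P.im : ℝ) : ℂ) * ((√P.im : ℝ) : ℂ) = P.im := by
      exact_mod_cast Real.mul_self_sqrt P.im_pos.le
    have h1 : ((P.toSL2R • w : UpperHalfPlane) : ℂ) = P.im * w + P.re := by
      rw [UpperHalfPlane.coe_specialLinearGroup_apply]
      simp only [UpperHalfPlane.coe_toSL2R, Matrix.of_apply, Matrix.cons_val', Matrix.cons_val_zero,
        Matrix.cons_val_one, Matrix.cons_val_fin_one, Algebra.algebraMap_self, RingHom.id_apply,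
        Complex.ofReal_div, Complex.ofReal_zero, Complex.ofReal_one, zero_mul, zero_add]
      rw [← hrr]
      field_simp
    have hP : (P : ℂ) = P.re + P.im * Complex.I := (Complex.re_add_im (P : ℂ)).symm
    have hP' : (starRingEnd ℂ) (P : ℂ) = P.re - P.im * Complex.I := by
      rw [hP]; simp [sub_eq_add_neg]
    unfold diskCoord
    rw [h1, hP', hP]
    simp only [UpperHalfPlane.coe_I, Complex.conj_I]
    rw [show (P.im : ℂ) * w + P.re - (P.re + P.im * Complex.I) = P.im * (w - Complex.I) by ring,
      show (P.im : ℂ) * w + P.re - (P.re - P.im * Complex.I) = P.im * (w - -Complex.I) by ring,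
      mul_div_mul_left _ _ hy]
  have rot : ∀ w : UpperHalfPlane, diskCoord UpperHalfPlane.I (rotMatrix θ • w) =
      Complex.exp (θ * Complex.I) * diskCoord UpperHalfPlane.I w := by
    intro w
    set c : ℂ := Complex.cos (θ / 2) with hc
    set s : ℂ := Complex.sin (θ / 2) with hs
    have h1 : ((rotMatrix θ • w : UpperHalfPlane) : ℂ) = (c * w + s) / (-s * w + c) := by
      rw [UpperHalfPlane.coe_specialLinearGroup_apply]
      simp [rotMatrix, hc, hs]
    have hcs : c ^ 2 + s ^ 2 = 1 := by rw [hc, hs]; exact Complex.cos_sq_add_sin_sq _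
    have hexp : Complex.exp (θ * Complex.I) = (c + s * Complex.I) ^ 2 := by
      rw [hc, hs, ← Complex.exp_mul_I, ← Complex.exp_nat_mul]
      congr 1
      push_cast
      ring
    have hI : Complex.I ^ 2 = -1 := Complex.I_sq
    have hd : -s * (w : ℂ) + c ≠ 0 := by
      have h0 : ![-Real.sin (θ / 2), Real.cos (θ / 2)] ≠ 0 := by
        intro h
        have h2 : Real.sin (θ / 2) = 0 := by simpa using congrFun h 0
        have h3 : Real.cos (θ / 2) = 0 := by simpa using congrFun h 1
        simpa [h2, h3] using Real.sin_sq_add_cos_sq (θ / 2)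
      simpa [hc, hs] using UpperHalfPlane.linear_ne_zero w h0
    have hw : (w : ℂ) + Complex.I ≠ 0 := by
      intro h
      have := congrArg Complex.im h
      simp at this
      linarith [w.im_pos]
    have hinv : (c - s * Complex.I) * (c + s * Complex.I) = 1 := by
      linear_combination hcs - s ^ 2 * hI
    have hne : c - s * Complex.I ≠ 0 := left_ne_zero_of_mul_eq_one hinv
    unfold diskCoord
    rw [h1, hexp]
    simp only [UpperHalfPlane.coe_I, Complex.conj_I, sub_neg_eq_add]
    rw [div_sub' hd, div_add' _ _ _ hd, div_div_div_cancel_right₀ hd,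
      show c * (w : ℂ) + s - (-s * w + c) * Complex.I
        = (c + s * Complex.I) * (w - Complex.I) by linear_combination s * hI,
      show c * (w : ℂ) + s + Complex.I * (-s * w + c)
        = (c - s * Complex.I) * (w + Complex.I) by linear_combination s * hI,
      mul_div_assoc', div_eq_div_iff (mul_ne_zero hne hw) hw]
    linear_combination -(c + s * Complex.I) * (w - Complex.I) * (w + Complex.I) * hinv
  obtain ⟨w, rfl⟩ : ∃ w, z = P.toSL2R • w := ⟨P.toSL2R⁻¹ • z, by simp⟩
  have h : hypRotation P θ (P.toSL2R • w) = P.toSL2R • (rotMatrix θ • w) := by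
    simp [hypRotation, mul_smul]
  rw [h, key, key, rot]

/-- `A B C` is a triangle with angles `π / 2`, `π / p₁`, `π / p₂` at `A`, `B`, `C`. -/
def IsTriangle (p₁ p₂ : ℕ) (A B C : UpperHalfPlane) : Prop :=
  hypAngle B A C = Real.pi / 2 ∧ hypAngle A B C = Real.pi / p₁ ∧ hypAngle A C B = Real.pi / p₂

/-! ### The space `H² × R` -/

/-- `H² × R`, with the distance of the product Riemannian metric
(the square root of the sum of the squares of the two distances). -/
abbrev H2R : Type := WithLp 2 (UpperHalfPlane × ℝ)

/-- The Riemannian volume of `H² × R`: the product of hyperbolic area and length. -/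
def volH2R : Measure H2R :=
  (volume : Measure (UpperHalfPlane × ℝ)).map (MeasurableEquiv.toLp 2 (UpperHalfPlane × ℝ))

theorem H2R.dist_eq (X Y : H2R) :
    dist X Y = √(dist X.fst Y.fst ^ 2 + dist X.snd Y.snd ^ 2) := by
  rw [WithLp.prod_dist_eq_add (by norm_num), Real.sqrt_eq_rpow]
  norm_num

/-- The isometry `(P, t) ↦ (g P, t + τ)` of `H² × R`. -/
def screwMotion (g : UpperHalfPlane ≃ᵢ UpperHalfPlane) (τ : ℝ) : H2R ≃ᵢ H2R :=
  IsometryEquiv.withLpProdCongr 2 g (IsometryEquiv.addRight τ)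

/-! ### The space groups -/

/-- The parameters `(2, p₁, p₂)` of the rotation groups of the hyperbolic plane. -/
def AdmissibleParams (p₁ p₂ : ℕ) : Prop :=
  3 ≤ p₁ ∧ 3 ≤ p₂ ∧ (1 : ℝ) / p₁ + 1 / p₂ < 1 / 2

/-- The space group `(+, 0; [2, p₁, p₂]; { }) × 1` belonging to a triangle `A B C` with angles
`π / 2`, `π / p₁`, `π / p₂`, with fibre lattice `h ℤ`. It is generated by the rotations of order `2`
about `A` and of order `p₁` about `B`, with translation parts zero, and by the fibre
translation by `h`. Its linear parts contain the rotation through `2 π / p₂` about `C`. -/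
def spaceGroup (p₁ : ℕ) (A B : UpperHalfPlane) (h : ℝ) : Subgroup (H2R ≃ᵢ H2R) :=
  Subgroup.closure {screwMotion (hypRotation A Real.pi) 0,
    screwMotion (hypRotation B (2 * Real.pi / p₁)) 0, screwMotion 1 h}

/-! ### Ball packings -/

/-- The Dirichlet–Voronoi cell of `Γ` around the kernel point `K`. -/
def dvCell (Γ : Subgroup (H2R ≃ᵢ H2R)) (K : H2R) : Set H2R :=
  {X | ∀ g ∈ Γ, dist K X ≤ dist (g K) X}

/-- The radius of the greatest ball with centre `K` inside the Dirichlet–Voronoi cell. -/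
def packingRadius (Γ : Subgroup (H2R ≃ᵢ H2R)) (K : H2R) : ℝ :=
  sSup {r : ℝ | 0 ≤ r ∧ Metric.closedBall K r ⊆ dvCell Γ K}

/-- The density of the ball packing of `Γ` with kernel point `K`: the ratio of the volumes of the
greatest ball in the Dirichlet–Voronoi cell and of the cell. -/
def packingDensity (Γ : Subgroup (H2R ≃ᵢ H2R)) (K : H2R) : ℝ :=
  volH2R.real (Metric.closedBall K (packingRadius Γ K)) / volH2R.real (dvCell Γ K)

/-- The orbit of `K` is multiply transitive: the stabilizer of `K` in `Γ` is not trivial. -/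
def IsMultiplyTransitive (Γ : Subgroup (H2R ≃ᵢ H2R)) (K : H2R) : Prop :=
  ∃ g ∈ Γ, g K = K ∧ g ≠ 1

/-- The configurations of the multiply transitive ball packings: admissible
parameters, a triangle, the (free) length of the fibre lattice and a kernel point with non-trivial
stabilizer. -/
def IsMultiplyTransitiveConfig (p₁ p₂ : ℕ) (A B C : UpperHalfPlane) (h : ℝ) (K : H2R) : Prop :=
  AdmissibleParams p₁ p₂ ∧ IsTriangle p₁ p₂ A B C ∧ 0 < h ∧
    IsMultiplyTransitive (spaceGroup p₁ A B h) K

end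

/-! The rotation group is the even half of the reflection group of the triangle, so the geometry
reduces to Coxeter theory and the optimisation to estimates in one real variable.

A `MirrorSystem` records reflections together with the functions `ℓ i`, which are linear in the
hyperboloid model. The Tits argument `ℓ_act_nonneg` makes the chamber a fundamental domain: its
images cover the plane (`exists_act_mem_chamber`), only the identity maps a chamber point into the
open chamber, and stabilizers are generated by the mirrors through the point. A nontrivial even
element therefore fixes a chamber point only where two mirrors meet, and every multiply transitive
kernel point lies over the orbit of a vertex (`exists_eq_act_vertex`).

A vertex `P` lies on mirrors, so its orbits under the rotation group and the reflection group agree.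
Its Dirichlet cell in the plane consists of `2 m` copies of the triangle, where `π / m` is the angle
at `P` (`measure_cell`). In the product space the cell is a prism of height `h` over it
(`dvCell_eq`), and the greatest ball has radius `min (h / 2) ρ`, where `sinh ρ` is the value at `P`
of the `ℓ` of the opposite side. The density is largest for `h = 2 ρ`, where it equals `ballProfile
ρ / (2 m (1/2 - 1/p₁ - 1/p₂))`.

It remains to compare these numbers. At a vertex with angle `π / p` the radius satisfies `cosh ρ *
sin (π / p) = cos (π / q)`. For `p = 9`, `q = 3` the denominator is `1`, so the optimum is
`ballProfile ρ` with `cosh ρ = 1 / (2 sin (π / 9))`. The profile is bounded by integrating truncated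
series of `cosh`. The cases `p = 7, 8, 10` with `q = 3` are computed one by one, and the infinite
families are treated with `b = π / p` as a real variable (`ballProfile_div_lt`). The right-angled
vertex is covered by `ballProfile_div_lt_of_right_angle`. -/

noncomputable section

/-! ### Reflections in mirrors, the Coxeter action, and the Tits criterion. -/

/-- Isometries `s i` of a metric space `X` which behave like the reflections in hyperplanes of a
hyperbolic space meeting under the angles `π / M i j`. The function `ℓ i` is the hyperbolic sine of
the signed distance to the hyperplane of `s i`. -/
structure MirrorSystem {B : Type*} (M : CoxeterMatrix B) (X : Type*) [MetricSpace X] where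
  /-- the reflections -/
  s : B → X ≃ᵢ X
  /-- the signed distances to the mirrors -/
  ℓ : B → X → ℝ
  ne_zero : ∀ i j, M i j ≠ 0
  ℓ_s : ∀ i j x, ℓ j (s i x) = ℓ j x + 2 * Real.cos (Real.pi / M i j) * ℓ i x
  cosh_dist_s : ∀ i x y,
    Real.cosh (dist x (s i y)) = Real.cosh (dist x y) + 2 * ℓ i x * ℓ i y
  ext_ℓ : ∀ x y, (∀ i, ℓ i x = ℓ i y) → x = y
  continuous_ℓ : ∀ i, Continuous (ℓ i)

namespace MirrorSystem

variable {B : Type*} {M : CoxeterMatrix B} {X : Type*} [MetricSpace X] (S : MirrorSystem M X)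

theorem ℓ_s_self (i : B) (x : X) : S.ℓ i (S.s i x) = -S.ℓ i x := by
  rw [S.ℓ_s, M.diagonal]; simp; ring

theorem s_s (i : B) (x : X) : S.s i (S.s i x) = x := by
  apply S.ext_ℓ
  intro j
  rw [S.ℓ_s, S.ℓ_s_self, S.ℓ_s]; ring

theorem s_mul_s (i : B) : S.s i * S.s i = 1 := by
  ext x; exact S.s_s i x

theorem sin_pi_div_pos (S : MirrorSystem M X) {i j : B} (hij : i ≠ j) :
    0 < Real.sin (Real.pi / M i j) := by
  have h2 : (2 : ℝ) ≤ M i j := by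
    have h0 := S.ne_zero i j
    have h1 := M.off_diagonal i j hij
    have : 2 ≤ M i j := by omega
    exact_mod_cast this
  apply Real.sin_pos_of_pos_of_lt_pi
  · positivity
  · rw [div_lt_iff₀ (by linarith)]; nlinarith [Real.pi_pos]

/-- The values of `ℓ i` and `ℓ j` under the powers of the rotation `s i * s j`. -/
theorem ℓ_s_mul_s_pow (i j : B) (n : ℕ) (x : X) :
    Real.sin (Real.pi / M i j) * S.ℓ i (((S.s i * S.s j) ^ n) x) =
      -Real.sin ((2 * n - 1) * (Real.pi / M i j)) * S.ℓ i x
        - Real.sin (2 * n * (Real.pi / M i j)) * S.ℓ j x ∧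
    Real.sin (Real.pi / M i j) * S.ℓ j (((S.s i * S.s j) ^ n) x) =
      Real.sin (2 * n * (Real.pi / M i j)) * S.ℓ i x
        + Real.sin ((2 * n + 1) * (Real.pi / M i j)) * S.ℓ j x := by
  set θ := Real.pi / M i j with hθ
  induction n with
  | zero => simp
  | succ n ih =>
    obtain ⟨h1, h2⟩ := ih
    set y := ((S.s i * S.s j) ^ n) x
    have e : ((S.s i * S.s j) ^ (n + 1)) x = S.s i (S.s j y) := by
      rw [pow_succ']; rfl
    have hji : Real.cos (Real.pi / M j i) = Real.cos θ := by rw [hθ, M.symmetric]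
    have a1 : S.ℓ i (S.s i (S.s j y)) = -S.ℓ i y - 2 * Real.cos θ * S.ℓ j y := by
      rw [S.ℓ_s_self, S.ℓ_s, hji]; ring
    have a2 : S.ℓ j (S.s i (S.s j y)) =
        2 * Real.cos θ * S.ℓ i y + (4 * Real.cos θ ^ 2 - 1) * S.ℓ j y := by
      rw [S.ℓ_s, S.ℓ_s_self, S.ℓ_s j i, hji]; ring
    have hc : Real.sin θ ^ 2 + Real.cos θ ^ 2 = 1 := Real.sin_sq_add_cos_sq θ
    have s1 : Real.sin ((2 * n - 1) * θ) =
        Real.sin (2 * n * θ) * Real.cos θ - Real.cos (2 * n * θ) * Real.sin θ := by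
      rw [← Real.sin_sub]; ring_nf
    have s2 : Real.sin ((2 * n + 1) * θ) =
        Real.sin (2 * n * θ) * Real.cos θ + Real.cos (2 * n * θ) * Real.sin θ := by
      rw [← Real.sin_add]; ring_nf
    have s3 : Real.sin (2 * (n + 1) * θ) =
        Real.sin (2 * n * θ) * (2 * Real.cos θ ^ 2 - 1) +
          Real.cos (2 * n * θ) * (2 * Real.sin θ * Real.cos θ) := by
      rw [← Real.cos_two_mul, ← Real.sin_two_mul, ← Real.sin_add]; ring_nf
    have c3 : Real.cos (2 * (n + 1) * θ) =
        Real.cos (2 * n * θ) * (2 * Real.cos θ ^ 2 - 1) -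
          Real.sin (2 * n * θ) * (2 * Real.sin θ * Real.cos θ) := by
      rw [← Real.cos_two_mul, ← Real.sin_two_mul, ← Real.cos_add]; ring_nf
    have s4 : Real.sin ((2 * (n + 1) - 1) * θ) =
        Real.sin (2 * n * θ) * Real.cos θ + Real.cos (2 * n * θ) * Real.sin θ := by
      rw [← Real.sin_add]; ring_nf
    have s5 : Real.sin ((2 * (n + 1) + 1) * θ) =
        Real.sin (2 * (n + 1) * θ) * Real.cos θ + Real.cos (2 * (n + 1) * θ) * Real.sin θ := by
      rw [← Real.sin_add]; ring_nf
    rw [s1] at h1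
    rw [s2] at h2
    push_cast
    rw [e, a1, a2, s5, c3, s3, s4]
    constructor
    · linear_combination -h1 - 2 * Real.cos θ * h2
    · linear_combination 2 * Real.cos θ * h1 + (4 * Real.cos θ ^ 2 - 1) * h2 +
        2 * Real.cos θ * Real.sin (2 * n * θ) * S.ℓ j x * hc

/-- The product is a rotation through `2 π / M i j`, so its `M i j`-th power restores `ℓ i` and `ℓ
j`. Any further `ℓ k` is restored because a combination of `ℓ k`, `ℓ i`, `ℓ j` with nonzero
coefficient at `ℓ k` is invariant under both reflections. The functions `ℓ` separate points. -/
theorem s_mul_s_pow (i j : B) : (S.s i * S.s j) ^ M i j = 1 := by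
  by_cases hij : i = j
  · subst hij
    rw [S.s_mul_s, one_pow]
  have hs := S.sin_pi_div_pos hij
  set θ := Real.pi / M i j with hθ
  have hM : (M i j : ℝ) * θ = Real.pi := by
    rw [hθ]; field_simp [S.ne_zero i j]
  have h1 : ∀ x, S.ℓ i (((S.s i * S.s j) ^ M i j) x) = S.ℓ i x := by
    intro x
    have h := (S.ℓ_s_mul_s_pow i j (M i j) x).1
    rw [← hθ, show (2 * (M i j : ℝ) - 1) * θ = 2 * Real.pi - θ by rw [← hM]; ring,
      show 2 * (M i j : ℝ) * θ = 2 * Real.pi by rw [← hM]; ring, Real.sin_two_pi_sub,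
      Real.sin_two_pi] at h
    exact mul_left_cancel₀ hs.ne' (by linarith)
  have h2 : ∀ x, S.ℓ j (((S.s i * S.s j) ^ M i j) x) = S.ℓ j x := by
    intro x
    have h := (S.ℓ_s_mul_s_pow i j (M i j) x).2
    rw [← hθ, show (2 * (M i j : ℝ) + 1) * θ = θ + 2 * Real.pi by rw [← hM]; ring,
      show 2 * (M i j : ℝ) * θ = 2 * Real.pi by rw [← hM]; ring, Real.sin_add_two_pi,
      Real.sin_two_pi] at h
    exact mul_left_cancel₀ hs.ne' (by linarith)
  ext x
  apply S.ext_ℓ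
  intro k
  set c := Real.cos θ with hc
  set a := Real.cos (Real.pi / M i k)
  set b := Real.cos (Real.pi / M j k)
  have hd : 1 - c ^ 2 ≠ 0 := by
    have := Real.sin_sq_add_cos_sq θ
    nlinarith
  have hji : Real.cos (Real.pi / M j i) = c := by rw [hc, hθ, M.symmetric]
  -- a combination of the three functions that is invariant under `s i` and `s j`
  set L : X → ℝ := fun x => (1 - c ^ 2) * S.ℓ k x + (a + b * c) * S.ℓ i x + (b + a * c) * S.ℓ j x
  have Li : ∀ x, L (S.s i x) = L x := by
    intro x
    simp only [L, S.ℓ_s_self, S.ℓ_s i k, S.ℓ_s i j]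
    rw [← hθ, ← hc]; ring
  have Lj : ∀ x, L (S.s j x) = L x := by
    intro x
    simp only [L, S.ℓ_s_self, S.ℓ_s j k, S.ℓ_s j i, hji]
    ring
  have Ln : ∀ n : ℕ, ∀ x, L (((S.s i * S.s j) ^ n) x) = L x := by
    intro n
    induction n with
    | zero => intro x; rfl
    | succ n ih =>
      intro x
      rw [pow_succ']
      change L (S.s i (S.s j (((S.s i * S.s j) ^ n) x))) = _
      rw [Li, Lj, ih]
  have h3 := Ln (M i j) x
  simp only [L, h1, h2] at h3
  exact mul_left_cancel₀ hd (by change _ = _ * S.ℓ k x; linarith)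

/-- The action of the Coxeter group. -/
def act : M.Group →* (X ≃ᵢ X) := M.toCoxeterSystem.lift ⟨S.s, S.s_mul_s_pow⟩

theorem act_simple (i : B) : S.act (M.toCoxeterSystem.simple i) = S.s i :=
  M.toCoxeterSystem.lift_apply_simple _ i

theorem act_simple_mul (i : B) (w : M.Group) (x : X) :
    S.act (M.toCoxeterSystem.simple i * w) x = S.s i (S.act w x) := by
  rw [map_mul, act_simple]; rfl

theorem act_mul_apply (v w : M.Group) (x : X) : S.act (v * w) x = S.act v (S.act w x) := by
  rw [map_mul]; rfl

/-- The closed fundamental chamber. -/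
def chamber : Set X := {x | ∀ i, 0 ≤ S.ℓ i x}

/-- The open fundamental chamber. -/
def openChamber : Set X := {x | ∀ i, 0 < S.ℓ i x}

theorem openChamber_subset : S.openChamber ⊆ S.chamber := fun _ hx i => (hx i).le

-- As long as `k + 1 ≤ M i t`, both coefficients on the right are sines of angles in `[0, π]`. This
-- is the positivity on which the Tits argument rests.
open CoxeterSystem in
theorem ℓ_alternatingWord (i t : B) (k : ℕ) (y : X) :
    Real.sin (Real.pi / M i t) *
        S.ℓ i (S.act (M.toCoxeterSystem.wordProd (alternatingWord i t k))⁻¹ y) =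
      if Even k then Real.sin ((k + 1) * (Real.pi / M i t)) * S.ℓ i y +
        Real.sin (k * (Real.pi / M i t)) * S.ℓ t y
      else Real.sin (k * (Real.pi / M i t)) * S.ℓ i y +
        Real.sin ((k + 1) * (Real.pi / M i t)) * S.ℓ t y := by
  set θ := Real.pi / M i t with hθ
  have hti : Real.cos (Real.pi / M t i) = Real.cos θ := by rw [hθ, M.symmetric]
  induction k generalizing y with
  | zero => simp [alternatingWord]
  | succ k ih =>
    have s1 : Real.sin ((k + 1 + 1) * θ) =
        2 * Real.cos θ * Real.sin ((k + 1) * θ) - Real.sin (k * θ) := by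
      rw [show ((k : ℝ) + 1 + 1) * θ = (k + 1) * θ + θ by ring,
        show (k : ℝ) * θ = (k + 1) * θ - θ by ring, Real.sin_add, Real.sin_sub]
      ring
    rw [alternatingWord_succ', wordProd_cons, mul_inv_rev, inv_simple, act_mul_apply, ih,
      act_simple]
    push_cast
    rw [s1]
    by_cases hk : Even k
    · have hk' : ¬ Even (k + 1) := by simp [hk, parity_simps]
      simp only [hk, hk', if_true, if_false]
      rw [S.ℓ_s_self, S.ℓ_s t i, hti]
      ring
    · have hk' : Even (k + 1) := by simp [hk, parity_simps]
      simp only [hk, hk', if_true, if_false]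
      rw [S.ℓ_s_self, S.ℓ_s i t]
      ring

open CoxeterSystem in
/-- The key property of the Tits representation: if `i` is not a left descent of `w`, then `w`
moves the fundamental chamber to the positive side of the mirror `i`. -/
theorem ℓ_act_nonneg {x : X} (hx : x ∈ S.chamber) (w : M.Group) (i : B)
    (h : ¬ M.toCoxeterSystem.IsLeftDescent w i) : 0 ≤ S.ℓ i (S.act w x) := by
  set cs := M.toCoxeterSystem with hcs
  induction hn : cs.length w using Nat.strong_induction_on generalizing w i with
  | _ n IH =>
  by_cases hw : w = 1
  · subst hw; simpa using hx i
  obtain ⟨t, ht⟩ := cs.exists_leftDescent_of_ne_one hw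
  have hti : i ≠ t := by rintro rfl; exact h ht
  have ht1 := cs.isLeftDescent_iff.1 ht
  set v : ℕ → M.Group := fun k => cs.wordProd (alternatingWord i t k) * w with hv
  have v0 : v 0 = w := by simp [hv, alternatingWord]
  have vs : ∀ k, v (k + 1) = cs.simple (if Even k then t else i) * v k := by
    intro k
    simp only [hv]
    rw [alternatingWord_succ', wordProd_cons, mul_assoc]
  -- The letters `t, i, t, …` are stripped from the left of `w` while each of them shortens it; `K`
  -- is the first count at which this fails.
  have hex : ∃ k, cs.length (v k) + k ≠ cs.length w := ⟨cs.length w + 1, by omega⟩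
  classical
  obtain ⟨hk1, hk2⟩ := (Nat.find_eq_iff hex).1 rfl
  generalize Nat.find hex = K at hk1 hk2
  push Not at hk2
  have hK0 : K ≠ 0 := by
    intro h0; rw [h0, v0] at hk1; exact hk1 rfl
  have hK1 : K ≠ 1 := by
    intro h0
    have := vs 0
    simp only [zero_add, Even.zero, if_true, v0] at this
    rw [h0, this] at hk1; exact hk1 ht1
  obtain ⟨k, rfl : K = k + 2⟩ : ∃ k, K = k + 2 := ⟨K - 2, by omega⟩
  have e1 := hk2 (k + 1) (by omega)
  have e0 := hk2 k (by omega)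
  -- Neither `i` nor `t` is a left descent of `v (k + 1)`: the next letter does not shorten it by
  -- the choice of `K`, and restoring the last stripped letter lengthens it. The induction
  -- hypothesis then applies to both mirrors.
  have d1 : ¬ cs.IsLeftDescent (v (k + 1)) (if Even (k + 1) then t else i) := by
    intro hd
    rw [cs.isLeftDescent_iff, ← vs] at hd
    apply hk1
    change cs.length (v (k + 1 + 1)) + (k + 1 + 1) = _
    omega
  have d0 : ¬ cs.IsLeftDescent (v (k + 1)) (if Even k then t else i) := by
    rw [IsLeftDescent, vs, simple_mul_simple_cancel_left, ← vs]
    omega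
  have hlt : cs.length (v (k + 1)) < n := by omega
  have p1 := IH _ hlt _ _ d1 rfl
  have p0 := IH _ hlt _ _ d0 rfl
  have hpos : 0 ≤ S.ℓ i (S.act (v (k + 1)) x) ∧ 0 ≤ S.ℓ t (S.act (v (k + 1)) x) := by
    by_cases hk : Even k
    · have hk' : ¬ Even (k + 1) := by simp [hk, parity_simps]
      simp only [hk, hk', if_true, if_false] at p0 p1
      exact ⟨p1, p0⟩
    · have hk' : Even (k + 1) := by simp [hk, parity_simps]
      simp only [hk, hk', if_true, if_false] at p0 p1
      exact ⟨p0, p1⟩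
  -- If `M i t` letters had been stripped, the braid relation would give an equal product that
  -- strips `i` first. That first step lengthens `w`, so the remaining `M i t - 1` letters could not
  -- produce the recorded loss of length.
  have hm : k + 1 < M i t := by
    by_contra! hle
    obtain ⟨m, hm⟩ : ∃ m, M i t = m + 1 := ⟨M i t - 1, by have := S.ne_zero i t; omega⟩
    have e2 := hk2 (m + 1) (by omega)
    have e3 : v (m + 1) = cs.wordProd (alternatingWord i t m) * (cs.simple i * w) := by
      have hb := cs.wordProd_braidWord_eq i t
      simp only [braidWord, M.symmetric t i, hm] at hb
      simp only [hv]
      rw [hb, alternatingWord_succ, wordProd_concat, mul_assoc]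
    have e4 := cs.length_le_length_mul_add_left (cs.wordProd (alternatingWord i t m))
      (cs.simple i * w)
    rw [← e3] at e4
    have e5 := cs.length_wordProd_le (alternatingWord i t m)
    rw [length_alternatingWord] at e5
    have e6 := cs.not_isLeftDescent_iff.1 h
    omega
  have hs := S.sin_pi_div_pos hti
  have key := S.ℓ_alternatingWord i t (k + 1) (S.act (v (k + 1)) x)
  have hvw : S.act (cs.wordProd (alternatingWord i t (k + 1)))⁻¹ (S.act (v (k + 1)) x) =
      S.act w x := by
    rw [← act_mul_apply]
    simp [hv]
  rw [hvw] at key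
  have hMpos : (0 : ℝ) < M i t := by exact_mod_cast Nat.pos_of_ne_zero (S.ne_zero i t)
  have sn : ∀ j : ℝ, 0 ≤ j → j ≤ M i t → 0 ≤ Real.sin (j * (Real.pi / M i t)) := by
    intro j h0 h1
    apply Real.sin_nonneg_of_nonneg_of_le_pi
    · positivity
    · calc j * (Real.pi / M i t) ≤ M i t * (Real.pi / M i t) := by gcongr
        _ = Real.pi := by field_simp
  have hm' : ((k + 1 : ℕ) : ℝ) + 1 ≤ M i t := by exact_mod_cast hm
  have n1 := sn ((k + 1 : ℕ) : ℝ) (by positivity) (by linarith)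
  have n2 := sn (((k + 1 : ℕ) : ℝ) + 1) (by positivity) hm'
  have : 0 ≤ Real.sin (Real.pi / M i t) * S.ℓ i (S.act w x) := by
    rw [key]
    split_ifs
    · exact add_nonneg (mul_nonneg n2 hpos.1) (mul_nonneg n1 hpos.2)
    · exact add_nonneg (mul_nonneg n1 hpos.1) (mul_nonneg n2 hpos.2)
  exact nonneg_of_mul_nonneg_right this hs

end MirrorSystem

/-! ### The chamber as a fundamental domain. -/

namespace MirrorSystem

variable {B : Type*} {M : CoxeterMatrix B} {X : Type*} [MetricSpace X] (S : MirrorSystem M X)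

open CoxeterSystem

theorem dist_le_dist_s_iff (i : B) (x y : X) :
    dist x y ≤ dist x (S.s i y) ↔ 0 ≤ S.ℓ i x * S.ℓ i y := by
  rw [← abs_of_nonneg (dist_nonneg (x := x) (y := y)),
    ← abs_of_nonneg (dist_nonneg (x := x) (y := S.s i y)), ← Real.cosh_le_cosh, S.cosh_dist_s]
  constructor <;> intro h <;> linarith

theorem exists_simple_mul {w : M.Group} (hw : w ≠ 1) {x : X} (hx : x ∈ S.chamber) :
    ∃ i v, w = M.toCoxeterSystem.simple i * v ∧
      M.toCoxeterSystem.length v < M.toCoxeterSystem.length w ∧ 0 ≤ S.ℓ i (S.act v x) := by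
  obtain ⟨i, hi⟩ := M.toCoxeterSystem.exists_leftDescent_of_ne_one hw
  refine ⟨i, M.toCoxeterSystem.simple i * w,
    (M.toCoxeterSystem.simple_mul_simple_cancel_left i).symm, hi, S.ℓ_act_nonneg hx _ _ ?_⟩
  unfold IsLeftDescent at hi ⊢
  simp only [simple_mul_simple_cancel_left]
  omega

/-- Induction over the elements of the Coxeter group: the chamber `act w (chamber)` is reached
by successive reflections, each of them away from the fundamental chamber. -/
theorem act_induction {p : M.Group → Prop} {x : X} (hx : x ∈ S.chamber) (one : p 1)
    (step : ∀ i v, 0 ≤ S.ℓ i (S.act v x) → p v → p (M.toCoxeterSystem.simple i * v))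
    (w : M.Group) : p w := by
  induction hn : M.toCoxeterSystem.length w using Nat.strong_induction_on generalizing w with
  | _ n IH =>
  by_cases hw : w = 1
  · subst hw; exact one
  obtain ⟨i, v, rfl, hv, hl⟩ := S.exists_simple_mul hw hx
  exact step i v hl (IH _ (hn ▸ hv) v rfl)

/-- A nontrivial `w` ends with a reflection away from the chamber, which leaves the image on the
nonpositive side of that mirror. -/
theorem eq_one_of_act_mem_openChamber {x : X} (hx : x ∈ S.chamber) {w : M.Group}
    (h : S.act w x ∈ S.openChamber) : w = 1 := by
  by_contra hw
  obtain ⟨i, v, rfl, -, hl⟩ := S.exists_simple_mul hw hx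
  have := h i
  rw [act_simple_mul, ℓ_s_self] at this
  linarith

/-- Each reflection in the build-up of `w` carries the image of `y` across a mirror to the side away
from `x`, so the distance never decreases. -/
theorem dist_le_dist_act {x y : X} (hx : x ∈ S.chamber) (hy : y ∈ S.chamber) (w : M.Group) :
    dist x y ≤ dist x (S.act w y) := by
  induction w using S.act_induction hy with
  | one => simp
  | step i v hl ih =>
    refine ih.trans ?_
    rw [act_simple_mul, dist_le_dist_s_iff]
    exact mul_nonneg (hx i) hl

/-- If the last reflection returns the point to `x`, then `ℓ i` is nonnegative both at `x` and at
its mirror image. Hence `x` lies on that mirror, and the reflection can be removed. -/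
theorem mem_closure_of_act_eq {x : X} (hx : x ∈ S.chamber) {w : M.Group} (h : S.act w x = x) :
    w ∈ Subgroup.closure (M.toCoxeterSystem.simple '' {i | S.ℓ i x = 0}) := by
  induction w using S.act_induction hx with
  | one => exact Subgroup.one_mem _
  | step i v hl ih =>
    rw [act_simple_mul] at h
    have h1 : S.ℓ i x = -S.ℓ i (S.act v x) := by rw [← ℓ_s_self, h]
    have h0 : S.ℓ i x = 0 := le_antisymm (by linarith) (hx i)
    have h2 : S.act v x = x := by
      have h3 : S.s i x = x := by
        apply S.ext_ℓ
        intro j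
        rw [S.ℓ_s, h0]; ring
      apply (S.s i).injective
      rw [h, h3]
    exact Subgroup.mul_mem _ (Subgroup.subset_closure ⟨i, h0, rfl⟩) (ih h2)

/-- A nontrivial orientation preserving element fixes no point of the chamber outside the
intersections of two mirrors. -/
theorem exists_ne_of_act_eq {x : X} (hx : x ∈ S.chamber) {w : M.Group} (h : S.act w x = x)
    (hw : M.toCoxeterSystem.lengthParity w = 1) (hw1 : w ≠ 1) :
    ∃ i j, i ≠ j ∧ S.ℓ i x = 0 ∧ S.ℓ j x = 0 := by
  by_contra! hne
  have hmem := S.mem_closure_of_act_eq hx h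
  by_cases hz : ∃ i, S.ℓ i x = 0
  · obtain ⟨i, hi⟩ := hz
    have : {i | S.ℓ i x = 0} = {i} := by
      ext j
      simp only [Set.mem_ofPred_eq, Set.mem_singleton_iff]
      constructor
      · intro hj; by_contra hji; exact hne j i hji hj hi
      · rintro rfl; exact hi
    rw [this, Set.image_singleton, ← Subgroup.zpowers_eq_closure, Subgroup.mem_zpowers_iff] at hmem
    obtain ⟨k, rfl⟩ := hmem
    -- With a single mirror through `x` the stabilizer is `{1, s i}`, whose only nontrivial element
    -- has odd length.
    rcases Int.even_or_odd' k with ⟨n, rfl | rfl⟩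
    · apply hw1
      rw [zpow_mul, zpow_two, simple_mul_simple_self, one_zpow]
    · rw [zpow_add, zpow_mul, zpow_two, simple_mul_simple_self, one_zpow, one_mul, zpow_one,
        lengthParity_simple] at hw
      exact absurd hw (by decide)
  · have : {i | S.ℓ i x = 0} = ∅ := by
      ext j; simp only [Set.mem_ofPred_eq, Set.mem_empty_iff_false, iff_false]
      exact fun hj => hz ⟨j, hj⟩
    rw [this, Set.image_empty, Subgroup.closure_empty, Subgroup.mem_bot] at hmem
    exact hw1 hmem

theorem isOpen_openChamber [Finite B] : IsOpen S.openChamber := by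
  have : S.openChamber = ⋂ i, {x | 0 < S.ℓ i x} := by ext; simp [openChamber]
  rw [this]
  exact isOpen_iInter_of_finite fun i => isOpen_lt continuous_const (S.continuous_ℓ i)

theorem isClosed_chamber : IsClosed S.chamber := by
  have : S.chamber = ⋂ i, {x | 0 ≤ S.ℓ i x} := by ext; simp [chamber]
  rw [this]
  exact isClosed_iInter fun i => isClosed_le continuous_const (S.continuous_ℓ i)

/-- The images of the chamber cover the space. -/
theorem exists_act_mem_chamber [Finite B] [ProperSpace X] (hne : S.openChamber.Nonempty) (x : X) :
    ∃ w, S.act w x ∈ S.chamber := by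
  obtain ⟨p, hp⟩ := hne
  obtain ⟨ε, hε, hball⟩ := Metric.isOpen_iff.1 S.isOpen_openChamber p hp
  -- The orbit of an interior point is uniformly separated. By properness only finitely many of its
  -- points lie in a ball, so some orbit point is nearest to `x`.
  have hsep : ∀ v w : M.Group, v ≠ w → ε ≤ dist (S.act v p) (S.act w p) := by
    intro v w hvw
    by_contra! hlt
    have h1 : dist (S.act (v⁻¹ * w) p) p < ε := by
      rw [dist_comm, ← (S.act v).dist_eq, ← act_mul_apply]
      simpa using hlt
    have := S.eq_one_of_act_mem_openChamber (S.openChamber_subset hp) (hball h1)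
    exact hvw (inv_mul_eq_one.1 this)
  have hfin : {w : M.Group | S.act w p ∈ Metric.closedBall x (dist x p)}.Finite := by
    by_contra hinf
    obtain ⟨t, ht⟩ := (isCompact_closedBall x (dist x p)).finite_cover_balls (half_pos hε)
    obtain ⟨htx, htf, hcov⟩ := ht
    have hmap : ∀ w ∈ {w : M.Group | S.act w p ∈ Metric.closedBall x (dist x p)},
        ∃ y ∈ t, dist (S.act w p) y < ε / 2 := by
      intro w hw
      simpa using hcov hw
    have : Nonempty X := ⟨x⟩
    choose! f hf1 hf2 using hmap
    obtain ⟨v, hv, w, hw, hvw, he⟩ :=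
      Set.Infinite.exists_ne_map_eq_of_mapsTo hinf hf1 htf
    have h1 := hf2 v hv
    have h2 := hf2 w hw
    have h3 := dist_triangle_right (S.act v p) (S.act w p) (f v)
    rw [← he] at h2
    have := hsep v w hvw
    linarith
  obtain ⟨w, hw, hmin⟩ := Set.exists_min_image _ (fun w : M.Group => dist x (S.act w p)) hfin
    ⟨1, by simp [dist_comm]⟩
  have hmin' : ∀ v, dist x (S.act w p) ≤ dist x (S.act v p) := by
    intro v
    by_cases hv : S.act v p ∈ Metric.closedBall x (dist x p)
    · exact hmin v hv
    · have h1 : dist (S.act w p) x ≤ dist x p := hw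
      have h2 : ¬ dist (S.act v p) x ≤ dist x p := hv
      rw [dist_comm x, dist_comm x]; linarith
  -- Pulled back by `w`, the point `x` is at least as close to `p` as to each reflected point `s i
  -- p`, which means it is on the side of `p`.
  refine ⟨w⁻¹, fun i => ?_⟩
  have h := hmin' (w * M.toCoxeterSystem.simple i)
  have e1 : dist x (S.act w p) = dist (S.act w⁻¹ x) p := by
    rw [← (S.act w⁻¹).dist_eq, ← act_mul_apply]; simp
  have e2 : dist x (S.act (w * M.toCoxeterSystem.simple i) p) =
      dist (S.act w⁻¹ x) (S.s i p) := by
    rw [← (S.act w⁻¹).dist_eq, ← act_mul_apply, inv_mul_cancel_left, act_simple]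
  rw [e1, e2, dist_le_dist_s_iff] at h
  exact nonneg_of_mul_nonneg_left h (hp i)

/-! ### The orientation preserving subgroup -/

/-- Even words are products of pairs `s i * s j = (s i * s c) * (s j * s c)⁻¹`. The induction also
carries odd words, corrected by one factor `s c`. -/
theorem act_mem_of_lengthParity {G : Subgroup (X ≃ᵢ X)} (c : B)
    (hG : ∀ i, S.s i * S.s c ∈ G) {w : M.Group} (hw : M.toCoxeterSystem.lengthParity w = 1) :
    S.act w ∈ G := by
  have key : ∀ w, (M.toCoxeterSystem.lengthParity w = 1 → S.act w ∈ G) ∧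
      (M.toCoxeterSystem.lengthParity w ≠ 1 → S.act w * S.s c ∈ G) := by
    intro w
    clear hw
    induction w using M.toCoxeterSystem.simple_induction_right with
    | one => simp
    | mul_simple_right v i ih =>
      have hpar : ∀ a : Multiplicative (ZMod 2), a * Multiplicative.ofAdd 1 = 1 ↔ a ≠ 1 := by
        decide
      rw [map_mul, lengthParity_simple, map_mul, act_simple, Ne, hpar]
      constructor
      · intro h
        have h1 := G.mul_mem (ih.2 h) (G.inv_mem (hG i))
        have h2 : S.act v * S.s c * (S.s i * S.s c)⁻¹ = S.act v * S.s i := by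
          rw [mul_inv_rev, ← mul_assoc, mul_assoc _ (S.s c) (S.s c)⁻¹, mul_inv_cancel, mul_one,
            inv_eq_of_mul_eq_one_right (S.s_mul_s i)]
        rwa [h2] at h1
      · intro h
        rw [mul_assoc]
        exact G.mul_mem (ih.1 (not_not.1 h)) (hG i)
  exact (key w).1 hw

/-- Appending the reflection in a mirror through `P` changes the parity of `w` and not the image of
`P`. -/
theorem exists_lengthParity_eq_one {P : X} {i : B} (hi : S.ℓ i P = 0) (w : M.Group) :
    ∃ v, M.toCoxeterSystem.lengthParity v = 1 ∧ S.act v P = S.act w P := by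
  by_cases hw : M.toCoxeterSystem.lengthParity w = 1
  · exact ⟨w, hw, rfl⟩
  · refine ⟨w * M.toCoxeterSystem.simple i, ?_, ?_⟩
    · have hpar : ∀ a : Multiplicative (ZMod 2), a ≠ 1 → a * Multiplicative.ofAdd 1 = 1 := by
        decide
      rw [map_mul, lengthParity_simple]
      exact hpar _ hw
    · rw [act_mul_apply, act_simple]
      congr 1
      apply S.ext_ℓ
      intro j
      rw [S.ℓ_s, hi]; ring

/-! ### Dirichlet cells of vertices -/

/-- The Dirichlet cell of `P` for the reflection group. -/
def cell (P : X) : Set X := {Q | ∀ w, dist P Q ≤ dist (S.act w P) Q}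

section Vertex

variable {i j k : B} {P : X}

theorem s_eq_of_ℓ_eq_zero (hi : S.ℓ i P = 0) : S.s i P = P := by
  apply S.ext_ℓ
  intro l
  rw [S.ℓ_s, hi]; ring

/-- The first reflection that moves the vertex must be `s k`, and the later ones only increase the
distance. So the nearest other orbit point is `s k P`, which fixes the packing radius. -/
theorem act_eq_or_le_dist_act (hk : 0 ≤ S.ℓ k P) (hi : S.ℓ i P = 0) (hj : S.ℓ j P = 0)
    (h3 : ∀ l, l = i ∨ l = j ∨ l = k) (w : M.Group) :
    S.act w P = P ∨ 1 + 2 * S.ℓ k P ^ 2 ≤ Real.cosh (dist P (S.act w P)) := by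
  have hP : P ∈ S.chamber := by
    intro l
    rcases h3 l with rfl | rfl | rfl
    · exact hi.ge
    · exact hj.ge
    · exact hk
  induction w using S.act_induction hP with
  | one => simp
  | step l v hl ih =>
    rw [act_simple_mul]
    rcases ih with ih | ih
    · rw [ih]
      rcases h3 l with rfl | rfl | rfl
      · exact Or.inl (S.s_eq_of_ℓ_eq_zero hi)
      · exact Or.inl (S.s_eq_of_ℓ_eq_zero hj)
      · right
        rw [S.cosh_dist_s, dist_self, Real.cosh_zero]; linarith
    · right
      rw [S.cosh_dist_s]
      have := mul_nonneg (hP l) hl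
      linarith

/-- The elements of the dihedral group of the mirrors `i` and `j`. -/
def dihedral (M : CoxeterMatrix B) (i j : B) (n : ℤ) (e : Bool) : M.Group :=
  (M.toCoxeterSystem.simple i * M.toCoxeterSystem.simple j) ^ n *
    (if e then M.toCoxeterSystem.simple i else 1)

theorem exists_dihedral_eq (hM : M i j ≠ 0) (n : ℤ) (e : Bool) :
    ∃ a : Fin (M i j), dihedral M i j a e = dihedral M i j n e := by
  have hpos : (0 : ℤ) < M i j := by exact_mod_cast Nat.pos_of_ne_zero hM
  have h1 := Int.emod_nonneg n hpos.ne'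
  have h2 := Int.emod_lt_of_pos n hpos
  refine ⟨⟨(n % M i j).toNat, by omega⟩, ?_⟩
  simp only [dihedral, Int.toNat_of_nonneg h1]
  congr 1
  conv_rhs => rw [← Int.emod_add_mul_ediv n (M i j), zpow_add, zpow_mul, zpow_natCast,
    simple_mul_simple_pow, one_zpow, mul_one]

theorem dihedral_mul_left (n : ℤ) (e : Bool) :
    dihedral M i j n e * M.toCoxeterSystem.simple i = dihedral M i j n (!e) := by
  cases e
  · simp [dihedral]
  · simp only [dihedral, if_true, Bool.not_true, mul_assoc, simple_mul_simple_self]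
    simp

theorem dihedral_mul_right (n : ℤ) (e : Bool) :
    dihedral M i j n e * M.toCoxeterSystem.simple j =
      dihedral M i j (if e then n + 1 else n - 1) (!e) := by
  cases e
  · change _ ^ n * 1 * _ = _ ^ (n - 1) * M.toCoxeterSystem.simple i
    rw [zpow_sub_one, mul_one, mul_inv_rev, inv_simple, inv_simple, mul_assoc, mul_assoc,
      simple_mul_simple_self, mul_one]
  · simp [dihedral, zpow_add_one, mul_assoc]

theorem act_dihedral (hi : S.ℓ i P = 0) (hj : S.ℓ j P = 0) (n : ℤ) (e : Bool) :
    S.act (dihedral M i j n e) P = P := by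
  have h1 : ∀ f : X ≃ᵢ X, f P = P → ∀ n : ℤ, (f ^ n) P = P := by
    intro f hf n
    have hf' : f⁻¹ P = P := f.symm_apply_eq.2 hf.symm
    induction n using Int.induction_on with
    | zero => rfl
    | succ n ih =>
      rw [zpow_add_one]
      change (f ^ (n : ℤ)) (f P) = P
      rw [hf, ih]
    | pred n ih =>
      rw [zpow_sub_one]
      change (f ^ (-n : ℤ)) (f⁻¹ P) = P
      rw [hf', ih]
  have hi' := S.s_eq_of_ℓ_eq_zero hi
  have hj' := S.s_eq_of_ℓ_eq_zero hj
  rw [dihedral, act_mul_apply, map_zpow, map_mul, act_simple, act_simple]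
  have h2 : S.act (if e then M.toCoxeterSystem.simple i else 1) P = P := by
    cases e
    · simp
    · simpa only [if_true, act_simple] using hi'
  rw [h2]
  apply h1
  change S.s i (S.s j P) = P
  rw [hj', hi']

/-- A nontrivial rotation about the common points of two mirrors cannot preserve both `ℓ i` and `ℓ
j` at an interior point. -/
theorem pow_ne_one (hij : i ≠ j) (hne : S.openChamber.Nonempty) {n : ℕ} (h0 : 0 < n)
    (hn : n < M i j) :
    (M.toCoxeterSystem.simple i * M.toCoxeterSystem.simple j) ^ n ≠ 1 := by
  intro h
  obtain ⟨p, hp⟩ := hne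
  have hact : (S.s i * S.s j) ^ n = 1 := by
    rw [← S.act_simple, ← S.act_simple, ← map_mul, ← map_pow, h, map_one]
  obtain ⟨h1, h2⟩ := S.ℓ_s_mul_s_pow i j n p
  rw [hact] at h1 h2
  simp only [IsometryEquiv.coe_one, id] at h1 h2
  have hs := S.sin_pi_div_pos hij
  set θ := Real.pi / M i j with hθ
  have hMpos : (0 : ℝ) < M i j := by exact_mod_cast h0.trans hn
  have hsn : 0 < Real.sin (n * θ) := by
    apply Real.sin_pos_of_pos_of_lt_pi
    · have : (0 : ℝ) < n := by exact_mod_cast h0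
      have : 0 < θ := div_pos Real.pi_pos hMpos
      positivity
    · have : (n : ℝ) < M i j := by exact_mod_cast hn
      rw [hθ, mul_div_assoc', div_lt_iff₀ hMpos]
      nlinarith [Real.pi_pos]
  have e1 : Real.sin (2 * n * θ) = 2 * Real.sin (n * θ) * Real.cos (n * θ) := by
    rw [← Real.sin_two_mul]; ring_nf
  have e2 : Real.cos (2 * n * θ) = 1 - 2 * Real.sin (n * θ) ^ 2 := by
    rw [Real.sin_sq, show 2 * (n : ℝ) * θ = 2 * (n * θ) by ring, Real.cos_two_mul]; ring
  have e3 : Real.sin ((2 * n - 1) * θ) =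
      Real.sin (2 * n * θ) * Real.cos θ - Real.cos (2 * n * θ) * Real.sin θ := by
    rw [← Real.sin_sub]; ring_nf
  have e4 : Real.sin ((2 * n + 1) * θ) =
      Real.sin (2 * n * θ) * Real.cos θ + Real.cos (2 * n * θ) * Real.sin θ := by
    rw [← Real.sin_add]; ring_nf
  rw [e3, e1, e2] at h1
  rw [e4, e1, e2] at h2
  have hcs := Real.sin_sq_add_cos_sq (n * θ)
  have hcs' := Real.sin_sq_add_cos_sq θ
  set a := S.ℓ i p
  set b := S.ℓ j p
  set σ := Real.sin (n * θ)
  set c := Real.cos (n * θ)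
  have f1 : a * (c * Real.cos θ + σ * Real.sin θ) + b * c = 0 := by
    have : 2 * σ * (a * (c * Real.cos θ + σ * Real.sin θ) + b * c) = 0 := by
      linear_combination h1
    exact (mul_eq_zero.1 this).resolve_left (by positivity)
  have f2 : a * c + b * (c * Real.cos θ - σ * Real.sin θ) = 0 := by
    have : 2 * σ * (a * c + b * (c * Real.cos θ - σ * Real.sin θ)) = 0 := by
      linear_combination -h2
    exact (mul_eq_zero.1 this).resolve_left (by positivity)
  -- The linear system `f1`, `f2` in `a`, `b` has determinant `-sin θ ^ 2`.
  have f3 : Real.sin θ ^ 2 * a = 0 := by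
    linear_combination -(c * Real.cos θ - σ * Real.sin θ) * f1 + c * f2 +
      (-Real.sin θ ^ 2 * a) * hcs + a * c ^ 2 * hcs'
  have := hp i
  have : 0 < Real.sin θ ^ 2 * a := by positivity
  linarith

/-- Length parity separates rotations from reflections; within one class, two equal elements would
give a trivial power below the order. The dihedral group thus contributes exactly `2 * M i j`
chambers around the vertex. -/
theorem dihedral_injective (hij : i ≠ j) (hne : S.openChamber.Nonempty) :
    Function.Injective fun a : Fin (M i j) × Bool => dihedral M i j (a.1 : ℕ) a.2 := by
  have hwlog : ∀ m n : ℕ, m < n → n < M i j → ∀ e, dihedral M i j m e ≠ dihedral M i j n e := by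
    intro m n hmn hn e h
    rw [dihedral, dihedral, mul_left_inj, zpow_natCast, zpow_natCast] at h
    apply S.pow_ne_one hij hne (n := n - m) (by omega) (by omega)
    rw [pow_sub _ hmn.le, h, mul_inv_cancel]
  rintro ⟨a, e⟩ ⟨b, f⟩ h
  simp only at h
  have hpar : ∀ (n : ℤ) e, M.toCoxeterSystem.lengthParity (dihedral M i j n e) =
      if e then Multiplicative.ofAdd 1 else 1 := by
    intro n e
    rw [dihedral, map_mul, map_zpow, map_mul, lengthParity_simple, lengthParity_simple]
    have : (Multiplicative.ofAdd 1 * Multiplicative.ofAdd 1 : Multiplicative (ZMod 2)) = 1 := by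
      decide
    rw [this, one_zpow, one_mul]
    cases e
    · simp
    · simp only [if_true, lengthParity_simple]
  have hef : e = f := by
    have h' := congrArg M.toCoxeterSystem.lengthParity h
    rw [hpar, hpar] at h'
    revert h'
    cases e <;> cases f <;> decide
  subst hef
  have hab : (a : ℕ) = b := by
    rcases lt_trichotomy (a : ℕ) b with hlt | heq | hlt
    · exact absurd h (hwlog _ _ hlt b.2 e)
    · exact heq
    · exact absurd h.symm (hwlog _ _ hlt a.2 e)
  rw [Fin.ext hab]

variable [MeasurableSpace X] {μ : Measure X}

theorem measurePreserving_act (hμ : ∀ i, MeasurePreserving (S.s i) μ μ) (w : M.Group) :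
    MeasurePreserving (S.act w) μ μ := by
  induction w using M.toCoxeterSystem.simple_induction_left with
  | one => rw [map_one]; exact MeasurePreserving.id μ
  | mul_simple_left w i ih =>
    rw [map_mul, act_simple]
    exact (hμ i).comp ih

/-- The area of the Dirichlet cell of a vertex. -/
theorem measure_cell [BorelSpace X] [Finite B] (hμ : ∀ i, MeasurePreserving (S.s i) μ μ)
    (hc : μ S.openChamber = μ S.chamber) (hne : S.openChamber.Nonempty) (hij : i ≠ j)
    (hk : 0 < S.ℓ k P) (hi : S.ℓ i P = 0) (hj : S.ℓ j P = 0)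
    (h3 : ∀ l, l = i ∨ l = j ∨ l = k) :
    μ (S.cell P) = 2 * M i j * μ S.chamber := by
  have hP : P ∈ S.chamber := by
    intro l
    rcases h3 l with rfl | rfl | rfl
    · exact hi.ge
    · exact hj.ge
    · exact hk.le
  set D : Fin (M i j) × Bool → M.Group := fun a => dihedral M i j (a.1 : ℕ) a.2 with hD
  have hDP : ∀ a, S.act (D a) P = P := fun a => S.act_dihedral hi hj _ _
  have hDP' : ∀ a, S.act (D a)⁻¹ P = P := by
    intro a
    nth_rw 1 [← hDP a]
    rw [← act_mul_apply, inv_mul_cancel, map_one]; rfl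
  have hcard : Fintype.card (Fin (M i j) × Bool) = 2 * M i j := by simp [mul_comm]
  have hconst : ∀ t : Set X, ∑ _a : Fin (M i j) × Bool, μ t = 2 * M i j * μ t := by
    intro t
    rw [Finset.sum_const, Finset.card_univ, hcard, nsmul_eq_mul]
    push_cast; rfl
  apply le_antisymm
  -- Choosing the dihedral image of `Q` nearest to an interior point `p` gives the signs of `ℓ i`
  -- and `ℓ j`. The cell condition against the neighbour across mirror `k` gives the third sign.
  · have hsub : S.cell P ⊆ ⋃ a, S.act (D a)⁻¹ ⁻¹' S.chamber := by
      intro Q hQ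
      obtain ⟨p, hp⟩ := hne
      have : Nonempty (Fin (M i j) × Bool) :=
        ⟨(⟨0, Nat.pos_of_ne_zero (S.ne_zero i j)⟩, true)⟩
      obtain ⟨a, ha⟩ := Finite.exists_min fun a => dist p (S.act (D a)⁻¹ Q)
      have hmin : ∀ (n : ℤ) e, dist p (S.act (D a)⁻¹ Q) ≤
          dist p (S.act (dihedral M i j n e)⁻¹ Q) := by
        intro n e
        obtain ⟨b, hb⟩ := exists_dihedral_eq (S.ne_zero i j) n e
        rw [← hb]
        exact ha (b, e)
      refine Set.mem_iUnion.2 ⟨a, fun l => ?_⟩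
      rcases h3 l with rfl | rfl | rfl
      · have h := hmin a.1 (!a.2)
        rw [← dihedral_mul_left, mul_inv_rev, inv_simple, act_simple_mul,
          dist_le_dist_s_iff] at h
        exact nonneg_of_mul_nonneg_right h (hp _)
      · have h := hmin (if a.2 then ((a.1 : ℕ) : ℤ) + 1 else ((a.1 : ℕ) : ℤ) - 1) (!a.2)
        rw [← dihedral_mul_right, mul_inv_rev, inv_simple, act_simple_mul,
          dist_le_dist_s_iff] at h
        exact nonneg_of_mul_nonneg_right h (hp _)
      · have h := hQ (D a * M.toCoxeterSystem.simple l)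
        have e1 : dist P Q = dist P (S.act (D a)⁻¹ Q) := by
          nth_rw 2 [← hDP' a]
          rw [(S.act (D a)⁻¹).dist_eq]
        have e2 : dist (S.act (D a * M.toCoxeterSystem.simple l) P) Q =
            dist P (S.s l (S.act (D a)⁻¹ Q)) := by
          have e3 : S.act (D a) (S.act (D a)⁻¹ Q) = Q := by
            rw [← act_mul_apply, mul_inv_cancel, map_one]; rfl
          rw [← (S.s l).dist_eq P, S.s_s, ← (S.act (D a)).dist_eq (S.s l P), e3, ← act_simple,
            ← act_mul_apply]
        rw [e1, e2, dist_le_dist_s_iff] at h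
        exact nonneg_of_mul_nonneg_right h hk
    calc μ (S.cell P) ≤ μ (⋃ a, S.act (D a)⁻¹ ⁻¹' S.chamber) := measure_mono hsub
      _ ≤ ∑ a, μ (S.act (D a)⁻¹ ⁻¹' S.chamber) := measure_iUnion_fintype_le _ _
      _ = ∑ _a : Fin (M i j) × Bool, μ S.chamber := by
        refine Finset.sum_congr rfl fun a _ => ?_
        exact (S.measurePreserving_act hμ _).measure_preimage
          S.isClosed_chamber.measurableSet.nullMeasurableSet
      _ = _ := hconst _
  -- Conversely the open chambers around the vertex are disjoint and lie in the cell. The two bounds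
  -- agree because the boundary of the chamber is null.
  · have hsub : (⋃ a, S.act (D a)⁻¹ ⁻¹' S.openChamber) ⊆ S.cell P := by
      intro Q hQ w
      obtain ⟨a, ha⟩ := Set.mem_iUnion.1 hQ
      have h := S.dist_le_dist_act (S.openChamber_subset ha) hP ((D a)⁻¹ * w)
      rw [act_mul_apply, (S.act (D a)⁻¹).dist_eq] at h
      nth_rw 1 [← hDP' a] at h
      rwa [(S.act (D a)⁻¹).dist_eq, dist_comm, dist_comm Q] at h
    calc 2 * M i j * μ S.chamber = ∑ _a : Fin (M i j) × Bool, μ S.openChamber := by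
          rw [hconst, hc]
      _ = ∑ a, μ (S.act (D a)⁻¹ ⁻¹' S.openChamber) := by
        refine Finset.sum_congr rfl fun a _ => ?_
        exact ((S.measurePreserving_act hμ _).measure_preimage
          S.isOpen_openChamber.measurableSet.nullMeasurableSet).symm
      _ = μ (⋃ a, S.act (D a)⁻¹ ⁻¹' S.openChamber) := by
        rw [measure_iUnion, tsum_fintype]
        · intro a b hab
          refine Set.disjoint_left.2 fun Q ha hb => hab ?_
          have h1 : S.act ((D b)⁻¹ * D a) (S.act (D a)⁻¹ Q) ∈ S.openChamber := by
            rw [← act_mul_apply, mul_assoc, mul_inv_cancel, mul_one]; exact hb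
          have h2 := S.eq_one_of_act_mem_openChamber (S.openChamber_subset ha) h1
          exact S.dihedral_injective hij hne (inv_mul_eq_one.1 h2).symm
        · intro a
          exact (S.measurePreserving_act hμ _).measurable S.isOpen_openChamber.measurableSet
      _ ≤ μ (S.cell P) := measure_mono hsub

end Vertex

end MirrorSystem

namespace UpperHalfPlane

/-! ### Hyperboloid coordinates on the upper half-plane -/

/-- The light cone coordinate `|z|² / im z`. -/
def coordP (z : UpperHalfPlane) : ℝ := (z.re ^ 2 + z.im ^ 2) / z.im

/-- The light cone coordinate `1 / im z`. -/
def coordQ (z : UpperHalfPlane) : ℝ := 1 / z.im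

/-- The spacelike coordinate `re z / im z`. -/
def coordT (z : UpperHalfPlane) : ℝ := z.re / z.im

theorem coordQ_pos (z : UpperHalfPlane) : 0 < coordQ z := one_div_pos.2 z.im_pos

theorem coordP_pos (z : UpperHalfPlane) : 0 < coordP z :=
  div_pos (by have := z.im_pos; positivity) z.im_pos

theorem coordP_mul_coordQ (z : UpperHalfPlane) : coordP z * coordQ z = 1 + coordT z ^ 2 := by
  have := z.im_ne_zero
  simp only [coordP, coordQ, coordT]; field_simp; ring

theorem cosh_dist_eq_coord (z w : UpperHalfPlane) : Real.cosh (dist z w) =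
    (coordP z * coordQ w + coordQ z * coordP w) / 2 - coordT z * coordT w := by
  have := z.im_ne_zero
  have := w.im_ne_zero
  rw [cosh_dist']
  simp only [coordP, coordQ, coordT]; field_simp; ring

theorem ext_coord {z w : UpperHalfPlane} (hq : coordQ z = coordQ w) (ht : coordT z = coordT w) :
    z = w := by
  have h1 : z.im = w.im := by
    simpa [coordQ] using hq
  have h2 : z.re = w.re := by
    simp only [coordT, h1] at ht
    exact (div_left_inj' w.im_ne_zero).1 ht
  exact UpperHalfPlane.ext (Complex.ext h2 h1)

theorem continuous_coordP : Continuous coordP :=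
  ((continuous_re.pow 2).add (continuous_im.pow 2)).div continuous_im fun z => z.im_ne_zero

theorem continuous_coordQ : Continuous coordQ :=
  continuous_const.div continuous_im fun z => z.im_ne_zero

theorem continuous_coordT : Continuous coordT :=
  continuous_re.div continuous_im fun z => z.im_ne_zero

/-- The coordinates are the entries of the symmetric matrix `!![P, T; T, Q]` of determinant `1`, on
which `g` acts by congruence `X ↦ g X gᵀ`. -/
theorem coord_smul (g : SL(2, ℝ)) (z : UpperHalfPlane) :
    coordP (g • z) =
      g 0 0 ^ 2 * coordP z + 2 * g 0 0 * g 0 1 * coordT z + g 0 1 ^ 2 * coordQ z ∧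
    coordQ (g • z) =
      g 1 0 ^ 2 * coordP z + 2 * g 1 0 * g 1 1 * coordT z + g 1 1 ^ 2 * coordQ z ∧
    coordT (g • z) =
      g 0 0 * g 1 0 * coordP z + (g 0 0 * g 1 1 + g 0 1 * g 1 0) * coordT z +
        g 0 1 * g 1 1 * coordQ z := by
  have hy := z.im_pos
  set x := z.re
  set y := z.im
  have hdet : g 0 0 * g 1 1 - g 0 1 * g 1 0 = 1 := by
    have := g.det_coe; rwa [Matrix.det_fin_two] at this
  generalize ha : g 0 0 = a at *
  generalize hb : g 0 1 = b at *
  generalize hc : g 1 0 = c at *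
  generalize hd : g 1 1 = d at *
  have hD : 0 < (c * x + d) ^ 2 + (c * y) ^ 2 := by
    by_contra! h
    have h1 : c * y = 0 := by nlinarith [sq_nonneg (c * x + d), sq_nonneg (c * y)]
    have h2 : c = 0 := (mul_eq_zero.1 h1).resolve_right hy.ne'
    have h3 : c * x + d = 0 := by nlinarith [sq_nonneg (c * x + d), sq_nonneg (c * y)]
    rw [h2] at h3 hdet
    have : d = 0 := by linarith
    rw [this] at hdet
    simp at hdet
  have hcoe : ((g • z : UpperHalfPlane) : ℂ) = (a * z + b) / (c * z + d) := by
    rw [coe_specialLinearGroup_apply]; simp [ha, hb, hc, hd]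
  have hns : Complex.normSq (c * z + d) = (c * x + d) ^ 2 + (c * y) ^ 2 := by
    rw [Complex.normSq_apply]; simp [x, y]; ring
  have him : (g • z).im = y / ((c * x + d) ^ 2 + (c * y) ^ 2) := by
    change ((g • z : UpperHalfPlane) : ℂ).im = _
    rw [hcoe, Complex.div_im, hns]
    simp only [Complex.add_re, Complex.add_im, Complex.mul_re, Complex.mul_im, Complex.ofReal_re,
      Complex.ofReal_im, coe_re, coe_im]
    rw [← sub_div, div_left_inj' hD.ne']
    linear_combination y * hdet
  have hre : (g • z).re = (a * c * (x ^ 2 + y ^ 2) + (a * d + b * c) * x + b * d) /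
      ((c * x + d) ^ 2 + (c * y) ^ 2) := by
    change ((g • z : UpperHalfPlane) : ℂ).re = _
    rw [hcoe, Complex.div_re, hns]
    simp only [Complex.add_re, Complex.add_im, Complex.mul_re, Complex.mul_im, Complex.ofReal_re,
      Complex.ofReal_im, coe_re, coe_im]
    rw [← add_div, div_left_inj' hD.ne']
    ring
  obtain ⟨N, hN⟩ : ∃ N, N = (c * x + d) ^ 2 + (c * y) ^ 2 := ⟨_, rfl⟩
  rw [← hN] at him hre hD
  simp only [coordP, coordQ, coordT, him, hre]
  change _ = _ * ((x ^ 2 + y ^ 2) / y) + _ * (x / y) + _ * (1 / y) ∧ _ =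
    _ * ((x ^ 2 + y ^ 2) / y) + _ * (x / y) + _ * (1 / y) ∧ _ =
    _ * ((x ^ 2 + y ^ 2) / y) + _ * (x / y) + _ * (1 / y)
  refine ⟨?_, ?_, ?_⟩
  · have e : (a * c * (x ^ 2 + y ^ 2) + (a * d + b * c) * x + b * d) ^ 2 + y ^ 2 =
        ((a * x + b) ^ 2 + (a * y) ^ 2) * ((c * x + d) ^ 2 + (c * y) ^ 2) := by
      linear_combination -y ^ 2 * (a * d - b * c + 1) * hdet
    rw [div_pow, div_pow, ← add_div, e, ← hN]
    field_simp
    ring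
  · rw [one_div_div, hN]; field_simp; ring
  · field_simp

/-- The reflection `z ↦ -conj z` of the upper half-plane. -/
def reflection : UpperHalfPlane ≃ᵢ UpperHalfPlane where
  toFun z := J • z
  invFun z := J • z
  left_inv z := by change J • (J • z) = z; rw [smul_smul, ← sq, J_sq, one_smul]
  right_inv z := by change J • (J • z) = z; rw [smul_smul, ← sq, J_sq, one_smul]
  isometry_toFun := by
    refine Isometry.of_dist_eq fun z w => ?_
    have h : ∀ z : UpperHalfPlane, (J • z).re = -z.re ∧ (J • z).im = z.im := by
      intro z
      have := coe_J_smul z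
      constructor
      · rw [← coe_re, this]; simp
      · rw [← coe_im, this]; simp
    change dist (J • z) (J • w) = _
    apply Real.cosh_strictMonoOn.injOn (Set.mem_Ici.2 dist_nonneg) (Set.mem_Ici.2 dist_nonneg)
    rw [cosh_dist', cosh_dist', (h z).1, (h z).2, (h w).1, (h w).2]
    congr 1
    ring

theorem reflection_re (z : UpperHalfPlane) : (reflection z).re = -z.re := by
  change (J • z).re = _
  rw [← coe_re, coe_J_smul]; simp

theorem reflection_im (z : UpperHalfPlane) : (reflection z).im = z.im := by
  change (J • z).im = _
  rw [← coe_im, coe_J_smul]; simp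

theorem coord_reflection (z : UpperHalfPlane) : coordP (reflection z) = coordP z ∧
    coordQ (reflection z) = coordQ z ∧ coordT (reflection z) = -coordT z := by
  simp only [coordP, coordQ, coordT, reflection_re, reflection_im]
  refine ⟨by ring, trivial, by ring⟩

theorem measurePreserving_reflection :
    MeasurePreserving reflection (volume : Measure UpperHalfPlane) volume :=
  measurePreserving_smul J volume

theorem measurePreserving_constSMul (g : SL(2, ℝ)) :
    MeasurePreserving (IsometryEquiv.constSMul g : UpperHalfPlane ≃ᵢ UpperHalfPlane)
      volume volume :=
  measurePreserving_smul (g : GL (Fin 2) ℝ) volume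

theorem measurePreserving_hypRotation (P : UpperHalfPlane) (θ : ℝ) :
    MeasurePreserving (hypRotation P θ) volume volume :=
  measurePreserving_constSMul _

/-- The point `i b`. -/
def imPoint (b : ℝ) (hb : 0 < b) : UpperHalfPlane := ⟨⟨0, b⟩, hb⟩

theorem coord_hypRotation_imPoint (b : ℝ) (hb : 0 < b) (θ : ℝ) (z : UpperHalfPlane) :
    coordP (hypRotation (imPoint b hb) (2 * θ) z) = Real.cos θ ^ 2 * coordP z +
      2 * b * Real.sin θ * Real.cos θ * coordT z + b ^ 2 * Real.sin θ ^ 2 * coordQ z ∧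
    coordQ (hypRotation (imPoint b hb) (2 * θ) z) = Real.sin θ ^ 2 / b ^ 2 * coordP z -
      2 * Real.sin θ * Real.cos θ / b * coordT z + Real.cos θ ^ 2 * coordQ z ∧
    coordT (hypRotation (imPoint b hb) (2 * θ) z) = -(Real.sin θ * Real.cos θ / b) * coordP z +
      (Real.cos θ ^ 2 - Real.sin θ ^ 2) * coordT z + b * Real.sin θ * Real.cos θ * coordQ z := by
  set g : SL(2, ℝ) := (imPoint b hb).toSL2R * rotMatrix (2 * θ) * (imPoint b hb).toSL2R⁻¹ with hg
  have hs : √b ≠ 0 := (Real.sqrt_pos.2 hb).ne'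
  have hss : √b * √b = b := Real.mul_self_sqrt hb.le
  have hss2 : √b ^ 2 = b := Real.sq_sqrt hb.le
  have hmat : (g : Matrix (Fin 2) (Fin 2) ℝ) =
      !![Real.cos θ, b * Real.sin θ; -Real.sin θ / b, Real.cos θ] := by
    have him : (imPoint b hb).im = b := rfl
    have hre : (imPoint b hb).re = 0 := rfl
    have hrot : (rotMatrix (2 * θ) : Matrix (Fin 2) (Fin 2) ℝ) =
        !![Real.cos θ, Real.sin θ; -Real.sin θ, Real.cos θ] := by
      change !![Real.cos (2 * θ / 2), Real.sin (2 * θ / 2); -Real.sin (2 * θ / 2),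
        Real.cos (2 * θ / 2)] = _
      rw [show 2 * θ / 2 = θ by ring]
    rw [hg]
    simp only [Matrix.SpecialLinearGroup.coe_mul, Matrix.SpecialLinearGroup.coe_inv,
      coe_toSL2R, him, hre, hrot, Matrix.adjugate_fin_two_of]
    ext i j
    fin_cases i <;> fin_cases j <;> simp [Matrix.mul_apply, Fin.sum_univ_two] <;> field_simp <;>
      simp [hss2, mul_comm]
  have h00 : g 0 0 = Real.cos θ := by rw [hmat]; rfl
  have h01 : g 0 1 = b * Real.sin θ := by rw [hmat]; rfl
  have h10 : g 1 0 = -Real.sin θ / b := by rw [hmat]; rfl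
  have h11 : g 1 1 = Real.cos θ := by rw [hmat]; rfl
  have h := coord_smul g z
  rw [h00, h01, h10, h11] at h
  obtain ⟨h1, h2, h3⟩ := h
  change coordP (g • z) = _ ∧ coordQ (g • z) = _ ∧ coordT (g • z) = _
  rw [h1, h2, h3]
  refine ⟨by ring, by field_simp; ring, by field_simp; ring⟩

end UpperHalfPlane

/-! ### A standard triangle with `A = i` and `B = i b`. -/

/-- A mirror system transported along an isometry. -/
def MirrorSystem.conj {B X Y : Type*} {M : CoxeterMatrix B} [MetricSpace X] [MetricSpace Y]
    (S : MirrorSystem M X) (φ : Y ≃ᵢ X) : MirrorSystem M Y where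
  s i := (φ.trans (S.s i)).trans φ.symm
  ℓ i y := S.ℓ i (φ y)
  ne_zero := S.ne_zero
  ℓ_s i j y := by
    simp only [IsometryEquiv.trans_apply, IsometryEquiv.apply_symm_apply]
    exact S.ℓ_s i j (φ y)
  cosh_dist_s i x y := by
    rw [← φ.dist_eq x y, ← S.cosh_dist_s, ← φ.dist_eq]
    simp only [IsometryEquiv.trans_apply, IsometryEquiv.apply_symm_apply]
  ext_ℓ x y h := φ.injective (S.ext_ℓ _ _ h)
  continuous_ℓ i := (S.continuous_ℓ i).comp φ.continuous

/-- The Coxeter matrix of the reflection group of a triangle with angles `π / 2`, `π / p₁`,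
`π / p₂` at `A`, `B`, `C`; the mirrors `0`, `1`, `2` are the sides `BC`, `AC`, `AB`. -/
def triangleMatrix (p₁ p₂ : ℕ) (h₁ : p₁ ≠ 1) (h₂ : p₂ ≠ 1) : CoxeterMatrix (Fin 3) where
  M := !![1, p₂, p₁; p₂, 1, 2; p₁, 2, 1]
  isSymm := by ext i j; fin_cases i <;> fin_cases j <;> rfl
  diagonal i := by fin_cases i <;> rfl
  off_diagonal i j hij := by
    fin_cases i <;> fin_cases j <;> simp_all

namespace UpperHalfPlane

/-- The signed distances to the sides of the standard triangle. -/
def stdℓ (b β : ℝ) : Fin 3 → UpperHalfPlane → ℝ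
  | 0, z => (Real.sin β * (b * coordQ z - coordP z / b) - 2 * Real.cos β * coordT z) / 2
  | 1, z => (coordP z - coordQ z) / 2
  | 2, z => coordT z

/-- The reflections in the sides of the standard triangle. -/
def stdS (b : ℝ) (hb : 0 < b) (β : ℝ) : Fin 3 → UpperHalfPlane ≃ᵢ UpperHalfPlane
  | 0 => hypRotation (imPoint b hb) (2 * β) * reflection
  | 1 => hypRotation I Real.pi * reflection
  | 2 => reflection

theorem imPoint_one : imPoint 1 one_pos = I := by
  apply UpperHalfPlane.ext; apply Complex.ext <;> simp [imPoint]

theorem coord_stdS_zero (b : ℝ) (hb : 0 < b) (β : ℝ) (z : UpperHalfPlane) :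
    coordP (stdS b hb β 0 z) = coordP z + 2 * b * Real.sin β * stdℓ b β 0 z ∧
    coordQ (stdS b hb β 0 z) = coordQ z - 2 / b * Real.sin β * stdℓ b β 0 z ∧
    coordT (stdS b hb β 0 z) = coordT z + 2 * Real.cos β * stdℓ b β 0 z := by
  have h := coord_hypRotation_imPoint b hb β (reflection z)
  obtain ⟨e1, e2, e3⟩ := coord_reflection z
  rw [e1, e2, e3] at h
  have hc := Real.sin_sq_add_cos_sq β
  obtain ⟨h1, h2, h3⟩ := h
  refine ⟨h1.trans ?_, h2.trans ?_, h3.trans ?_⟩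
  · simp only [stdℓ]; field_simp
    linear_combination coordP z * hc
  · simp only [stdℓ]; field_simp
    linear_combination b ^ 2 * coordQ z * hc
  · simp only [stdℓ]; field_simp
    linear_combination b * coordT z * hc

theorem coord_stdS_one (b : ℝ) (hb : 0 < b) (β : ℝ) (z : UpperHalfPlane) :
    coordP (stdS b hb β 1 z) = coordQ z ∧ coordQ (stdS b hb β 1 z) = coordP z ∧
    coordT (stdS b hb β 1 z) = coordT z := by
  have h := coord_hypRotation_imPoint 1 one_pos (Real.pi / 2) (reflection z)
  obtain ⟨e1, e2, e3⟩ := coord_reflection z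
  rw [e1, e2, e3, imPoint_one, mul_div_cancel₀ _ (two_ne_zero)] at h
  obtain ⟨h1, h2, h3⟩ := h
  refine ⟨h1.trans ?_, h2.trans ?_, h3.trans ?_⟩ <;> simp

/-- The reflections in the sides of the standard triangle with vertices `I`, `b I`. -/
def stdMirrors (p₁ p₂ : ℕ) (h₁ : 3 ≤ p₁) (h₂ : 3 ≤ p₂) (b : ℝ) (hb : 1 < b)
    (hbc : Real.sin (Real.pi / p₁) * (b + 1 / b) = 2 * Real.cos (Real.pi / p₂)) :
    MirrorSystem (triangleMatrix p₁ p₂ (by omega) (by omega)) UpperHalfPlane where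
  s := stdS b (by linarith) (Real.pi / p₁)
  ℓ := stdℓ b (Real.pi / p₁)
  ne_zero i j := by
    have : p₁ ≠ 0 := by omega
    have : p₂ ≠ 0 := by omega
    fin_cases i <;> fin_cases j <;> simp [triangleMatrix, *]
  ℓ_s i j z := by
    have hb0 : 0 < b := by linarith
    obtain ⟨a1, a2, a3⟩ := coord_stdS_zero b hb0 (Real.pi / p₁) z
    obtain ⟨b1, b2, b3⟩ := coord_stdS_one b hb0 (Real.pi / p₁) z
    obtain ⟨c1, c2, c3⟩ := coord_reflection z
    have hc := Real.sin_sq_add_cos_sq (Real.pi / p₁)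
    have m01 : triangleMatrix p₁ p₂ (by omega) (by omega) 0 1 = p₂ := rfl
    have m10 : triangleMatrix p₁ p₂ (by omega) (by omega) 1 0 = p₂ := rfl
    have m02 : triangleMatrix p₁ p₂ (by omega) (by omega) 0 2 = p₁ := rfl
    have m20 : triangleMatrix p₁ p₂ (by omega) (by omega) 2 0 = p₁ := rfl
    have m12 : triangleMatrix p₁ p₂ (by omega) (by omega) 1 2 = 2 := rfl
    have m21 : triangleMatrix p₁ p₂ (by omega) (by omega) 2 1 = 2 := rfl
    have m00 : triangleMatrix p₁ p₂ (by omega) (by omega) 0 0 = 1 := rfl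
    have m11 : triangleMatrix p₁ p₂ (by omega) (by omega) 1 1 = 1 := rfl
    have m22 : triangleMatrix p₁ p₂ (by omega) (by omega) 2 2 = 1 := rfl
    -- This is `cosh AB * sin β = cos γ` without denominators; it says that mirrors `0` and `1` meet
    -- at the angle `π / p₂`.
    have hbc' : Real.sin (Real.pi / p₁) * (b ^ 2 + 1) = 2 * b * Real.cos (Real.pi / p₂) := by
      field_simp at hbc; linarith
    fin_cases i <;> fin_cases j
    · change stdℓ _ _ 0 _ = stdℓ _ _ 0 _ + _ * stdℓ _ _ 0 _
      simp only [Fin.zero_eta, m00]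
      conv_lhs => rw [stdℓ, a1, a2, a3]
      simp only [stdℓ, Nat.cast_one, div_one, Real.cos_pi]
      field_simp
      linear_combination -(2 * (Real.sin (Real.pi / p₁) * (b ^ 2 * coordQ z - coordP z) -
        2 * b * Real.cos (Real.pi / p₁) * coordT z)) * hc
    · change stdℓ _ _ 1 _ = stdℓ _ _ 1 _ + _ * stdℓ _ _ 0 _
      simp only [Fin.zero_eta, Fin.mk_one, m01]
      conv_lhs => rw [stdℓ, a1, a2]
      simp only [stdℓ]
      field_simp
      linear_combination (Real.sin (Real.pi / p₁) * (b ^ 2 * coordQ z - coordP z) -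
        2 * b * Real.cos (Real.pi / p₁) * coordT z) * hbc'
    · exact a3
    · change stdℓ _ _ 0 _ = stdℓ _ _ 0 _ + _ * stdℓ _ _ 1 _
      simp only [Fin.zero_eta, Fin.mk_one, m10]
      conv_lhs => rw [stdℓ, b1, b2, b3]
      simp only [stdℓ]
      field_simp
      linear_combination (coordP z - coordQ z) * hbc'
    · change stdℓ _ _ 1 _ = stdℓ _ _ 1 _ + _ * stdℓ _ _ 1 _
      simp only [Fin.mk_one, m11]
      conv_lhs => rw [stdℓ, b1, b2]
      simp only [stdℓ, Nat.cast_one, div_one, Real.cos_pi]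
      ring
    · change stdℓ _ _ 2 (stdS b hb0 (Real.pi / p₁) 1 z) = stdℓ _ _ 2 _ +
        2 * Real.cos (Real.pi / (2 : ℕ)) * stdℓ _ _ 1 _
      conv_lhs => rw [stdℓ, b3]
      simp [stdℓ]
    · change stdℓ _ _ 0 _ = stdℓ _ _ 0 _ + 2 * Real.cos (Real.pi / p₁) * stdℓ _ _ 2 _
      change stdℓ _ _ 0 (reflection z) = _
      conv_lhs => rw [stdℓ, c1, c2, c3]
      simp only [stdℓ]
      ring
    · change stdℓ _ _ 1 (reflection z) = stdℓ _ _ 1 _ +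
        2 * Real.cos (Real.pi / (2 : ℕ)) * stdℓ _ _ 2 _
      conv_lhs => rw [stdℓ, c1, c2]
      simp [stdℓ]
    · change stdℓ _ _ 2 (reflection z) = stdℓ _ _ 2 _ +
        2 * Real.cos (Real.pi / (1 : ℕ)) * stdℓ _ _ 2 _
      conv_lhs => rw [stdℓ, c3]
      simp only [stdℓ, Nat.cast_one, div_one, Real.cos_pi]
      ring
  cosh_dist_s i z w := by
    have hb0 : 0 < b := by linarith
    obtain ⟨a1, a2, a3⟩ := coord_stdS_zero b hb0 (Real.pi / p₁) w
    obtain ⟨b1, b2, b3⟩ := coord_stdS_one b hb0 (Real.pi / p₁) w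
    obtain ⟨c1, c2, c3⟩ := coord_reflection w
    rw [cosh_dist_eq_coord, cosh_dist_eq_coord]
    fin_cases i
    · simp only [Fin.zero_eta, a1, a2, a3]
      simp only [stdℓ]
      field_simp
      ring
    · simp only [Fin.mk_one, b1, b2, b3, stdℓ]
      ring
    · change (_ * coordQ (reflection w) + _ * coordP (reflection w)) / 2 -
        _ * coordT (reflection w) = _ + 2 * stdℓ _ _ 2 z * stdℓ _ _ 2 w
      simp only [c1, c2, c3, stdℓ]
      ring
  ext_ℓ z w h := by
    have h0 := h 0
    have h1 := h 1
    have h2 := h 2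
    simp only [stdℓ] at h0 h1 h2
    have hb0 : 0 < b := by linarith
    have hs : 0 < Real.sin (Real.pi / p₁) := by
      have : (3 : ℝ) ≤ p₁ := by exact_mod_cast h₁
      apply Real.sin_pos_of_pos_of_lt_pi
      · positivity
      · rw [div_lt_iff₀ (by linarith)]; nlinarith [Real.pi_pos]
    refine ext_coord ?_ h2
    rw [h2] at h0
    have h3 : Real.sin (Real.pi / p₁) * (b * coordQ z - coordP z / b) =
        Real.sin (Real.pi / p₁) * (b * coordQ w - coordP w / b) := by linarith
    have h4 := mul_left_cancel₀ hs.ne' h3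
    field_simp at h4
    have h5 : (b ^ 2 - 1) * coordQ z = (b ^ 2 - 1) * coordQ w := by linarith
    exact mul_left_cancel₀ (by nlinarith) h5
  continuous_ℓ i := by
    have hP := continuous_coordP
    have hQ := continuous_coordQ
    have hT := continuous_coordT
    fin_cases i
    · change Continuous fun z => (Real.sin (Real.pi / p₁) * (b * coordQ z - coordP z / b) -
        2 * Real.cos (Real.pi / p₁) * coordT z) / 2
      fun_prop
    · change Continuous fun z => (coordP z - coordQ z) / 2
      fun_prop
    · exact hT

end UpperHalfPlane

/-! ### Moving configurations into standard position. -/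

namespace UpperHalfPlane

theorem coord_I : coordP I = 1 ∧ coordQ I = 1 ∧ coordT I = 0 := by
  simp [coordP, coordQ, coordT]

theorem coord_imPoint (b : ℝ) (hb : 0 < b) : coordP (imPoint b hb) = b ∧
    coordQ (imPoint b hb) = 1 / b ∧ coordT (imPoint b hb) = 0 := by
  have h1 : (imPoint b hb).im = b := rfl
  have h2 : (imPoint b hb).re = 0 := rfl
  simp only [coordP, coordQ, coordT, h1, h2]
  refine ⟨by field_simp; ring, trivial, by simp⟩

/-- The elements of `SL(2, ℝ)` fixing `i` commute with the rotations about `i`. -/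
theorem commute_rotMatrix {k : SL(2, ℝ)} (hk : k • I = I) (θ : ℝ) : Commute k (rotMatrix θ) := by
  obtain ⟨h1, h2, h3⟩ := coord_smul k I
  obtain ⟨e1, e2, e3⟩ := coord_I
  rw [hk, e1, e2, e3] at h1 h2 h3
  have hdet : k 0 0 * k 1 1 - k 0 1 * k 1 0 = 1 := by
    have := k.det_coe; rwa [Matrix.det_fin_two] at this
  have h : (k 0 0 - k 1 1) ^ 2 + (k 0 1 + k 1 0) ^ 2 = 0 := by
    linear_combination -h1 - h2 - 2 * hdet
  have f1 : k 1 1 = k 0 0 := by nlinarith [sq_nonneg (k 0 0 - k 1 1), sq_nonneg (k 0 1 + k 1 0)]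
  have f2 : k 1 0 = -k 0 1 := by nlinarith [sq_nonneg (k 0 0 - k 1 1), sq_nonneg (k 0 1 + k 1 0)]
  have hm : (k : Matrix (Fin 2) (Fin 2) ℝ) = !![k 0 0, k 0 1; -k 0 1, k 0 0] := by
    ext i j
    fin_cases i <;> fin_cases j
    · rfl
    · rfl
    · exact f2
    · exact f1
  have hr : (rotMatrix θ : Matrix (Fin 2) (Fin 2) ℝ) = !![Real.cos (θ / 2), Real.sin (θ / 2);
      -Real.sin (θ / 2), Real.cos (θ / 2)] := rfl
  apply Subtype.ext
  rw [Matrix.SpecialLinearGroup.coe_mul, Matrix.SpecialLinearGroup.coe_mul, hm, hr]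
  ext i j
  fin_cases i <;> fin_cases j <;> simp [Matrix.mul_apply, Fin.sum_univ_two] <;> ring

/-- The standard matrices for `P` and `g • P`, compared through `g`, differ by an element fixing
`i`. That element commutes with the rotations about `i`. -/
theorem hypRotation_smul (g : SL(2, ℝ)) (P : UpperHalfPlane) (θ : ℝ) (z : UpperHalfPlane) :
    hypRotation (g • P) θ (g • z) = g • hypRotation P θ z := by
  have hk : ((g • P).toSL2R⁻¹ * g * P.toSL2R) • I = I := by
    rw [mul_smul, mul_smul, toSL2R_smul_I, inv_smul_eq_iff, toSL2R_smul_I]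
  have hc := commute_rotMatrix hk θ
  have key : (g • P).toSL2R * rotMatrix θ * (g • P).toSL2R⁻¹ * g =
      g * (P.toSL2R * rotMatrix θ * P.toSL2R⁻¹) := by
    have h := congrArg (fun m => (g • P).toSL2R * m * P.toSL2R⁻¹) hc.eq
    simp only [mul_assoc, mul_inv_cancel_left, mul_inv_cancel, mul_one] at h ⊢
    rw [← h]
  change ((g • P).toSL2R * rotMatrix θ * (g • P).toSL2R⁻¹) • g • z =
    g • ((P.toSL2R * rotMatrix θ * P.toSL2R⁻¹) • z)
  rw [smul_smul, smul_smul, key]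

theorem sub_conj_ne_zero (P z : UpperHalfPlane) : (z : ℂ) - (starRingEnd ℂ) (P : ℂ) ≠ 0 := by
  intro h
  have := congrArg Complex.im h
  simp at this
  linarith [z.im_pos, P.im_pos]

theorem diskCoord_eq_zero_iff {P z : UpperHalfPlane} : diskCoord P z = 0 ↔ z = P := by
  rw [diskCoord, div_eq_zero_iff, or_iff_left (sub_conj_ne_zero P z), sub_eq_zero]
  exact ⟨fun h => UpperHalfPlane.ext h, fun h => by rw [h]⟩

/-- A pair of points can be moved to the positive imaginary axis. -/
theorem exists_smul_eq_imPoint {A B : UpperHalfPlane} (h : A ≠ B) :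
    ∃ (g : SL(2, ℝ)) (b : ℝ) (hb : 1 < b), g • A = I ∧ g • B = imPoint b (by linarith) := by
  set z := A.toSL2R⁻¹ • B with hz
  have hzI : z ≠ I := by
    intro h'
    rw [hz, inv_smul_eq_iff, toSL2R_smul_I] at h'
    exact h h'.symm
  set w := diskCoord I z with hw
  set k : SL(2, ℝ) := I.toSL2R * rotMatrix (-w.arg) * I.toSL2R⁻¹ with hk
  have hrot : ∀ v, diskCoord I (k • v) = Complex.exp ((-w.arg : ℝ) * Complex.I) * diskCoord I v :=
    fun v => diskCoord_hypRotation I v (-w.arg)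
  have hkI : k • I = I := by
    rw [← diskCoord_eq_zero_iff, hrot, diskCoord_eq_zero_iff.2 rfl, mul_zero]
  have hkz : diskCoord I (k • z) = (‖w‖ : ℂ) := by
    rw [hrot, ← hw]
    nth_rw 2 [← Complex.norm_mul_exp_arg_mul_I w]
    rw [mul_left_comm, ← Complex.exp_add]
    simp
  have hpos : 0 < ‖w‖ := norm_pos_iff.2 fun h0 => hzI (diskCoord_eq_zero_iff.1 h0)
  set r := ‖w‖
  -- After the rotation the Cayley coordinate is real and positive, which places the point on the
  -- imaginary axis above `i`.
  have h1 : ((k • z : UpperHalfPlane) : ℂ) - I = r * ((k • z : UpperHalfPlane) + Complex.I) := by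
    have := hkz
    rw [diskCoord, div_eq_iff (sub_conj_ne_zero _ _)] at this
    simpa using this
  have hre := congrArg Complex.re h1
  have him := congrArg Complex.im h1
  simp only [Complex.sub_re, Complex.sub_im, Complex.mul_re, Complex.mul_im, Complex.add_re,
    Complex.add_im, Complex.ofReal_re, Complex.ofReal_im, Complex.I_re, Complex.I_im, coe_I,
    coe_re, coe_im] at hre him
  have hy := (k • z).im_pos
  have hy1 : 1 < (k • z).im := by nlinarith
  have hx : (k • z).re = 0 := by
    have h2 : (k • z).re * (1 - r) = 0 := by linarith
    refine (mul_eq_zero.1 h2).resolve_right fun h3 => ?_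
    have : r = 1 := by linarith
    rw [this] at him; linarith
  refine ⟨k * A.toSL2R⁻¹, (k • z).im, hy1, ?_, ?_⟩
  · have : A.toSL2R⁻¹ • A = I := by rw [inv_smul_eq_iff, toSL2R_smul_I]
    rw [mul_smul, this, hkI]
  · rw [mul_smul]
    apply UpperHalfPlane.ext
    apply Complex.ext
    · exact hx
    · rfl

/-! ### Hyperbolic trigonometry -/

/-- The disk coordinate has modulus `tanh (d / 2)`, and `(1 + cosh d) * tanh (d / 2) = sinh d`. The
positive factor keeps angles and makes both components simple rational expressions, so the law of
cosines becomes a Euclidean inner product. -/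
theorem one_add_cosh_mul_diskCoord (P z : UpperHalfPlane) :
    ((1 + Real.cosh (dist P z) : ℝ) : ℂ) * diskCoord P z =
      ⟨((z.re - P.re) ^ 2 + z.im ^ 2 - P.im ^ 2) / (2 * z.im * P.im), (P.re - z.re) / z.im⟩ := by
  have h1 := z.im_ne_zero
  have h2 := P.im_ne_zero
  rw [diskCoord, mul_div_assoc', div_eq_iff (sub_conj_ne_zero P z), cosh_dist']
  apply Complex.ext
  · simp only [Complex.mul_re, Complex.sub_re, Complex.sub_im, Complex.ofReal_re,
      Complex.ofReal_im, Complex.conj_re, Complex.conj_im, coe_re, coe_im]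
    field_simp
    ring
  · simp only [Complex.mul_im, Complex.sub_re, Complex.sub_im, Complex.ofReal_re,
      Complex.ofReal_im, Complex.conj_re, Complex.conj_im, coe_re, coe_im]
    field_simp
    ring

theorem norm_one_add_cosh_mul_diskCoord (P z : UpperHalfPlane) :
    ‖((1 + Real.cosh (dist P z) : ℝ) : ℂ) * diskCoord P z‖ = Real.sinh (dist P z) := by
  have h1 := z.im_ne_zero
  have h2 := P.im_ne_zero
  have h0 : 0 ≤ Real.sinh (dist P z) := Real.sinh_nonneg_iff.2 dist_nonneg
  rw [← sq_eq_sq₀ (norm_nonneg _) h0, Complex.sq_norm, one_add_cosh_mul_diskCoord,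
    Real.sinh_sq, cosh_dist', Complex.normSq_mk]
  field_simp
  ring

/-- The hyperbolic law of cosines. -/
theorem cos_hypAngle_mul (Q P R : UpperHalfPlane) :
    Real.cos (hypAngle Q P R) * (Real.sinh (dist P Q) * Real.sinh (dist P R)) =
      Real.cosh (dist P Q) * Real.cosh (dist P R) - Real.cosh (dist Q R) := by
  have hQ : 0 < 1 + Real.cosh (dist P Q) := by have := Real.cosh_pos (dist P Q); linarith
  have hR : 0 < 1 + Real.cosh (dist P R) := by have := Real.cosh_pos (dist P R); linarith
  have hang : hypAngle Q P R =
      InnerProductGeometry.angle (((1 + Real.cosh (dist P Q) : ℝ) : ℂ) * diskCoord P Q)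
        (((1 + Real.cosh (dist P R) : ℝ) : ℂ) * diskCoord P R) := by
    rw [← Complex.real_smul, ← Complex.real_smul, InnerProductGeometry.angle_smul_left_of_pos _ _ hQ,
      InnerProductGeometry.angle_smul_right_of_pos _ _ hR]
    rfl
  rw [hang, ← norm_one_add_cosh_mul_diskCoord P Q, ← norm_one_add_cosh_mul_diskCoord P R,
    InnerProductGeometry.cos_angle_mul_norm_mul_norm, one_add_cosh_mul_diskCoord,
    one_add_cosh_mul_diskCoord, Complex.inner, cosh_dist', cosh_dist', cosh_dist']
  have h1 := P.im_ne_zero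
  have h2 := Q.im_ne_zero
  have h3 := R.im_ne_zero
  simp only [Complex.mul_re, Complex.conj_re, Complex.conj_im]
  field_simp
  ring

/-- The angle with a zero vector is `π / 2` by convention. The angles `π / p` with `p ≥ 3` therefore
exclude degenerate triangles. -/
theorem ne_of_hypAngle_ne {Q P R : UpperHalfPlane} (h : hypAngle Q P R ≠ Real.pi / 2) :
    Q ≠ P ∧ R ≠ P := by
  constructor
  · rintro rfl
    exact h (by rw [hypAngle, diskCoord_eq_zero_iff.2 rfl, InnerProductGeometry.angle_zero_left])
  · rintro rfl
    exact h (by rw [hypAngle, diskCoord_eq_zero_iff.2 rfl, InnerProductGeometry.angle_zero_right])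

theorem sin_pi_div_pos {p : ℕ} (hp : 3 ≤ p) : 0 < Real.sin (Real.pi / p) := by
  have : (3 : ℝ) ≤ p := by exact_mod_cast hp
  apply Real.sin_pos_of_pos_of_lt_pi
  · have := Real.pi_pos; positivity
  · rw [div_lt_iff₀ (by linarith)]; nlinarith [Real.pi_pos]

theorem cos_pi_div_pos {p : ℕ} (hp : 3 ≤ p) : 0 < Real.cos (Real.pi / p) := by
  have : (3 : ℝ) ≤ p := by exact_mod_cast hp
  apply Real.cos_pos_of_mem_Ioo
  constructor
  · have : 0 < Real.pi / p := by have := Real.pi_pos; positivity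
    linarith [Real.pi_pos]
  · rw [div_lt_iff₀ (by linarith)]; nlinarith [Real.pi_pos]

theorem pi_div_ne {p : ℕ} (hp : 3 ≤ p) : Real.pi / p ≠ Real.pi / 2 := by
  have := cos_pi_div_pos hp
  intro h
  rw [h, Real.cos_pi_div_two] at this
  exact lt_irrefl _ this

/-- The sides of a right-angled hyperbolic triangle. -/
theorem cosh_dist_of_isTriangle {p₁ p₂ : ℕ} (h₁ : 3 ≤ p₁) (h₂ : 3 ≤ p₂) {A B C : UpperHalfPlane}
    (h : IsTriangle p₁ p₂ A B C) :
    A ≠ B ∧ A ≠ C ∧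
    Real.cosh (dist B C) = Real.cosh (dist A B) * Real.cosh (dist A C) ∧
    Real.cosh (dist A B) * Real.sin (Real.pi / p₁) = Real.cos (Real.pi / p₂) ∧
    Real.cosh (dist A C) * Real.sin (Real.pi / p₂) = Real.cos (Real.pi / p₁) := by
  obtain ⟨hA, hB, hC⟩ := h
  have hAB := (ne_of_hypAngle_ne (hB ▸ pi_div_ne h₁)).1
  have hAC := (ne_of_hypAngle_ne (hC ▸ pi_div_ne h₂)).1
  have lA := cos_hypAngle_mul B A C
  have lB := cos_hypAngle_mul A B C
  have lC := cos_hypAngle_mul A C B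
  rw [hA, Real.cos_pi_div_two, zero_mul] at lA
  rw [hB, dist_comm B A] at lB
  rw [hC, dist_comm C A, dist_comm C B] at lC
  have hbc : Real.cosh (dist B C) = Real.cosh (dist A B) * Real.cosh (dist A C) := by linarith
  have sc := Real.sinh_sq (dist A B)
  have sb := Real.sinh_sq (dist A C)
  have sa := Real.sinh_sq (dist B C)
  have pc : 0 < Real.sinh (dist A B) := Real.sinh_pos_iff.2 (dist_pos.2 hAB)
  have pb : 0 < Real.sinh (dist A C) := Real.sinh_pos_iff.2 (dist_pos.2 hAC)
  have pcc : 0 < Real.cosh (dist A B) := Real.cosh_pos _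
  have pcb : 0 < Real.cosh (dist A C) := Real.cosh_pos _
  rw [hbc] at lB lC sa
  generalize Real.sinh (dist A B) = sC at *
  generalize Real.sinh (dist A C) = sB at *
  generalize Real.sinh (dist B C) = sA at *
  generalize Real.cosh (dist A B) = c at *
  generalize Real.cosh (dist A C) = b at *
  have pB := sin_pi_div_pos h₁
  have pC := sin_pi_div_pos h₂
  have qB := cos_pi_div_pos h₁
  have qC := cos_pi_div_pos h₂
  have tB := Real.sin_sq_add_cos_sq (Real.pi / p₁)
  have tC := Real.sin_sq_add_cos_sq (Real.pi / p₂)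
  generalize Real.sin (Real.pi / p₁) = s₁ at *
  generalize Real.sin (Real.pi / p₂) = s₂ at *
  generalize Real.cos (Real.pi / p₁) = c₁ at *
  generalize Real.cos (Real.pi / p₂) = c₂ at *
  have eB : c₁ * sA = b * sC := by
    apply mul_right_cancel₀ pc.ne'
    linear_combination lB - b * sc
  have eC : c₂ * sA = c * sB := by
    apply mul_right_cancel₀ pb.ne'
    linear_combination lC - c * sb
  have hsA : 0 < sA ^ 2 := by rw [sa]; nlinarith [mul_pos pc pc, mul_pos pb pb]
  -- This and `fC` are squared forms of the law of sines.
  have fB : s₁ ^ 2 * sA ^ 2 = sB ^ 2 := by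
    linear_combination sA ^ 2 * tB - (c₁ * sA + b * sC) * eB + sa - b ^ 2 * sc - sb
  have fC : s₂ ^ 2 * sA ^ 2 = sC ^ 2 := by
    linear_combination sA ^ 2 * tC - (c₂ * sA + c * sB) * eC + sa - c ^ 2 * sb - sc
  refine ⟨hAB, hAC, hbc, ?_, ?_⟩
  · have : (c * s₁) ^ 2 = c₂ ^ 2 := by
      apply mul_right_cancel₀ hsA.ne'
      linear_combination c ^ 2 * fB - (c₂ * sA + c * sB) * eC
    exact (sq_eq_sq₀ (by positivity) qC.le).1 this
  · have : (b * s₂) ^ 2 = c₁ ^ 2 := by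
      apply mul_right_cancel₀ hsA.ne'
      linear_combination b ^ 2 * fC - (c₁ * sA + b * sC) * eB
    exact (sq_eq_sq₀ (by positivity) qB.le).1 this

end UpperHalfPlane

/-! ### Areas of regions between graphs, of disks and of the standard triangle. -/

namespace UpperHalfPlane

theorem lintegral_inv_sq {u v : ℝ} (hu : 0 < u) (huv : u ≤ v) :
    ∫⁻ y in Set.Ioc u v, ((((1 / ‖y‖₊) ^ 2 : NNReal)) : ENNReal) =
      ENNReal.ofReal (1 / u - 1 / v) := by
  have hcont : ContinuousOn (fun y : ℝ => 1 / y ^ 2) (Set.Icc u v) := by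
    refine ContinuousOn.div continuousOn_const (by fun_prop) fun y hy => ?_
    have : 0 < y := hu.trans_le hy.1
    positivity
  have hint : IntervalIntegrable (fun y : ℝ => 1 / y ^ 2) volume u v := by
    apply ContinuousOn.intervalIntegrable
    rwa [Set.uIcc_of_le huv]
  have h1 : ∫ y in u..v, 1 / y ^ 2 = 1 / u - 1 / v := by
    rw [intervalIntegral.integral_eq_sub_of_hasDerivAt (f := fun y => -(1 / y)) _ hint]
    · ring
    · intro y hy
      rw [Set.uIcc_of_le huv] at hy
      have hy0 : y ≠ 0 := (hu.trans_le hy.1).ne'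
      convert! (hasDerivAt_inv hy0).neg using 1
      · ext t; simp
      · field_simp
  rw [← h1, intervalIntegral.integral_of_le huv, ofReal_integral_eq_lintegral_ofReal]
  · refine setLIntegral_congr_fun measurableSet_Ioc fun y hy => ?_
    have hy0 : 0 < y := hu.trans hy.1
    rw [ENNReal.ofReal, ENNReal.coe_inj]
    apply NNReal.eq
    rw [Real.coe_toNNReal _ (by positivity)]
    simp
  · exact hint.1
  · exact Filter.Eventually.of_forall fun y => by positivity

/-- The area of a region between two graphs. -/
theorem volume_of_graphs {a b : ℝ} {f g : ℝ → ℝ} {s : Set UpperHalfPlane} (hs : MeasurableSet s)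
    (hf : ∀ x ∈ Set.Ioo a b, 0 < f x) (hfg : ∀ x ∈ Set.Ioo a b, f x ≤ g x)
    (h1 : ∀ z ∈ s, z.re ∈ Set.Icc a b ∧
      (z.re ∈ Set.Ioo a b → f z.re ≤ z.im ∧ z.im ≤ g z.re))
    (h2 : ∀ z : UpperHalfPlane, z.re ∈ Set.Ioo a b → f z.re < z.im → z.im < g z.re → z ∈ s) :
    volume s = ∫⁻ x in Set.Ioo a b, ENNReal.ofReal (1 / f x - 1 / g x) := by
  set F : ℝ → ENNReal := fun y => (((1 / ‖y‖₊) ^ 2 : NNReal) : ENNReal) with hF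
  have hFm : Measurable F := by
    refine Measurable.coe_nnreal_ennreal ?_
    exact (measurable_const.div measurable_nnnorm).pow_const 2
  have hms : MeasurableSet (UpperHalfPlane.coe '' s) :=
    measurableEmbedding_coe.measurableSet_image.2 hs
  have hmem : ∀ x y : ℝ, (⟨x, y⟩ : ℂ) ∈ UpperHalfPlane.coe '' s ↔
      ∃ hy : 0 < y, (⟨⟨x, y⟩, hy⟩ : UpperHalfPlane) ∈ s := by
    intro x y
    constructor
    · rintro ⟨z, hz, he⟩
      have hy : 0 < y := by
        have := congrArg Complex.im he
        simp only [coe_im] at this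
        rw [← this]; exact z.im_pos
      refine ⟨hy, ?_⟩
      have hzz : (⟨⟨x, y⟩, hy⟩ : UpperHalfPlane) = z := UpperHalfPlane.ext he.symm
      rwa [hzz]
    · rintro ⟨hy, hz⟩
      exact ⟨_, hz, rfl⟩
  rw [volume_eq_lintegral, ← lintegral_indicator hms,
    ← (Complex.volume_preserving_equiv_real_prod.symm).lintegral_comp_emb
      (MeasurableEquiv.measurableEmbedding _), Measure.volume_eq_prod, lintegral_prod,
    ← lintegral_indicator measurableSet_Ioo]
  · apply lintegral_congr_ae
    have hab : ∀ᵐ x : ℝ, x ≠ a ∧ x ≠ b := by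
      have ha := (Set.countable_singleton a).ae_notMem (volume : Measure ℝ)
      have hb := (Set.countable_singleton b).ae_notMem (volume : Measure ℝ)
      filter_upwards [ha, hb] with x hxa hxb
      exact ⟨hxa, hxb⟩
    filter_upwards [hab] with x hx
    change ∫⁻ y, (UpperHalfPlane.coe '' s).indicator (fun z : ℂ => F z.im) ⟨x, y⟩ = _
    by_cases hxI : x ∈ Set.Ioo a b
    · rw [Set.indicator_of_mem hxI, ← lintegral_inv_sq (hf x hxI) (hfg x hxI),
        ← lintegral_indicator measurableSet_Ioc]
      apply lintegral_congr_ae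
      have ha := (Set.countable_singleton (f x)).ae_notMem (volume : Measure ℝ)
      have hb := (Set.countable_singleton (g x)).ae_notMem (volume : Measure ℝ)
      filter_upwards [ha, hb] with y hya hyb
      simp only [Set.mem_singleton_iff] at hya hyb
      by_cases hy : (⟨x, y⟩ : ℂ) ∈ UpperHalfPlane.coe '' s
      · rw [Set.indicator_of_mem hy]
        obtain ⟨hy0, hys⟩ := (hmem x y).1 hy
        obtain ⟨l1, l2⟩ := (h1 _ hys).2 hxI
        rw [Set.indicator_of_mem]
        exact ⟨lt_of_le_of_ne l1 (Ne.symm hya), l2⟩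
      · rw [Set.indicator_of_notMem hy, Set.indicator_of_notMem]
        intro hyI
        have hy0 : 0 < y := (hf x hxI).trans hyI.1
        exact hy ((hmem x y).2 ⟨hy0, h2 ⟨⟨x, y⟩, hy0⟩ hxI hyI.1 (lt_of_le_of_ne hyI.2 hyb)⟩)
    · rw [Set.indicator_of_notMem hxI]
      rw [lintegral_eq_zero_of_ae_eq_zero]
      refine Filter.Eventually.of_forall fun y => ?_
      refine Set.indicator_of_notMem (fun hy => hxI ?_) _
      obtain ⟨hy0, hys⟩ := (hmem x y).1 hy
      have h3 : x ∈ Set.Icc a b := (h1 _ hys).1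
      exact ⟨lt_of_le_of_ne h3.1 (Ne.symm hx.1), lt_of_le_of_ne h3.2 hx.2⟩
  · refine Measurable.aemeasurable ?_
    exact ((hFm.comp Complex.measurable_im).indicator hms).comp
      (MeasurableEquiv.measurable _)

/-- The fundamental theorem of calculus in the form needed for areas between graphs. -/
theorem lintegral_ofReal_eq_sub {a b : ℝ} (hab : a ≤ b) {F φ : ℝ → ℝ}
    (hc : ContinuousOn F (Set.Icc a b)) (hd : ∀ x ∈ Set.Ioo a b, HasDerivAt F (φ x) x)
    (hφ : ∀ x ∈ Set.Ioo a b, 0 ≤ φ x) :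
    ∫⁻ x in Set.Ioo a b, ENNReal.ofReal (φ x) = ENNReal.ofReal (F b - F a) := by
  have hint : IntervalIntegrable φ volume a b := by
    rw [intervalIntegrable_iff_integrableOn_Ioc_of_le hab]
    exact intervalIntegral.integrableOn_deriv_of_nonneg hc hd hφ
  rw [← intervalIntegral.integral_eq_sub_of_hasDerivAt_of_le hab hc hd hint,
    intervalIntegral.integral_of_le hab, integral_Ioc_eq_integral_Ioo,
    ofReal_integral_eq_lintegral_ofReal]
  · exact hint.1.mono_set Set.Ioo_subset_Ioc_self
  · exact (ae_restrict_iff' measurableSet_Ioo).2 (Filter.Eventually.of_forall hφ)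

end UpperHalfPlane

namespace UpperHalfPlane

theorem volume_closedBall_I {r : ℝ} (hr : 0 ≤ r) :
    volume (Metric.closedBall I r) = ENNReal.ofReal (2 * Real.pi * (Real.cosh r - 1)) := by
  set S := Real.sinh r with hS
  set C := Real.cosh r with hC
  have hCS : C ^ 2 = 1 + S ^ 2 := by rw [hC, hS, Real.cosh_sq]; ring
  have hS0 : 0 ≤ S := Real.sinh_nonneg_iff.2 hr
  have hC0 : 0 < C := Real.cosh_pos r
  have hSC : S < C := by rw [hS, hC]; exact Real.sinh_lt_cosh r
  -- The hyperbolic disk about `i` is the Euclidean disk with centre `i cosh r` and radius `sinh r`.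
  have hmem : ∀ z : UpperHalfPlane, z ∈ Metric.closedBall I r ↔
      z.re ^ 2 + (z.im - C) ^ 2 ≤ S ^ 2 := by
    intro z
    rw [Metric.mem_closedBall, dist_le_iff_dist_coe_center_le, Complex.dist_eq,
      ← sq_le_sq₀ (norm_nonneg _) (by rw [I_im, one_mul]; exact hS0), Complex.sq_norm,
      Complex.normSq_apply]
    simp [hC, hS, sq]
  have hsq : ∀ x ∈ Set.Ioo (-S) S, 0 < S ^ 2 - x ^ 2 := by
    intro x hx; nlinarith [hx.1, hx.2]
  have hsl : ∀ x, √(S ^ 2 - x ^ 2) ≤ S := by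
    intro x
    calc √(S ^ 2 - x ^ 2) ≤ √(S ^ 2) := Real.sqrt_le_sqrt (by nlinarith [sq_nonneg x])
      _ = S := Real.sqrt_sq hS0
  rw [volume_of_graphs (a := -S) (b := S) (f := fun x => C - √(S ^ 2 - x ^ 2))
    (g := fun x => C + √(S ^ 2 - x ^ 2)) Metric.isClosed_closedBall.measurableSet]
  · rcases hS0.eq_or_lt with h0 | hpos
    · have : r = 0 := Real.sinh_eq_zero.1 h0.symm
      rw [hC, this, ← h0]; simp
    -- This is an antiderivative of `1 / (C - q) - 1 / (C + q) = 2 q / (1 + x ^ 2)` with `q = √(S ^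
    -- 2 - x ^ 2)`. Both arcsines run from `-π / 2` to `π / 2`.
    have hcont : Continuous fun x => 2 * (C * Real.arcsin (x * C / (S * √(1 + x ^ 2))) -
        Real.arcsin (x / S)) := by
      have h1 : Continuous fun x : ℝ => x * C / (S * √(1 + x ^ 2)) := by
        refine Continuous.div (by fun_prop) (by fun_prop) fun x => ?_
        have : 0 < √(1 + x ^ 2) := Real.sqrt_pos.2 (by positivity)
        positivity
      have h2 := Real.continuous_arcsin.comp h1
      have h3 : Continuous fun x : ℝ => Real.arcsin (x / S) :=
        Real.continuous_arcsin.comp (continuous_id.div_const S)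
      exact continuous_const.mul ((continuous_const.mul h2).sub h3)
    rw [lintegral_ofReal_eq_sub (by linarith) (hcont.continuousOn)]
    · have e1 : S * C / (S * √(1 + S ^ 2)) = 1 := by
        rw [← hCS, Real.sqrt_sq hC0.le, div_self (by positivity)]
      have e2 : -S * C / (S * √(1 + (-S) ^ 2)) = -1 := by
        rw [neg_sq, neg_mul, neg_div, e1]
      rw [e1, e2, div_self hpos.ne', neg_div, div_self hpos.ne', Real.arcsin_one,
        Real.arcsin_neg_one]
      congr 1
      ring
    · intro x hx
      have hx2 := hsq x hx
      set q := √(S ^ 2 - x ^ 2) with hq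
      set t := √(1 + x ^ 2) with ht
      have hq0 : 0 < q := Real.sqrt_pos.2 hx2
      have ht0 : 0 < t := Real.sqrt_pos.2 (by positivity)
      have hqq : q ^ 2 = S ^ 2 - x ^ 2 := Real.sq_sqrt hx2.le
      have htt : t ^ 2 = 1 + x ^ 2 := Real.sq_sqrt (by positivity)
      have hu : 1 - (x * C / (S * t)) ^ 2 = (q / (S * t)) ^ 2 := by
        field_simp
        rw [htt, hqq, hCS]; ring
      have hv : 1 - (x / S) ^ 2 = (q / S) ^ 2 := by
        field_simp
        rw [hqq]
      have hu1 : x * C / (S * t) ≠ -1 ∧ x * C / (S * t) ≠ 1 := by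
        have : 0 < 1 - (x * C / (S * t)) ^ 2 := by rw [hu]; positivity
        constructor <;> intro h <;> rw [h] at this <;> norm_num at this
      have hv1 : x / S ≠ -1 ∧ x / S ≠ 1 := by
        have : 0 < 1 - (x / S) ^ 2 := by rw [hv]; positivity
        constructor <;> intro h <;> rw [h] at this <;> norm_num at this
      have dt : HasDerivAt (fun x : ℝ => √(1 + x ^ 2)) (x / t) x := by
        have h0 : HasDerivAt (fun y : ℝ => 1 + y ^ 2) (2 * x) x := by
          simpa using (hasDerivAt_pow 2 x).const_add 1
        have h := h0.sqrt (by positivity)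
        convert! h using 1
        rw [← ht]
        field_simp
      have du : HasDerivAt (fun x : ℝ => x * C / (S * √(1 + x ^ 2))) (C / (S * t ^ 3)) x := by
        have h := ((hasDerivAt_id x).mul_const C).div (dt.const_mul S)
          (by change S * t ≠ 0; positivity)
        convert! h using 1
        simp only [id, ← ht]
        field_simp
        rw [htt]; ring
      have dv : HasDerivAt (fun x : ℝ => x / S) (1 / S) x := (hasDerivAt_id x).div_const S
      have hau := (Real.hasDerivAt_arcsin hu1.1 hu1.2).comp x du
      have hav := (Real.hasDerivAt_arcsin hv1.1 hv1.2).comp x dv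
      rw [hu, Real.sqrt_sq (by positivity)] at hau
      rw [hv, Real.sqrt_sq (by positivity)] at hav
      convert! ((hau.const_mul C).sub hav).const_mul 2 using 1
      have n1 : C - q ≠ 0 := by have := hsl x; linarith
      have n2 : C + q ≠ 0 := by positivity
      have e3 : (C - q) * (C + q) = t ^ 2 := by rw [htt]; linear_combination hCS - hqq
      have e4 : 1 / (C - q) - 1 / (C + q) = 2 * q / t ^ 2 := by
        rw [← e3]; field_simp; ring
      rw [e4]
      field_simp
      rw [htt, hqq, hCS]; ring
    · intro x hx
      have h1 : 0 < C - √(S ^ 2 - x ^ 2) := by have := hsl x; linarith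
      have h2 : 0 ≤ √(S ^ 2 - x ^ 2) := Real.sqrt_nonneg _
      rw [sub_nonneg]
      exact one_div_le_one_div_of_le h1 (by linarith)
  · intro x _
    have := hsl x
    linarith
  · intro x _
    have := Real.sqrt_nonneg (S ^ 2 - x ^ 2)
    linarith
  · intro z hz
    rw [hmem] at hz
    have h1 : z.re ^ 2 ≤ S ^ 2 := by nlinarith [sq_nonneg (z.im - C)]
    have h2 := abs_le_of_sq_le_sq' h1 hS0
    refine ⟨⟨h2.1, h2.2⟩, fun hx => ?_⟩
    have h3 : |z.im - C| ≤ √(S ^ 2 - z.re ^ 2) := Real.abs_le_sqrt (by linarith)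
    have h4 := abs_le.1 h3
    constructor <;> linarith [h4.1, h4.2]
  · intro z hx h1 h2
    rw [hmem]
    have h3 : |z.im - C| ≤ √(S ^ 2 - z.re ^ 2) := abs_le.2 ⟨by linarith, by linarith⟩
    have h4 : (z.im - C) ^ 2 ≤ √(S ^ 2 - z.re ^ 2) ^ 2 := by
      rw [← sq_abs]; gcongr
    rw [Real.sq_sqrt (hsq _ hx).le] at h4
    linarith

/-- The area of a hyperbolic disk. -/
theorem volume_closedBall (P : UpperHalfPlane) {r : ℝ} (hr : 0 ≤ r) :
    volume (Metric.closedBall P r) = ENNReal.ofReal (2 * Real.pi * (Real.cosh r - 1)) := by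
  rw [← volume_closedBall_I hr]
  have h := (measurePreserving_constSMul P.toSL2R).measure_preimage
    (Metric.isClosed_closedBall (x := P) (ε := r)).measurableSet.nullMeasurableSet
  rw [← h, IsometryEquiv.preimage_closedBall]
  congr 2
  rw [IsometryEquiv.symm_apply_eq]
  exact (toSL2R_smul_I P).symm

section Chamber

variable {p₁ p₂ : ℕ} {b : ℝ}

theorem hasDerivAt_arcsin_add_div {R c x : ℝ} (hR : 0 < R) (h : 0 < R ^ 2 - (x + c) ^ 2) :
    HasDerivAt (fun x => Real.arcsin ((x + c) / R)) (1 / √(R ^ 2 - (x + c) ^ 2)) x := by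
  have hy : 1 - ((x + c) / R) ^ 2 = (R ^ 2 - (x + c) ^ 2) / R ^ 2 := by field_simp
  have hv1 : (x + c) / R ≠ -1 ∧ (x + c) / R ≠ 1 := by
    have : 0 < 1 - ((x + c) / R) ^ 2 := by
      rw [hy]; exact div_pos h (by positivity)
    constructor <;> intro h <;> rw [h] at this <;> norm_num at this
  have dv : HasDerivAt (fun x : ℝ => (x + c) / R) (1 / R) x :=
    ((hasDerivAt_id x).add_const c).div_const R
  have hav := (Real.hasDerivAt_arcsin hv1.1 hv1.2).comp x dv
  rw [hy, Real.sqrt_div' _ (by positivity), Real.sqrt_sq hR.le] at hav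
  convert! hav using 1
  have : 0 < √(R ^ 2 - (x + c) ^ 2) := Real.sqrt_pos.2 h
  field_simp

-- The area between two Euclidean arcs is a difference of arcsines, each of which is an angle of the
-- triangle; this gives the angle defect. Allowing any region between the open and the closed
-- triangle gives both areas at once, so the sides have measure zero.
set_option maxHeartbeats 1000000 in
theorem volume_std_region (h₁ : 3 ≤ p₁) (h₂ : 3 ≤ p₂) (hb : 1 < b)
    (hbc : Real.sin (Real.pi / p₁) * (b + 1 / b) = 2 * Real.cos (Real.pi / p₂))
    {s : Set UpperHalfPlane} (hs : MeasurableSet s)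
    (hs1 : s ⊆ {z | ∀ i, 0 ≤ stdℓ b (Real.pi / p₁) i z})
    (hs2 : {z | ∀ i, 0 < stdℓ b (Real.pi / p₁) i z} ⊆ s) :
    volume s = ENNReal.ofReal (Real.pi / 2 - Real.pi / p₁ - Real.pi / p₂) := by
  have hb0 : 0 < b := by linarith
  have ps := sin_pi_div_pos h₁
  have pc := cos_pi_div_pos h₁
  have qs := sin_pi_div_pos h₂
  have qc := cos_pi_div_pos h₂
  have hsc := Real.sin_sq_add_cos_sq (Real.pi / p₁)
  have hsc' := Real.sin_sq_add_cos_sq (Real.pi / p₂)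
  set β := Real.pi / p₁ with hβ
  set γ := Real.pi / p₂ with hγ
  set σ := Real.sin β with hσ
  set c := Real.cos β with hc
  have hbc' : σ * (b ^ 2 + 1) = 2 * b * Real.cos γ := by
    field_simp at hbc; linarith
  -- Mirror `0` is the Euclidean circle with centre `-c₀` and radius `R`; `xC` below is the abscissa
  -- of its intersection with the unit circle, the vertex `C`.
  set c₀ := b * c / σ with hc₀
  set R := b / σ with hR
  have hc₀0 : 0 < c₀ := by positivity
  have hR0 : 0 < R := by positivity
  have hRc : R ^ 2 = b ^ 2 + c₀ ^ 2 := by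
    rw [hR, hc₀]; field_simp; linarith
  set xC := (b ^ 2 - 1) / (2 * c₀) with hxC
  have hxC0 : 0 < xC := div_pos (by nlinarith) (by positivity)
  have hxCe : 2 * c₀ * xC = b ^ 2 - 1 := by rw [hxC]; field_simp
  have hxC1 : xC < 1 := by
    have h1 : (σ * (b ^ 2 - 1)) ^ 2 < (2 * b * c) ^ 2 := by
      have h3 : 0 < (b * Real.sin γ) ^ 2 := by positivity
      have h4 : (σ * (b ^ 2 - 1)) ^ 2 = (2 * b * Real.cos γ) ^ 2 - 4 * σ ^ 2 * b ^ 2 := by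
        rw [← hbc']; ring
      linear_combination h4 + 4 * h3 + 4 * b ^ 2 * (hsc' - hsc)
    have h2 : σ * (b ^ 2 - 1) < 2 * b * c := lt_of_pow_lt_pow_left₀ 2 (by positivity) h1
    rw [hxC, div_lt_one (by positivity), hc₀]
    rw [mul_div_assoc', lt_div_iff₀ ps]
    linarith
  -- The two sides differ by `b ^ 2 - 1 - 2 * c₀ * x`, which vanishes at `xC`.
  have hgap : ∀ x, x ≤ xC → 1 - x ^ 2 ≤ R ^ 2 - (x + c₀) ^ 2 := by
    intro x hx
    have : 2 * c₀ * x ≤ 2 * c₀ * xC := by gcongr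
    nlinarith
  have hpos1 : ∀ x ∈ Set.Ioo 0 xC, 0 < 1 - x ^ 2 := by
    intro x hx; nlinarith [hx.1, hx.2]
  have e1 : ∀ z : UpperHalfPlane, stdℓ b β 1 z = (z.re ^ 2 + z.im ^ 2 - 1) / (2 * z.im) := by
    intro z
    have := z.im_ne_zero
    simp only [stdℓ, coordP, coordQ]; field_simp
  have e0 : ∀ z : UpperHalfPlane, stdℓ b β 0 z =
      (R ^ 2 - (z.re + c₀) ^ 2 - z.im ^ 2) / (2 * z.im) * (σ / b) := by
    intro z
    have := z.im_ne_zero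
    rw [hRc, hc₀]
    simp only [stdℓ, coordP, coordQ, coordT, ← hσ, ← hc]; field_simp; ring
  have e2 : ∀ z : UpperHalfPlane, stdℓ b β 2 z = z.re / z.im := fun z => rfl
  rw [volume_of_graphs (a := 0) (b := xC) (f := fun x => √(1 - x ^ 2))
    (g := fun x => √(R ^ 2 - (x + c₀) ^ 2)) hs]
  · rw [lintegral_ofReal_eq_sub hxC0.le
      (F := fun x => Real.arcsin x - Real.arcsin ((x + c₀) / R))]
    · congr 1
      have a0 : Real.arcsin ((0 + c₀) / R) = Real.pi / 2 - β := by
        have : (0 + c₀) / R = c := by rw [hc₀, hR]; field_simp; ring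
        rw [this, hc, ← Real.sin_pi_div_two_sub, Real.arcsin_sin]
        · have : β ≤ Real.pi := by
            rw [hβ]; exact div_le_self Real.pi_pos.le (by exact_mod_cast (by omega : 1 ≤ p₁))
          linarith
        · have : 0 ≤ β := by rw [hβ]; positivity
          linarith
      set u := Real.arcsin xC with hu
      set v := Real.arcsin ((xC + c₀) / R) with hv
      set y := √(1 - xC ^ 2) with hy
      have hyy : y ^ 2 = 1 - xC ^ 2 := Real.sq_sqrt (by nlinarith)
      have hRx : R ^ 2 - (xC + c₀) ^ 2 = y ^ 2 := by rw [hyy, hRc]; linarith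
      have hle1 : (xC + c₀) / R ≤ 1 := by
        rw [div_le_one hR0]
        exact le_of_sq_le_sq (by nlinarith [sq_nonneg y]) hR0.le
      have su : Real.sin u = xC := Real.sin_arcsin (by linarith) hxC1.le
      have cu : Real.cos u = y := Real.cos_arcsin xC
      have sv : Real.sin v = (xC + c₀) / R :=
        Real.sin_arcsin (by have : 0 ≤ (xC + c₀) / R := by positivity
                            linarith) hle1
      have cv : Real.cos v = y / R := by
        rw [hv, Real.cos_arcsin, hy]
        have : 1 - ((xC + c₀) / R) ^ 2 = (1 - xC ^ 2) / R ^ 2 := by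
          rw [← hyy, ← hRx]; field_simp
        rw [this, Real.sqrt_div' _ (by positivity), Real.sqrt_sq hR0.le]
      have u0 : 0 ≤ u := Real.arcsin_nonneg.2 hxC0.le
      have v0 : 0 ≤ v := Real.arcsin_nonneg.2 (by positivity)
      have u1 : u ≤ Real.pi / 2 := Real.arcsin_le_pi_div_two _
      have v1 : v ≤ Real.pi / 2 := Real.arcsin_le_pi_div_two _
      -- `u` and `v` are the inclinations from the vertical of the two Euclidean radii to the vertex
      -- `C`; their difference is the angle of the triangle there.
      have hcos : Real.cos (v - u) = Real.cos γ := by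
        rw [Real.cos_sub, su, cu, sv, cv]
        have h1 : y / R * y + (xC + c₀) / R * xC = (y ^ 2 + xC ^ 2 + c₀ * xC) / R := by
          field_simp; ring
        rw [h1, hyy, div_eq_iff hR0.ne', hR]
        field_simp
        linear_combination σ / 2 * hxCe + hbc' / 2
      have hsin : 0 ≤ Real.sin (v - u) := by
        rw [Real.sin_sub, su, cu, sv, cv]
        have h1 : (xC + c₀) / R * y - y / R * xC = c₀ * y / R := by field_simp; ring
        rw [h1]; positivity
      have huv : 0 ≤ v - u := by
        by_contra! hneg
        have := Real.sin_neg_of_neg_of_neg_pi_lt hneg (by linarith [Real.pi_pos])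
        linarith
      have hfin : v - u = γ := by
        apply Real.injOn_cos ⟨huv, by linarith [Real.pi_pos]⟩ _ hcos
        constructor
        · rw [hγ]; positivity
        · rw [hγ]; exact div_le_self Real.pi_pos.le (by exact_mod_cast (by omega : 1 ≤ p₂))
      rw [a0, Real.arcsin_zero]
      linarith
    · have := Real.continuous_arcsin
      fun_prop
    · intro x hx
      have hx1 := hpos1 x hx
      have hx2 := hgap x hx.2.le
      have hxn : x ≠ -1 ∧ x ≠ 1 := by
        constructor <;> rintro rfl <;> norm_num at hx1
      exact (Real.hasDerivAt_arcsin hxn.1 hxn.2).sub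
        (hasDerivAt_arcsin_add_div hR0 (by linarith))
    · intro x hx
      have hx1 := hpos1 x hx
      rw [sub_nonneg]
      exact one_div_le_one_div_of_le (Real.sqrt_pos.2 hx1)
        (Real.sqrt_le_sqrt (hgap x hx.2.le))
  · intro x hx
    exact Real.sqrt_pos.2 (hpos1 x hx)
  · intro x hx
    exact Real.sqrt_le_sqrt (hgap x hx.2.le)
  · intro z hz
    have hy := z.im_pos
    have k0 := hs1 hz 0
    have k1 := hs1 hz 1
    have k2 := hs1 hz 2
    rw [e0] at k0
    rw [e1] at k1
    rw [e2] at k2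
    have k0' : 0 ≤ R ^ 2 - (z.re + c₀) ^ 2 - z.im ^ 2 := by
      by_contra! h
      have : (R ^ 2 - (z.re + c₀) ^ 2 - z.im ^ 2) / (2 * z.im) * (σ / b) < 0 :=
        mul_neg_of_neg_of_pos (div_neg_of_neg_of_pos h (by positivity)) (by positivity)
      linarith
    have k1' : 0 ≤ z.re ^ 2 + z.im ^ 2 - 1 := by
      by_contra! h
      have := div_neg_of_neg_of_pos h (by positivity : 0 < 2 * z.im)
      linarith
    have k2' : 0 ≤ z.re := by
      by_contra! h
      have := div_neg_of_neg_of_pos h hy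
      linarith
    refine ⟨⟨k2', ?_⟩, fun _ => ⟨?_, ?_⟩⟩
    · have : 2 * c₀ * z.re ≤ 2 * c₀ * xC := by nlinarith
      exact le_of_mul_le_mul_left this (by positivity)
    · exact Real.sqrt_le_iff.2 ⟨hy.le, by linarith⟩
    · exact Real.le_sqrt_of_sq_le (by linarith)
  · intro z hx k1 k2
    apply hs2
    have hy := z.im_pos
    have k1' : 1 - z.re ^ 2 < z.im ^ 2 := (Real.sqrt_lt' hy).1 k1
    have k2' : z.im ^ 2 < R ^ 2 - (z.re + c₀) ^ 2 := (Real.lt_sqrt hy.le).1 k2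
    intro i
    fin_cases i
    · change 0 < stdℓ b β 0 z
      rw [e0]
      have : 0 < R ^ 2 - (z.re + c₀) ^ 2 - z.im ^ 2 := by linarith
      positivity
    · change 0 < stdℓ b β 1 z
      rw [e1]
      have : 0 < z.re ^ 2 + z.im ^ 2 - 1 := by linarith
      positivity
    · exact div_pos hx.1 hy

end Chamber

end UpperHalfPlane

/-! ### Vertices of the chamber and the reflection group of a given triangle. -/

/-- `P` is the vertex of the chamber opposite to the mirror `k`. -/
def MirrorSystem.IsVertex {B X : Type*} {M : CoxeterMatrix B} [MetricSpace X]
    (S : MirrorSystem M X) (k : B) (P : X) : Prop :=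
  0 < S.ℓ k P ∧ ∀ i, i ≠ k → S.ℓ i P = 0

namespace UpperHalfPlane

section Std

variable {p₁ p₂ : ℕ} {b : ℝ}

theorem ext_coord' {z w : UpperHalfPlane} (hp : coordP z = coordP w) (hq : coordQ z = coordQ w)
    (ht : 0 ≤ coordT z * coordT w) : z = w := by
  refine ext_coord hq ?_
  have h1 := coordP_mul_coordQ z
  have h2 := coordP_mul_coordQ w
  rw [hp, hq] at h1
  have h3 : coordT z ^ 2 = coordT w ^ 2 := by linarith
  rcases sq_eq_sq_iff_eq_or_eq_neg.1 h3 with h | h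
  · exact h
  · rw [h] at ht
    have : coordT w = 0 := by nlinarith [sq_nonneg (coordT w)]
    rw [h, this, neg_zero]

theorem stdℓ_eq_zero_iff {β : ℝ} (hb : 1 < b) (z : UpperHalfPlane) :
    stdℓ b β 0 z = 0 ↔
      Real.sin β * (b ^ 2 * coordQ z - coordP z) = 2 * b * Real.cos β * coordT z := by
  have : 0 < b := by linarith
  simp only [stdℓ]
  rw [div_eq_zero_iff]
  simp only [OfNat.ofNat_ne_zero, or_false]
  constructor
  · intro h; field_simp at h; linarith
  · intro h; field_simp; linarith

/-- Two sides of the standard triangle meet in one point. -/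
theorem eq_of_stdℓ_eq_zero {β : ℝ} (hs : 0 < Real.sin β) (hc : 0 < Real.cos β) (hb : 1 < b)
    {i j : Fin 3} (hij : i ≠ j) {z w : UpperHalfPlane}
    (hzi : stdℓ b β i z = 0) (hzj : stdℓ b β j z = 0)
    (hwi : stdℓ b β i w = 0) (hwj : stdℓ b β j w = 0) : z = w := by
  have hb0 : 0 < b := by linarith
  have hb2 : 0 < b ^ 2 - 1 := by nlinarith
  have zP := coordP_pos z
  have zQ := coordQ_pos z
  have wP := coordP_pos w
  have wQ := coordQ_pos w
  have z1 := coordP_mul_coordQ z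
  have w1 := coordP_mul_coordQ w
  have key01 : stdℓ b β 0 z = 0 → stdℓ b β 1 z = 0 → stdℓ b β 0 w = 0 → stdℓ b β 1 w = 0 →
      z = w := by
    intro z0 z1' w0 w1'
    rw [stdℓ_eq_zero_iff hb] at z0 w0
    have ez : coordQ z = coordP z := by simp only [stdℓ] at z1'; linarith
    have ew : coordQ w = coordP w := by simp only [stdℓ] at w1'; linarith
    rw [ez] at z0 z1
    rw [ew] at w0 w1
    have hk : 0 < 2 * b * Real.cos β := by positivity
    have zT : 0 < coordT z := by
      have : 0 < 2 * b * Real.cos β * coordT z := by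
        rw [← z0]; apply mul_pos hs; nlinarith
      exact (pos_iff_pos_of_mul_pos this).1 hk
    have wT : 0 < coordT w := by
      have : 0 < 2 * b * Real.cos β * coordT w := by
        rw [← w0]; apply mul_pos hs; nlinarith
      exact (pos_iff_pos_of_mul_pos this).1 hk
    have e1 : coordT z * coordP w = coordT w * coordP z := by
      apply mul_left_cancel₀ hk.ne'
      linear_combination coordP z * w0 - coordP w * z0
    have e2 : coordP z ^ 2 = coordP w ^ 2 := by
      linear_combination coordP w ^ 2 * z1 - coordP z ^ 2 * w1 +
        (coordT z * coordP w + coordT w * coordP z) * e1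
    have e3 : coordP z = coordP w := (sq_eq_sq₀ zP.le wP.le).1 e2
    exact ext_coord' e3 (by rw [ez, ew, e3]) (by positivity)
  have key02 : stdℓ b β 0 z = 0 → stdℓ b β 2 z = 0 → stdℓ b β 0 w = 0 → stdℓ b β 2 w = 0 →
      z = w := by
    intro z0 z2 w0 w2
    rw [stdℓ_eq_zero_iff hb] at z0 w0
    simp only [stdℓ] at z2 w2
    rw [z2] at z0 z1
    rw [w2] at w0 w1
    have ez : coordP z = b ^ 2 * coordQ z := by
      have := mul_left_cancel₀ hs.ne' (z0.trans (by ring :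
        2 * b * Real.cos β * 0 = Real.sin β * 0))
      linarith
    have ew : coordP w = b ^ 2 * coordQ w := by
      have := mul_left_cancel₀ hs.ne' (w0.trans (by ring :
        2 * b * Real.cos β * 0 = Real.sin β * 0))
      linarith
    rw [ez] at z1
    rw [ew] at w1
    have e2 : (b * coordQ z) ^ 2 = (b * coordQ w) ^ 2 := by linear_combination z1 - w1
    have e3 := (sq_eq_sq₀ (by positivity) (by positivity)).1 e2
    exact ext_coord (mul_left_cancel₀ hb0.ne' e3) (by rw [z2, w2])
  have key12 : stdℓ b β 1 z = 0 → stdℓ b β 2 z = 0 → stdℓ b β 1 w = 0 → stdℓ b β 2 w = 0 →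
      z = w := by
    intro z0 z2 w0 w2
    simp only [stdℓ] at z0 z2 w0 w2
    rw [z2] at z1
    rw [w2] at w1
    have ez : coordP z = coordQ z := by linarith
    have ew : coordP w = coordQ w := by linarith
    rw [ez] at z1
    rw [ew] at w1
    have e2 : coordQ z ^ 2 = coordQ w ^ 2 := by linear_combination z1 - w1
    exact ext_coord ((sq_eq_sq₀ zQ.le wQ.le).1 e2) (by rw [z2, w2])
  fin_cases i <;> fin_cases j
  · exact absurd rfl hij
  · exact key01 hzi hzj hwi hwj
  · exact key02 hzi hzj hwi hwj
  · exact key01 hzj hzi hwj hwi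
  · exact absurd rfl hij
  · exact key12 hzi hzj hwi hwj
  · exact key02 hzj hzi hwj hwi
  · exact key12 hzj hzi hwj hwi
  · exact absurd rfl hij

theorem stdS_zero_mul_stdS_two (hb : 0 < b) (β : ℝ) :
    stdS b hb β 0 * stdS b hb β 2 = hypRotation (imPoint b hb) (2 * β) := by
  ext1 z
  change hypRotation (imPoint b hb) (2 * β) (reflection (reflection z)) = _
  rw [show reflection (reflection z) = z from reflection.left_inv z]

theorem stdS_one_mul_stdS_two (hb : 0 < b) (β : ℝ) :
    stdS b hb β 1 * stdS b hb β 2 = hypRotation I Real.pi := by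
  ext1 z
  change hypRotation I Real.pi (reflection (reflection z)) = _
  rw [show reflection (reflection z) = z from reflection.left_inv z]

theorem measurePreserving_stdS (hb : 0 < b) (β : ℝ) (i : Fin 3) :
    MeasurePreserving (stdS b hb β i) volume volume := by
  fin_cases i
  · exact (measurePreserving_hypRotation _ _).comp measurePreserving_reflection
  · exact (measurePreserving_hypRotation _ _).comp measurePreserving_reflection
  · exact measurePreserving_reflection

theorem coord_hypRotation_I_pi (z : UpperHalfPlane) :
    coordP (hypRotation I Real.pi z) = coordQ z ∧ coordQ (hypRotation I Real.pi z) = coordP z ∧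
      coordT (hypRotation I Real.pi z) = -coordT z := by
  have h := coord_hypRotation_imPoint 1 one_pos (Real.pi / 2) z
  rw [imPoint_one, mul_div_cancel₀ _ (two_ne_zero)] at h
  simpa using h

end Std

section Triangle

variable {p₁ p₂ : ℕ} {A B C : UpperHalfPlane}

/-- The reflection group of a triangle. The given triangle is the chamber of the group or the
image of the chamber under the reflection in the side `AB`. -/
structure TriangleMirrors (p₁ p₂ : ℕ) (h₁ : p₁ ≠ 1) (h₂ : p₂ ≠ 1) (A B C : UpperHalfPlane)
    extends MirrorSystem (triangleMatrix p₁ p₂ h₁ h₂) UpperHalfPlane where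
  s_one_mul_s_two : s 1 * s 2 = hypRotation A Real.pi
  s_zero_mul_s_two : s 0 * s 2 = hypRotation B (2 * Real.pi / p₁)
  measurePreserving_s : ∀ i, MeasurePreserving (s i) volume volume
  volume_openChamber : volume toMirrorSystem.openChamber =
    ENNReal.ofReal (Real.pi / 2 - Real.pi / p₁ - Real.pi / p₂)
  volume_chamber : volume toMirrorSystem.chamber =
    ENNReal.ofReal (Real.pi / 2 - Real.pi / p₁ - Real.pi / p₂)
  eq_of_ℓ_eq_zero : ∀ i j, i ≠ j → ∀ z w, ℓ i z = 0 → ℓ j z = 0 → ℓ i w = 0 → ℓ j w = 0 → z = w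
  isVertex_A : toMirrorSystem.IsVertex 0 A
  isVertex_B : toMirrorSystem.IsVertex 1 B
  /-- the third vertex of the chamber -/
  vertexC : UpperHalfPlane
  isVertex_vertexC : toMirrorSystem.IsVertex 2 vertexC
  vertexC_eq : vertexC = C ∨ vertexC = hypRotation A Real.pi C
  ℓ_A : ℓ 0 A ^ 2 = Real.cos (Real.pi / p₁) ^ 2 + Real.cos (Real.pi / p₂) ^ 2 - 1
  ℓ_B : Real.sin (Real.pi / p₁) ^ 2 * (1 + ℓ 1 B ^ 2) = Real.cos (Real.pi / p₂) ^ 2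
  ℓ_C : Real.sin (Real.pi / p₂) ^ 2 * (1 + ℓ 2 vertexC ^ 2) = Real.cos (Real.pi / p₁) ^ 2

set_option maxHeartbeats 2000000 in
theorem nonempty_triangleMirrors (h₁ : 3 ≤ p₁) (h₂ : 3 ≤ p₂) (hT : IsTriangle p₁ p₂ A B C) :
    Nonempty (TriangleMirrors p₁ p₂ (by omega) (by omega) A B C) := by
  obtain ⟨hAB, -, hBC, hσ, hs⟩ := cosh_dist_of_isTriangle h₁ h₂ hT
  obtain ⟨g, b, hb, hA, hB⟩ := exists_smul_eq_imPoint hAB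
  have hb0 : 0 < b := by linarith
  have hb2 : 0 < b ^ 2 - 1 := by nlinarith
  have ps := sin_pi_div_pos h₁
  have pc := cos_pi_div_pos h₁
  have qs := sin_pi_div_pos h₂
  have qc := cos_pi_div_pos h₂
  have hsc := Real.sin_sq_add_cos_sq (Real.pi / p₁)
  have hsc' := Real.sin_sq_add_cos_sq (Real.pi / p₂)
  obtain ⟨i1, i2, i3⟩ := coord_I
  obtain ⟨b1, b2, b3⟩ := coord_imPoint b hb0
  have dsm : ∀ x y : UpperHalfPlane, dist x y = dist (g • x) (g • y) :=
    fun x y => (dist_smul g x y).symm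
  have dAB : Real.cosh (dist A B) = (b + 1 / b) / 2 := by
    rw [dsm, hA, hB, cosh_dist_eq_coord, i1, i2, i3, b1, b2]; ring
  have hbc : Real.sin (Real.pi / p₁) * (b + 1 / b) = 2 * Real.cos (Real.pi / p₂) := by
    rw [dAB] at hσ; linarith
  have dAC : Real.cosh (dist A C) = (coordP (g • C) + coordQ (g • C)) / 2 := by
    rw [dsm, hA, cosh_dist_eq_coord, i1, i2, i3]; ring
  have dBC : Real.cosh (dist B C) = (b * coordQ (g • C) + coordP (g • C) / b) / 2 := by
    rw [dsm, hB, cosh_dist_eq_coord, b1, b2, b3]; ring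
  -- The hyperbolic Pythagorean theorem forces `C` onto the unit circle, the perpendicular to `AB`
  -- at `A`.
  have hPQ : coordQ (g • C) = coordP (g • C) := by
    rw [dAB, dAC, dBC] at hBC
    field_simp at hBC
    apply mul_left_cancel₀ hb2.ne'
    linarith
  have hPC : coordP (g • C) * Real.sin (Real.pi / p₂) = Real.cos (Real.pi / p₁) := by
    rw [← hs, dAC, hPQ]; ring
  have hTC : coordT (g • C) ^ 2 = coordP (g • C) ^ 2 - 1 := by
    have := coordP_mul_coordQ (g • C)
    rw [hPQ] at this; linarith
  have hPpos := coordP_pos (g • C)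
  have hbc2 : Real.sin (Real.pi / p₁) * (b ^ 2 + 1) = 2 * b * Real.cos (Real.pi / p₂) := by
    field_simp at hbc; linarith
  have hT2 : (Real.sin (Real.pi / p₁) * (b ^ 2 - 1) * coordP (g • C)) ^ 2 =
      (2 * b * Real.cos (Real.pi / p₁) * coordT (g • C)) ^ 2 := by
    rw [mul_pow _ (coordT (g • C)), hTC]
    have h1 : (Real.sin (Real.pi / p₁) * (b ^ 2 - 1)) ^ 2 =
        4 * b ^ 2 * (Real.cos (Real.pi / p₂) ^ 2 - Real.sin (Real.pi / p₁) ^ 2) := by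
      linear_combination (Real.sin (Real.pi / p₁) * (b ^ 2 + 1) +
        2 * b * Real.cos (Real.pi / p₂)) * hbc2
    rw [mul_pow, h1]
    linear_combination 4 * b ^ 2 * coordP (g • C) ^ 2 * (hsc' - hsc) -
      4 * b ^ 2 * (coordP (g • C) * Real.sin (Real.pi / p₂) + Real.cos (Real.pi / p₁)) * hPC
  have hL : 0 < Real.sin (Real.pi / p₁) * (b ^ 2 - 1) * coordP (g • C) :=
    mul_pos (mul_pos ps hb2) hPpos
  have hK : 0 < 2 * b * Real.cos (Real.pi / p₁) := by positivity
  -- The orientation of the triangle is not prescribed, so only the square of `coordT` is known. If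
  -- `C` is on the wrong side of `AB`, the half-turn about `A` takes it to its mirror image, which
  -- stays in the same orbit.
  obtain ⟨C', hC', hgC'⟩ : ∃ C', (C' = C ∨ C' = hypRotation A Real.pi C) ∧
      coordP (g • C') = coordP (g • C) ∧ coordQ (g • C') = coordP (g • C) ∧
      2 * b * Real.cos (Real.pi / p₁) * coordT (g • C') =
        Real.sin (Real.pi / p₁) * (b ^ 2 - 1) * coordP (g • C) := by
    rcases sq_eq_sq_iff_eq_or_eq_neg.1 hT2 with h | h
    · exact ⟨C, Or.inl rfl, rfl, hPQ, h.symm⟩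
    · refine ⟨hypRotation A Real.pi C, Or.inr rfl, ?_⟩
      rw [← hypRotation_smul, hA]
      obtain ⟨r1, r2, r3⟩ := coord_hypRotation_I_pi (g • C)
      rw [r1, r2, r3]
      exact ⟨hPQ, rfl, by linarith⟩
  obtain ⟨cP, cQ, cT⟩ := hgC'
  have hTC' : coordT (g • C') ^ 2 = coordP (g • C) ^ 2 - 1 := by
    have := coordP_mul_coordQ (g • C')
    rw [cP, cQ] at this; linarith
  set φ : UpperHalfPlane ≃ᵢ UpperHalfPlane := IsometryEquiv.constSMul g with hφ
  have hφm : MeasurePreserving φ volume volume := measurePreserving_constSMul g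
  have hφs : ∀ z, φ z = g • z := fun z => rfl
  set S := (stdMirrors p₁ p₂ h₁ h₂ b hb hbc).conj φ with hS
  have hℓ : ∀ i z, S.ℓ i z = stdℓ b (Real.pi / p₁) i (g • z) := fun i z => rfl
  have hss : ∀ i z, S.s i z = φ.symm (stdS b hb0 (Real.pi / p₁) i (φ z)) := fun i z => rfl
  have hpre : ∀ s : Set UpperHalfPlane, MeasurableSet s → volume (φ ⁻¹' s) = volume s :=
    fun s hs => hφm.measure_preimage hs.nullMeasurableSet
  have hch : S.chamber = φ ⁻¹' (stdMirrors p₁ p₂ h₁ h₂ b hb hbc).chamber := rfl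
  have hoc : S.openChamber = φ ⁻¹' (stdMirrors p₁ p₂ h₁ h₂ b hb hbc).openChamber := rfl
  have hA0 : stdℓ b (Real.pi / p₁) 0 I = Real.sin (Real.pi / p₁) * (b ^ 2 - 1) / (2 * b) := by
    simp only [stdℓ, i1, i2, i3]; field_simp; ring
  have hB1 : stdℓ b (Real.pi / p₁) 1 (imPoint b hb0) = (b ^ 2 - 1) / (2 * b) := by
    simp only [stdℓ, b1, b2]; field_simp
  refine ⟨{ toMirrorSystem := S, vertexC := C', s_one_mul_s_two := ?_, s_zero_mul_s_two := ?_,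
            measurePreserving_s := ?_, volume_openChamber := ?_, volume_chamber := ?_,
            eq_of_ℓ_eq_zero := ?_, isVertex_A := ?_, isVertex_B := ?_, isVertex_vertexC := ?_,
            vertexC_eq := hC', ℓ_A := ?_, ℓ_B := ?_, ℓ_C := ?_ }⟩
  · ext1 z
    change S.s 1 (S.s 2 z) = _
    rw [hss, hss, φ.apply_symm_apply, φ.symm_apply_eq]
    change (stdS b hb0 (Real.pi / p₁) 1 * stdS b hb0 (Real.pi / p₁) 2) (φ z) = _
    rw [stdS_one_mul_stdS_two, hφs, hφs, ← hypRotation_smul, hA]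
  · ext1 z
    change S.s 0 (S.s 2 z) = _
    rw [hss, hss, φ.apply_symm_apply, φ.symm_apply_eq]
    change (stdS b hb0 (Real.pi / p₁) 0 * stdS b hb0 (Real.pi / p₁) 2) (φ z) = _
    rw [stdS_zero_mul_stdS_two, hφs, hφs, ← hypRotation_smul, hB, mul_div_assoc]
  · intro i
    have hinv : MeasurePreserving φ.symm volume volume :=
      hφm.symm φ.toHomeomorph.toMeasurableEquiv
    exact hinv.comp ((measurePreserving_stdS hb0 _ i).comp hφm)
  · rw [hoc, hpre _ (MirrorSystem.isOpen_openChamber _).measurableSet]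
    exact volume_std_region h₁ h₂ hb hbc (MirrorSystem.isOpen_openChamber _).measurableSet
      (stdMirrors p₁ p₂ h₁ h₂ b hb hbc).openChamber_subset subset_rfl
  · rw [hch, hpre _ (MirrorSystem.isClosed_chamber _).measurableSet]
    exact volume_std_region h₁ h₂ hb hbc (MirrorSystem.isClosed_chamber _).measurableSet
      subset_rfl (stdMirrors p₁ p₂ h₁ h₂ b hb hbc).openChamber_subset
  · intro i j hij z w hz1 hz2 hw1 hw2
    exact φ.injective (eq_of_stdℓ_eq_zero ps pc hb hij hz1 hz2 hw1 hw2)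
  · constructor
    · rw [hℓ, hA, hA0]; positivity
    · intro i hi
      rw [hℓ, hA]
      fin_cases i
      · exact absurd rfl hi
      · change (coordP I - coordQ I) / 2 = 0
        rw [i1, i2]; norm_num
      · exact i3
  · constructor
    · rw [hℓ, hB, hB1]; positivity
    · intro i hi
      rw [hℓ, hB]
      fin_cases i
      · change stdℓ b (Real.pi / p₁) 0 (imPoint b hb0) = 0
        rw [stdℓ_eq_zero_iff hb, b1, b2, b3]; field_simp; ring
      · exact absurd rfl hi
      · exact b3
  · constructor
    · have : 0 < 2 * b * Real.cos (Real.pi / p₁) * coordT (g • C') := by rw [cT]; exact hL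
      exact (pos_iff_pos_of_mul_pos this).1 hK
    · intro i hi
      rw [hℓ]
      fin_cases i
      · change stdℓ b (Real.pi / p₁) 0 (g • C') = 0
        rw [stdℓ_eq_zero_iff hb, cP, cQ, cT]; ring
      · change (coordP (g • C') - coordQ (g • C')) / 2 = 0
        rw [cP, cQ]; ring
      · exact absurd rfl hi
  · rw [hℓ, hA, hA0]
    field_simp
    linear_combination (Real.sin (Real.pi / p₁) * (b ^ 2 + 1) +
        2 * b * Real.cos (Real.pi / p₂)) * hbc2 - 4 * b ^ 2 * hsc
  · rw [hℓ, hB, hB1]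
    field_simp
    linear_combination (Real.sin (Real.pi / p₁) * (b ^ 2 + 1) +
        2 * b * Real.cos (Real.pi / p₂)) * hbc2
  · rw [hℓ]
    change _ * (1 + coordT (g • C') ^ 2) = _
    rw [hTC']
    linear_combination (coordP (g • C) * Real.sin (Real.pi / p₂) + Real.cos (Real.pi / p₁)) * hPC

/-- Converse trigonometry: the law of cosines yields `cos B = cosh AC * sinh AB / sinh BC`, which is
positive and has the square of `cos (π / p₁)`. -/
theorem hypAngle_eq_of_cosh_dist (h₁ : 3 ≤ p₁) (hAB : A ≠ B)
    (hBC : Real.cosh (dist B C) = Real.cosh (dist A B) * Real.cosh (dist A C))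
    (hb : Real.cosh (dist A B) * Real.sin (Real.pi / p₁) = Real.cos (Real.pi / p₂))
    (hc : Real.cosh (dist A C) * Real.sin (Real.pi / p₂) = Real.cos (Real.pi / p₁)) :
    hypAngle A B C = Real.pi / p₁ := by
  have pc := cos_pi_div_pos h₁
  have hsc := Real.sin_sq_add_cos_sq (Real.pi / p₁)
  have hsc' := Real.sin_sq_add_cos_sq (Real.pi / p₂)
  have h := cos_hypAngle_mul A B C
  rw [dist_comm B A] at h
  set a := Real.cosh (dist A B)
  set e := Real.cosh (dist A C)
  have hx : 0 < Real.sinh (dist A B) := Real.sinh_pos_iff.2 (dist_pos.2 hAB)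
  have hx2 : Real.sinh (dist A B) ^ 2 = a ^ 2 - 1 := by rw [Real.sinh_sq]
  have hy2 : Real.sinh (dist B C) ^ 2 = a ^ 2 * e ^ 2 - 1 := by rw [Real.sinh_sq, hBC]; ring
  have he : 1 ≤ e := Real.one_le_cosh _
  have ha : 1 ≤ a := Real.one_le_cosh _
  have hy0 : 0 ≤ Real.sinh (dist B C) := Real.sinh_nonneg_iff.2 dist_nonneg
  have hy : 0 < Real.sinh (dist B C) := by
    apply lt_of_le_of_ne hy0
    intro h0
    rw [← h0] at hy2
    nlinarith [pow_pos hx 2, one_le_pow₀ he (n := 2), one_le_pow₀ ha (n := 2)]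
  rw [hBC] at h
  have h2 : Real.cos (hypAngle A B C) * Real.sinh (dist B C) = e * Real.sinh (dist A B) := by
    apply mul_left_cancel₀ hx.ne'
    linear_combination h - e * hx2
  have h3 : Real.cos (hypAngle A B C) = Real.cos (Real.pi / p₁) := by
    have hpos : 0 < Real.cos (hypAngle A B C) := by
      have : 0 < Real.cos (hypAngle A B C) * Real.sinh (dist B C) := by
        rw [h2]; positivity
      exact (pos_iff_pos_of_mul_pos this).2 hy
    apply (sq_eq_sq₀ hpos.le pc.le).1
    apply mul_right_cancel₀ (pow_pos hy 2).ne'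
    have h4 : Real.cos (hypAngle A B C) ^ 2 * Real.sinh (dist B C) ^ 2 = e ^ 2 * (a ^ 2 - 1) := by
      rw [← mul_pow, h2, mul_pow, hx2]
    rw [h4, hy2]
    linear_combination -a ^ 2 * e ^ 2 * hsc +
      e ^ 2 * (a * Real.sin (Real.pi / p₁) + Real.cos (Real.pi / p₂)) * hb +
      e ^ 2 * hsc' - (e * Real.sin (Real.pi / p₂) + Real.cos (Real.pi / p₁)) * hc
  apply Real.injOn_cos ⟨InnerProductGeometry.angle_nonneg _ _, InnerProductGeometry.angle_le_pi _ _⟩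
    _ h3
  constructor
  · have := Real.pi_pos; positivity
  · exact div_le_self Real.pi_pos.le (by exact_mod_cast (by omega : 1 ≤ p₁))

theorem sin_pi_div_lt_cos_pi_div (h₁ : 3 ≤ p₁) (h₂ : 3 ≤ p₂)
    (h : (1 : ℝ) / p₁ + 1 / p₂ < 1 / 2) :
    Real.sin (Real.pi / p₁) < Real.cos (Real.pi / p₂) := by
  have hp := Real.pi_pos
  have h₁' : (3 : ℝ) ≤ p₁ := by exact_mod_cast h₁
  have h₂' : (3 : ℝ) ≤ p₂ := by exact_mod_cast h₂
  have k1 : 0 < Real.pi / p₁ := by positivity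
  have k2 : 0 < Real.pi / p₂ := by positivity
  have k3 : Real.pi / p₁ + Real.pi / p₂ < Real.pi / 2 := by
    have := mul_lt_mul_of_pos_left h hp
    calc _ = Real.pi * (1 / p₁ + 1 / p₂) := by ring
      _ < _ := this
      _ = _ := by ring
  rw [← Real.sin_pi_div_two_sub]
  exact Real.sin_lt_sin_of_lt_of_le_pi_div_two (by linarith) (by linarith) (by linarith)

/-- The angles prescribe `cosh AB = a` and `cosh AC = e`, both above `1` because the angle sum is
less than `π`. Take `A = i`, `B = i b` with `log b = AB`, and `C` on the unit circle at height `1 /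
e`. -/
theorem exists_isTriangle (h₁ : 3 ≤ p₁) (h₂ : 3 ≤ p₂) (h : (1 : ℝ) / p₁ + 1 / p₂ < 1 / 2) :
    ∃ A B C : UpperHalfPlane, IsTriangle p₁ p₂ A B C := by
  have ps := sin_pi_div_pos h₁
  have qs := sin_pi_div_pos h₂
  have hlt := sin_pi_div_lt_cos_pi_div h₁ h₂ h
  have hlt' := sin_pi_div_lt_cos_pi_div h₂ h₁ (by linarith)
  set a := Real.cos (Real.pi / p₂) / Real.sin (Real.pi / p₁) with ha
  set e := Real.cos (Real.pi / p₁) / Real.sin (Real.pi / p₂) with he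
  have ha1 : 1 < a := by rwa [ha, one_lt_div ps]
  have he1 : 1 < e := by rwa [he, one_lt_div qs]
  set b := a + √(a ^ 2 - 1) with hb
  have hq : √(a ^ 2 - 1) ^ 2 = a ^ 2 - 1 := Real.sq_sqrt (by nlinarith)
  have hq0 := Real.sqrt_nonneg (a ^ 2 - 1)
  have hb0 : 0 < b := by linarith
  have hb1 : 1 < b := by linarith
  have hab : (b + 1 / b) / 2 = a := by
    field_simp
    rw [hb]; linear_combination hq
  set C : UpperHalfPlane := ⟨⟨√(e ^ 2 - 1) / e, 1 / e⟩, by positivity⟩ with hC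
  have hr : √(e ^ 2 - 1) ^ 2 = e ^ 2 - 1 := Real.sq_sqrt (by nlinarith)
  have c1 : C.re = √(e ^ 2 - 1) / e := rfl
  have c2 : C.im = 1 / e := rfl
  have cQ : coordQ C = e := by rw [coordQ, c2]; field_simp
  have cP : coordP C = e := by rw [coordP, c1, c2]; field_simp; rw [hr]; ring
  obtain ⟨i1, i2, i3⟩ := coord_I
  obtain ⟨b1, b2, b3⟩ := coord_imPoint b hb0
  have dAB : Real.cosh (dist I (imPoint b hb0)) = a := by
    rw [cosh_dist_eq_coord, i1, i2, i3, b1, b2, ← hab]; ring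
  have dAC : Real.cosh (dist I C) = e := by
    rw [cosh_dist_eq_coord, i1, i2, i3, cP, cQ]; ring
  have dBC : Real.cosh (dist (imPoint b hb0) C) = a * e := by
    rw [cosh_dist_eq_coord, b1, b2, b3, cP, cQ, ← hab]; ring
  have nAB : I ≠ imPoint b hb0 := by
    intro h
    rw [← h, dist_self, Real.cosh_zero] at dAB
    linarith
  have nAC : I ≠ C := by
    intro h
    rw [← h, dist_self, Real.cosh_zero] at dAC
    linarith
  have k1 : a * Real.sin (Real.pi / p₁) = Real.cos (Real.pi / p₂) := by rw [ha]; field_simp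
  have k2 : e * Real.sin (Real.pi / p₂) = Real.cos (Real.pi / p₁) := by rw [he]; field_simp
  refine ⟨I, imPoint b hb0, C, ?_, ?_, ?_⟩
  · have h := cos_hypAngle_mul (imPoint b hb0) I C
    rw [dAB, dAC, dBC, sub_self] at h
    have h1 := Real.sinh_pos_iff.2 (dist_pos.2 nAB)
    have h2 := Real.sinh_pos_iff.2 (dist_pos.2 nAC)
    have h3 : Real.cos (hypAngle (imPoint b hb0) I C) = Real.cos (Real.pi / 2) := by
      rw [Real.cos_pi_div_two]
      exact (mul_eq_zero.1 h).resolve_right (mul_pos h1 h2).ne'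
    exact Real.injOn_cos
      ⟨InnerProductGeometry.angle_nonneg _ _, InnerProductGeometry.angle_le_pi _ _⟩
      ⟨by linarith [Real.pi_pos], by linarith [Real.pi_pos]⟩ h3
  · exact hypAngle_eq_of_cosh_dist h₁ nAB (by rw [dAB, dAC, dBC]) (by rw [dAB, k1])
      (by rw [dAC, k2])
  · exact hypAngle_eq_of_cosh_dist h₂ nAC (by rw [dist_comm, dAB, dAC, dBC, mul_comm])
      (by rw [dAC, k2]) (by rw [dAB, k1])

end Triangle

end UpperHalfPlane

/-! ### Balls in `H² × R` -/

/-- The volume of the ball of radius `r` in `H² × R` is `2 π r * ballProfile r`. -/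
def ballProfile (r : ℝ) : ℝ := ∫ u in (-1 : ℝ)..1, (Real.cosh (r * √(1 - u ^ 2)) - 1)

theorem H2R.mem_closedBall {K X : H2R} {r : ℝ} (hr : 0 ≤ r) :
    X ∈ Metric.closedBall K r ↔ dist X.fst K.fst ^ 2 + (X.snd - K.snd) ^ 2 ≤ r ^ 2 := by
  rw [Metric.mem_closedBall, H2R.dist_eq, Real.sqrt_le_left hr, Real.dist_eq X.snd, sq_abs]

/-- The slice at height `t` above the centre is a hyperbolic disk of radius `√(r ^ 2 - t ^ 2)`.
Beyond `|t| = r` the real square root is `0`, so the integrand vanishes as it should. -/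
theorem volH2R_closedBall (K : H2R) {r : ℝ} (hr : 0 ≤ r) :
    volH2R (Metric.closedBall K r) =
      ∫⁻ t : ℝ, ENNReal.ofReal (2 * Real.pi * (Real.cosh √(r ^ 2 - t ^ 2) - 1)) := by
  have hm : MeasurableSet (MeasurableEquiv.toLp 2 (UpperHalfPlane × ℝ) ⁻¹' Metric.closedBall K r) :=
    (Metric.isClosed_closedBall.preimage
      (WithLp.prod_continuous_toLp 2 UpperHalfPlane ℝ)).measurableSet
  rw [volH2R, MeasurableEquiv.map_apply]
  change (Measure.prod volume volume) _ = _
  rw [Measure.prod_apply_symm hm, ← lintegral_sub_right_eq_self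
    (fun t => ENNReal.ofReal (2 * Real.pi * (Real.cosh √(r ^ 2 - t ^ 2) - 1))) K.snd]
  refine lintegral_congr fun t => ?_
  by_cases ht : (t - K.snd) ^ 2 ≤ r ^ 2
  · rw [← UpperHalfPlane.volume_closedBall K.fst (Real.sqrt_nonneg _)]
    congr 1
    ext z
    change WithLp.toLp 2 (z, t) ∈ Metric.closedBall K r ↔ _
    rw [H2R.mem_closedBall hr, Metric.mem_closedBall, Real.le_sqrt dist_nonneg]
    change dist z K.fst ^ 2 + (t - K.snd) ^ 2 ≤ r ^ 2 ↔ _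
    rw [le_sub_iff_add_le]
    exact sub_nonneg.2 ht
  · rw [Real.sqrt_eq_zero_of_nonpos (by linarith), Real.cosh_zero, sub_self, mul_zero,
      ENNReal.ofReal_zero]
    convert! measure_empty (μ := (volume : Measure UpperHalfPlane)) using 2
    rw [Set.eq_empty_iff_forall_notMem]
    intro z hz
    change WithLp.toLp 2 (z, t) ∈ Metric.closedBall K r at hz
    rw [H2R.mem_closedBall hr] at hz
    change dist z K.fst ^ 2 + (t - K.snd) ^ 2 ≤ r ^ 2 at hz
    exact ht (by nlinarith [sq_nonneg (dist z K.fst)])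

theorem volH2R_real_closedBall (K : H2R) {r : ℝ} (hr : 0 < r) :
    volH2R.real (Metric.closedBall K r) = 2 * Real.pi * r * ballProfile r := by
  have hc : Continuous fun t : ℝ => 2 * Real.pi * (Real.cosh √(r ^ 2 - t ^ 2) - 1) := by
    have := Real.continuous_cosh
    fun_prop
  rw [Measure.real, volH2R_closedBall K hr.le, ← integral_eq_lintegral_of_nonneg_ae
    (Filter.Eventually.of_forall fun t => ?_) hc.aestronglyMeasurable]
  · have h0 : ∀ t, t ∉ Set.Ioc (-r) r →
        2 * Real.pi * (Real.cosh √(r ^ 2 - t ^ 2) - 1) = 0 := by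
      intro t ht
      have : r ^ 2 - t ^ 2 ≤ 0 := by
        by_contra! h
        have := abs_lt_of_sq_lt_sq (by linarith : t ^ 2 < r ^ 2) hr.le
        exact ht ⟨(abs_lt.1 this).1, (abs_lt.1 this).2.le⟩
      rw [Real.sqrt_eq_zero_of_nonpos this]; simp
    rw [← setIntegral_eq_integral_of_forall_compl_eq_zero h0,
      ← intervalIntegral.integral_of_le (by linarith)]
    have h := intervalIntegral.integral_comp_mul_left (a := -1) (b := 1)
      (fun t => 2 * Real.pi * (Real.cosh √(r ^ 2 - t ^ 2) - 1)) hr.ne'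
    rw [mul_neg_one, mul_one, smul_eq_mul, eq_inv_mul_iff_mul_eq₀ hr.ne'] at h
    rw [← h, ballProfile, mul_comm (2 * Real.pi) r, mul_assoc,
      ← intervalIntegral.integral_const_mul (2 * Real.pi)]
    refine congrArg (r * ·) (intervalIntegral.integral_congr fun u _ => ?_)
    change 2 * Real.pi * _ = 2 * Real.pi * _
    rw [mul_pow, ← mul_one_sub, Real.sqrt_mul (sq_nonneg r), Real.sqrt_sq hr.le]
  · have := Real.one_le_cosh √(r ^ 2 - t ^ 2)
    have := Real.pi_pos
    change 0 ≤ 2 * Real.pi * _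
    exact mul_nonneg (by positivity) (by linarith)

theorem continuous_ballProfile_integrand (r : ℝ) :
    Continuous fun u : ℝ => Real.cosh (r * √(1 - u ^ 2)) - 1 := by
  have := Real.continuous_cosh
  fun_prop

theorem ballProfile_mono {r s : ℝ} (hr : 0 ≤ r) (h : r ≤ s) : ballProfile r ≤ ballProfile s := by
  refine intervalIntegral.integral_mono_on (by norm_num)
    ((continuous_ballProfile_integrand r).intervalIntegrable _ _)
    ((continuous_ballProfile_integrand s).intervalIntegrable _ _) fun u _ => ?_
  have hu := Real.sqrt_nonneg (1 - u ^ 2)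
  have : Real.cosh (r * √(1 - u ^ 2)) ≤ Real.cosh (s * √(1 - u ^ 2)) := by
    rw [Real.cosh_le_cosh, abs_of_nonneg (by positivity),
      abs_of_nonneg (mul_nonneg (hr.trans h) hu)]
    gcongr
  linarith

theorem ballProfile_nonneg (r : ℝ) : 0 ≤ ballProfile r := by
  refine intervalIntegral.integral_nonneg (by norm_num) fun u _ => ?_
  have := Real.one_le_cosh (r * √(1 - u ^ 2))
  linarith

theorem UpperHalfPlane.dist_imPoint {a b : ℝ} (ha : 0 < a) (hb : 0 < b) :
    dist (imPoint a ha) (imPoint b hb) = |Real.log a - Real.log b| :=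
  dist_of_re_eq (z := imPoint a ha) (w := imPoint b hb) rfl

/-- The points of geodesic segments. -/
theorem UpperHalfPlane.exists_dist_eq (P Q : UpperHalfPlane) {a : ℝ} (h0 : 0 ≤ a)
    (ha : a ≤ dist P Q) : ∃ R, dist P R = a ∧ dist Q R = dist P Q - a := by
  by_cases hPQ : P = Q
  · subst hPQ
    rw [dist_self] at ha
    have : a = 0 := le_antisymm ha h0
    exact ⟨P, by simp [this], by simp [this]⟩
  obtain ⟨g, b, hb, hP, hQ⟩ := exists_smul_eq_imPoint hPQ
  have hb0 : 0 < b := by linarith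
  have hlog : 0 < Real.log b := Real.log_pos hb
  have hd : dist P Q = Real.log b := by
    rw [← dist_smul g P Q, hP, hQ, ← imPoint_one, dist_imPoint, Real.log_one, zero_sub, abs_neg,
      abs_of_pos hlog]
  refine ⟨g⁻¹ • imPoint (Real.exp a) (Real.exp_pos a), ?_, ?_⟩
  · rw [← dist_smul g P, smul_inv_smul, hP, ← imPoint_one, dist_imPoint, Real.log_one,
      Real.log_exp, zero_sub, abs_neg, abs_of_nonneg h0]
  · rw [← dist_smul g Q, smul_inv_smul, hQ, dist_imPoint, Real.log_exp, hd,
      abs_of_nonneg (by linarith)]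

/-! ### Equivariance of the cells and the structure of the space groups. -/

namespace MirrorSystem

variable {B X : Type*} {M : CoxeterMatrix B} [MetricSpace X] (S : MirrorSystem M X)

theorem act_inv_apply (w : M.Group) (x : X) : S.act w⁻¹ (S.act w x) = x := by
  rw [← act_mul_apply, inv_mul_cancel, map_one]; rfl

theorem act_apply_inv (w : M.Group) (x : X) : S.act w (S.act w⁻¹ x) = x := by
  rw [← act_mul_apply, mul_inv_cancel, map_one]; rfl

theorem dist_act_act (v w : M.Group) (P Q : X) :
    dist (S.act v (S.act w P)) (S.act w Q) = dist (S.act (w⁻¹ * v * w) P) Q := by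
  rw [← (S.act w).dist_eq (S.act (w⁻¹ * v * w) P), ← act_mul_apply, ← act_mul_apply]
  congr 3
  group

theorem preimage_cell_act (w : M.Group) (P : X) :
    S.act w ⁻¹' S.cell (S.act w P) = S.cell P := by
  ext Q
  constructor
  · intro h v
    have := h (w * v * w⁻¹)
    rw [dist_act_act, (S.act w).dist_eq] at this
    convert! this using 4
    group
  · intro h v
    rw [dist_act_act, (S.act w).dist_eq]
    exact h _

theorem isClosed_cell (P : X) : IsClosed (S.cell P) := by
  have : S.cell P = ⋂ w, {Q | dist P Q ≤ dist (S.act w P) Q} := by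
    ext; simp [cell]
  rw [this]
  exact isClosed_iInter fun w => isClosed_le (by fun_prop) (by fun_prop)

end MirrorSystem

namespace UpperHalfPlane

/-- The product of an isometry of the hyperbolic plane and a translation. -/
def screwHom : (UpperHalfPlane ≃ᵢ UpperHalfPlane) × Multiplicative ℝ →* (H2R ≃ᵢ H2R) where
  toFun x := screwMotion x.1 (Multiplicative.toAdd x.2)
  map_one' := by
    ext1 X
    change WithLp.toLp 2 (X.fst, X.snd + 0) = X
    rw [add_zero]; rfl
  map_mul' x y := by
    ext1 X
    change WithLp.toLp 2 (x.1 (y.1 X.fst),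
      X.snd + (Multiplicative.toAdd x.2 + Multiplicative.toAdd y.2)) =
      WithLp.toLp 2 (x.1 (y.1 X.fst),
      X.snd + Multiplicative.toAdd y.2 + Multiplicative.toAdd x.2)
    congr 2; ring

theorem screwMotion_zpow (h : ℝ) (n : ℤ) : screwMotion 1 h ^ n = screwMotion 1 (n * h) := by
  have := (map_zpow screwHom (1, Multiplicative.ofAdd h) n).symm
  change screwMotion 1 h ^ n = screwMotion (1 ^ n) (n • h) at this
  rw [this, one_zpow, zsmul_eq_mul]

theorem screwMotion_mul (f g : UpperHalfPlane ≃ᵢ UpperHalfPlane) (a b : ℝ) :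
    screwMotion f a * screwMotion g b = screwMotion (f * g) (a + b) :=
  (map_mul screwHom (f, Multiplicative.ofAdd a) (g, Multiplicative.ofAdd b)).symm

theorem screwMotion_inv (f : UpperHalfPlane ≃ᵢ UpperHalfPlane) (a : ℝ) :
    (screwMotion f a)⁻¹ = screwMotion f⁻¹ (-a) :=
  (map_inv screwHom (f, Multiplicative.ofAdd a)).symm

variable {p₁ p₂ : ℕ} {h₁ : p₁ ≠ 1} {h₂ : p₂ ≠ 1} {A B C : UpperHalfPlane} {h : ℝ}

namespace TriangleMirrors

variable (T : TriangleMirrors p₁ p₂ h₁ h₂ A B C)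

theorem openChamber_nonempty (hadm : AdmissibleParams p₁ p₂) :
    T.toMirrorSystem.openChamber.Nonempty := by
  rw [Set.nonempty_iff_ne_empty]
  intro h0
  have h := T.volume_openChamber
  rw [h0, measure_empty, eq_comm, ENNReal.ofReal_eq_zero] at h
  have := mul_lt_mul_of_pos_left hadm.2.2 Real.pi_pos
  have e : Real.pi / 2 - Real.pi / p₁ - Real.pi / p₂ =
      Real.pi * (1 / 2) - Real.pi * (1 / p₁ + 1 / p₂) := by ring
  linarith

theorem lengthParity_simple_mul_simple (i j : Fin 3) :
    (triangleMatrix p₁ p₂ h₁ h₂).toCoxeterSystem.lengthParity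
      ((triangleMatrix p₁ p₂ h₁ h₂).toCoxeterSystem.simple i *
        (triangleMatrix p₁ p₂ h₁ h₂).toCoxeterSystem.simple j) = 1 := by
  rw [map_mul, CoxeterSystem.lengthParity_simple, CoxeterSystem.lengthParity_simple]
  decide

theorem act_simple_one_two : T.act ((triangleMatrix p₁ p₂ h₁ h₂).toCoxeterSystem.simple 1 *
    (triangleMatrix p₁ p₂ h₁ h₂).toCoxeterSystem.simple 2) = hypRotation A Real.pi := by
  rw [map_mul, MirrorSystem.act_simple, MirrorSystem.act_simple, T.s_one_mul_s_two]

theorem act_simple_zero_two : T.act ((triangleMatrix p₁ p₂ h₁ h₂).toCoxeterSystem.simple 0 *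
    (triangleMatrix p₁ p₂ h₁ h₂).toCoxeterSystem.simple 2) =
    hypRotation B (2 * Real.pi / p₁) := by
  rw [map_mul, MirrorSystem.act_simple, MirrorSystem.act_simple, T.s_zero_mul_s_two]

/-- The generators are even Coxeter elements with no translation part, together with one vertical
translation, and this shape is stable under products and inverses. -/
theorem exists_of_mem_spaceGroup {g : H2R ≃ᵢ H2R} (hg : g ∈ spaceGroup p₁ A B h) :
    ∃ (v : (triangleMatrix p₁ p₂ h₁ h₂).Group) (n : ℤ),
      (triangleMatrix p₁ p₂ h₁ h₂).toCoxeterSystem.lengthParity v = 1 ∧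
      g = screwMotion (T.act v) (n * h) := by
  induction hg using Subgroup.closure_induction with
  | mem x hx =>
    rcases hx with rfl | rfl | rfl
    · exact ⟨_, 0, lengthParity_simple_mul_simple 1 2, by rw [act_simple_one_two]; simp⟩
    · exact ⟨_, 0, lengthParity_simple_mul_simple 0 2, by rw [act_simple_zero_two]; simp⟩
    · exact ⟨1, 1, map_one _, by rw [map_one]; simp⟩
  | one =>
    refine ⟨1, 0, map_one _, ?_⟩
    rw [map_one, Int.cast_zero, zero_mul]
    exact (map_one screwHom).symm
  | mul x y _ _ hx hy =>
    obtain ⟨v, m, hv, rfl⟩ := hx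
    obtain ⟨w, n, hw, rfl⟩ := hy
    refine ⟨v * w, m + n, by rw [map_mul, hv, hw, one_mul], ?_⟩
    rw [screwMotion_mul, map_mul]; push_cast; ring_nf
  | inv x _ hx =>
    obtain ⟨v, m, hv, rfl⟩ := hx
    refine ⟨v⁻¹, -m, by rw [map_inv, hv, inv_one], ?_⟩
    rw [screwMotion_inv, map_inv]; push_cast; ring_nf

theorem screwMotion_mem_spaceGroup {v : (triangleMatrix p₁ p₂ h₁ h₂).Group}
    (hv : (triangleMatrix p₁ p₂ h₁ h₂).toCoxeterSystem.lengthParity v = 1) (n : ℤ) :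
    screwMotion (T.act v) (n * h) ∈ spaceGroup p₁ A B h := by
  have hA : screwMotion (hypRotation A Real.pi) 0 ∈ spaceGroup p₁ A B h :=
    Subgroup.subset_closure (by simp)
  have hB : screwMotion (hypRotation B (2 * Real.pi / p₁)) 0 ∈ spaceGroup p₁ A B h :=
    Subgroup.subset_closure (by simp)
  have hh : screwMotion 1 h ∈ spaceGroup p₁ A B h := Subgroup.subset_closure (by simp)
  have key : T.act v ∈ (spaceGroup p₁ A B h).comap (screwHom.comp (MonoidHom.inl _ _)) := by
    refine T.act_mem_of_lengthParity 2 (fun i => ?_) hv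
    fin_cases i
    · exact (congrArg (fun f => screwMotion f 0 ∈ spaceGroup p₁ A B h) T.s_zero_mul_s_two).mpr hB
    · exact (congrArg (fun f => screwMotion f 0 ∈ spaceGroup p₁ A B h) T.s_one_mul_s_two).mpr hA
    · change T.s 2 * T.s 2 ∈ _
      rw [T.s_mul_s]
      exact Subgroup.one_mem _
  have key' : screwMotion (T.act v) 0 ∈ spaceGroup p₁ A B h := key
  have := Subgroup.mul_mem _ key' (Subgroup.zpow_mem _ hh n)
  rwa [screwMotion_zpow, screwMotion_mul, mul_one, zero_add] at this

end TriangleMirrors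

end UpperHalfPlane

/-! ### Dirichlet cells, packing radii and densities over vertex orbits. -/

namespace UpperHalfPlane

variable {p₁ p₂ : ℕ} {h₁ : p₁ ≠ 1} {h₂ : p₂ ≠ 1} {A B C : UpperHalfPlane} {h : ℝ}

theorem fin_three_eq_or {i j k : Fin 3} (hij : i ≠ j) (hik : i ≠ k) (hjk : j ≠ k) (l : Fin 3) :
    l = i ∨ l = j ∨ l = k := by
  omega

namespace TriangleMirrors

variable (T : TriangleMirrors p₁ p₂ h₁ h₂ A B C)

/-- The vertices of the chamber. -/
def vertex : Fin 3 → UpperHalfPlane := ![A, B, T.vertexC]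

theorem isVertex_vertex (k : Fin 3) : T.IsVertex k (T.vertex k) := by
  fin_cases k
  · exact T.isVertex_A
  · exact T.isVertex_B
  · exact T.isVertex_vertexC

variable {i j k : Fin 3} {P : UpperHalfPlane} {K : H2R}

/-- The orbit of a vertex under the reflection group is an orbit of the rotation group. -/
theorem exists_even_act_eq (hik : i ≠ k) (hP : T.IsVertex k P)
    (v w : (triangleMatrix p₁ p₂ h₁ h₂).Group) :
    ∃ u, (triangleMatrix p₁ p₂ h₁ h₂).toCoxeterSystem.lengthParity u = 1 ∧
      T.act u (T.act w P) = T.act v P := by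
  obtain ⟨a, ha, ha'⟩ := T.exists_lengthParity_eq_one (hP.2 i hik) v
  obtain ⟨b, hb, hb'⟩ := T.exists_lengthParity_eq_one (hP.2 i hik) w
  refine ⟨a * b⁻¹, by rw [map_mul, map_inv, ha, hb]; rfl, ?_⟩
  rw [MirrorSystem.act_mul_apply, ← hb', MirrorSystem.act_inv_apply, ha']

/-- Squared distances add, and plane motions and vertical translations can be chosen independently.
The cell is therefore the product of the planar cell and a fibre interval; odd elements of the
reflection group add no orbit points of a vertex. -/
theorem dvCell_eq (hh : 0 < h) (hik : i ≠ k) (hP : T.IsVertex k P)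
    (w : (triangleMatrix p₁ p₂ h₁ h₂).Group) (hK : K.fst = T.act w P) :
    dvCell (spaceGroup p₁ A B h) K =
      {X | X.fst ∈ T.cell (T.act w P) ∧ |X.snd - K.snd| ≤ h / 2} := by
  ext X
  constructor
  · intro hX
    have key : ∀ (v : (triangleMatrix p₁ p₂ h₁ h₂).Group) (n : ℤ),
        (triangleMatrix p₁ p₂ h₁ h₂).toCoxeterSystem.lengthParity v = 1 →
        dist (T.act w P) X.fst ^ 2 + (K.snd - X.snd) ^ 2 ≤
          dist (T.act v (T.act w P)) X.fst ^ 2 + (K.snd + n * h - X.snd) ^ 2 := by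
      intro v n hv
      have h1 := hX _ (T.screwMotion_mem_spaceGroup hv n)
      rw [H2R.dist_eq, H2R.dist_eq, Real.sqrt_le_sqrt_iff (by positivity), Real.dist_eq,
        Real.dist_eq, sq_abs, sq_abs] at h1
      change dist K.fst X.fst ^ 2 + (K.snd - X.snd) ^ 2 ≤
        dist (T.act v K.fst) X.fst ^ 2 + (K.snd + n * h - X.snd) ^ 2 at h1
      rwa [hK] at h1
    constructor
    · intro v
      obtain ⟨u, hu, hu'⟩ := T.exists_even_act_eq hik hP (v * w) w
      have h1 := key u 0 hu
      rw [hu', MirrorSystem.act_mul_apply, Int.cast_zero, zero_mul, add_zero] at h1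
      exact (sq_le_sq₀ dist_nonneg dist_nonneg).1 (by linarith)
    · have h1 := key 1 1 (map_one _)
      have h2 := key 1 (-1) (map_one _)
      rw [map_one] at h1 h2
      change _ ≤ dist (T.act w P) _ ^ 2 + _ at h1
      change _ ≤ dist (T.act w P) _ ^ 2 + _ at h2
      push_cast at h1 h2
      rw [abs_le]
      constructor <;> nlinarith
  · rintro ⟨hX1, hX2⟩ g hg
    obtain ⟨v, n, hv, rfl⟩ := T.exists_of_mem_spaceGroup hg
    rw [H2R.dist_eq, H2R.dist_eq, Real.dist_eq, Real.dist_eq, sq_abs, sq_abs]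
    apply Real.sqrt_le_sqrt
    change dist K.fst X.fst ^ 2 + (K.snd - X.snd) ^ 2 ≤
      dist (T.act v K.fst) X.fst ^ 2 + (K.snd + n * h - X.snd) ^ 2
    rw [hK]
    have h1 : dist (T.act w P) X.fst ^ 2 ≤ dist (T.act v (T.act w P)) X.fst ^ 2 := by
      gcongr
      exact hX1 v
    have h2 : (K.snd - X.snd) ^ 2 ≤ (K.snd + n * h - X.snd) ^ 2 := by
      obtain ⟨h3, h4⟩ := abs_le.1 hX2
      rcases lt_trichotomy n 0 with hn | rfl | hn
      · have : (n : ℝ) ≤ -1 := by exact_mod_cast (by omega : n ≤ -1)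
        nlinarith [mul_nonneg (by linarith : (0 : ℝ) ≤ -n)
            (by linarith : 0 ≤ h / 2 + (X.snd - K.snd)),
          mul_nonneg (by linarith : (0 : ℝ) ≤ -n) (by linarith : (0 : ℝ) ≤ -n - 1), sq_nonneg h,
          mul_nonneg (mul_nonneg (by linarith : (0 : ℝ) ≤ -n) (by linarith : (0 : ℝ) ≤ -n - 1))
            (sq_nonneg h),
          mul_nonneg (mul_nonneg (by linarith : (0 : ℝ) ≤ -n)
            (by linarith : 0 ≤ h / 2 - (X.snd - K.snd))) hh.le,
          mul_nonneg (mul_nonneg (by linarith : (0 : ℝ) ≤ -n)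
            (by linarith : 0 ≤ h / 2 + (X.snd - K.snd))) hh.le]
      · simp
      · have : (1 : ℝ) ≤ n := by exact_mod_cast hn
        nlinarith [mul_nonneg (mul_nonneg (by linarith : (0 : ℝ) ≤ n)
            (by linarith : (0 : ℝ) ≤ n - 1)) (sq_nonneg h),
          mul_nonneg (mul_nonneg (by linarith : (0 : ℝ) ≤ n)
            (by linarith : 0 ≤ h / 2 - (X.snd - K.snd))) hh.le]
    linarith

theorem volH2R_real_dvCell (hadm : AdmissibleParams p₁ p₂) (hh : 0 < h) (hij : i ≠ j)
    (hik : i ≠ k) (hjk : j ≠ k) (hP : T.IsVertex k P)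
    (w : (triangleMatrix p₁ p₂ h₁ h₂).Group) (hK : K.fst = T.act w P) :
    volH2R.real (dvCell (spaceGroup p₁ A B h) K) =
      2 * (triangleMatrix p₁ p₂ h₁ h₂) i j * (Real.pi / 2 - Real.pi / p₁ - Real.pi / p₂) * h := by
  have hne := T.openChamber_nonempty hadm
  have h1 : volume (T.cell (T.act w P)) = 2 * (triangleMatrix p₁ p₂ h₁ h₂) i j *
      ENNReal.ofReal (Real.pi / 2 - Real.pi / p₁ - Real.pi / p₂) := by
    rw [← (T.measurePreserving_act T.measurePreserving_s w).measure_preimage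
      (T.isClosed_cell _).measurableSet.nullMeasurableSet, T.preimage_cell_act,
      T.measure_cell T.measurePreserving_s (T.volume_openChamber.trans T.volume_chamber.symm) hne
        hij hP.1 (hP.2 i hik) (hP.2 j hjk) (fin_three_eq_or hij hik hjk), T.volume_chamber]
  have h2 : MeasurableEquiv.toLp 2 (UpperHalfPlane × ℝ) ⁻¹' dvCell (spaceGroup p₁ A B h) K =
      T.cell (T.act w P) ×ˢ Metric.closedBall K.snd (h / 2) := by
    rw [T.dvCell_eq hh hik hP w hK]
    rfl
  have h3 : 0 ≤ Real.pi / 2 - Real.pi / p₁ - Real.pi / p₂ := by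
    have := mul_lt_mul_of_pos_left hadm.2.2 Real.pi_pos
    have e : Real.pi / 2 - Real.pi / p₁ - Real.pi / p₂ =
      Real.pi * (1 / 2) - Real.pi * (1 / p₁ + 1 / p₂) := by ring
    linarith
  rw [Measure.real, volH2R, MeasurableEquiv.map_apply, h2]
  change (Measure.prod volume volume _).toReal = _
  rw [Measure.prod_prod, h1, Real.volume_closedBall, ENNReal.toReal_mul, ENNReal.toReal_mul,
    ENNReal.toReal_ofReal h3, ENNReal.toReal_ofReal (by linarith)]
  simp only [ENNReal.toReal_mul, ENNReal.toReal_ofNat, ENNReal.toReal_natCast]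
  ring

/-- The nearest other orbit point in the plane is the mirror image of `P`, at distance `2 ρ` with
`sinh ρ = ℓ k P`; in the fibre it is at distance `h`. Balls up to half the smaller distance fit by
the triangle inequality. -/
theorem packingRadius_eq (hh : 0 < h) (hij : i ≠ j) (hik : i ≠ k) (hjk : j ≠ k)
    (hP : T.IsVertex k P) (w : (triangleMatrix p₁ p₂ h₁ h₂).Group) (hK : K.fst = T.act w P) :
    packingRadius (spaceGroup p₁ A B h) K = min (h / 2) (Real.arsinh (T.ℓ k P)) := by
  set ρ := Real.arsinh (T.ℓ k P) with hρ
  have hρ0 : 0 < ρ := Real.arsinh_pos_iff.2 hP.1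
  have hcosh : Real.cosh (2 * ρ) = 1 + 2 * T.ℓ k P ^ 2 := by
    rw [Real.cosh_two_mul, Real.cosh_sq, hρ, Real.sinh_arsinh]; ring
  have hset : {r : ℝ | 0 ≤ r ∧ Metric.closedBall K r ⊆ dvCell (spaceGroup p₁ A B h) K} =
      Set.Icc 0 (min (h / 2) ρ) := by
    rw [T.dvCell_eq hh hik hP w hK]
    ext r
    constructor
    · rintro ⟨hr, hsub⟩
      refine ⟨hr, le_min ?_ ?_⟩
      · have hX : WithLp.toLp 2 (K.fst, K.snd + r) ∈ Metric.closedBall K r := by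
          rw [H2R.mem_closedBall hr]
          change dist K.fst K.fst ^ 2 + (K.snd + r - K.snd) ^ 2 ≤ r ^ 2
          rw [dist_self]; linarith
        have := (hsub hX).2
        change |K.snd + r - K.snd| ≤ h / 2 at this
        rwa [add_sub_cancel_left, abs_of_nonneg hr] at this
      · by_contra! hlt
        have hd : dist P (T.s k P) = 2 * ρ := by
          have : Real.cosh (dist P (T.s k P)) = Real.cosh (2 * ρ) := by
            rw [T.cosh_dist_s, dist_self, Real.cosh_zero, hcosh]; ring
          exact Real.cosh_strictMonoOn.injOn dist_nonneg (by positivity : 0 ≤ 2 * ρ) this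
        -- A point of the segment from `P` to its mirror image beyond the midpoint; the minimum
        -- keeps it on the segment when `r` is large.
        obtain ⟨R, hR1, hR2⟩ := exists_dist_eq P (T.s k P) (a := min r (2 * ρ))
          (le_min hr (by linarith)) (by rw [hd]; exact min_le_right _ _)
        have hX : WithLp.toLp 2 (T.act w R, K.snd) ∈ Metric.closedBall K r := by
          rw [H2R.mem_closedBall hr]
          change dist (T.act w R) K.fst ^ 2 + (K.snd - K.snd) ^ 2 ≤ r ^ 2
          rw [hK, (T.act w).dist_eq, dist_comm, hR1, sub_self, zero_pow two_ne_zero, add_zero]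
          have : 0 ≤ min r (2 * ρ) := le_min hr (by linarith)
          gcongr
          exact min_le_left _ _
        have h1 : T.act w R ∈ T.cell (T.act w P) := (hsub hX).1
        have h2 : R ∈ T.act w ⁻¹' T.cell (T.act w P) := h1
        rw [T.preimage_cell_act] at h2
        have h3 := h2 ((triangleMatrix p₁ p₂ h₁ h₂).toCoxeterSystem.simple k)
        rw [MirrorSystem.act_simple, hR1, hR2, hd] at h3
        have : ρ < min r (2 * ρ) := lt_min hlt (by linarith)
        linarith
    · rintro ⟨hr, hle⟩
      have hr1 := hle.trans (min_le_left _ _)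
      have hr2 := hle.trans (min_le_right _ _)
      refine ⟨hr, fun X hX => ?_⟩
      rw [H2R.mem_closedBall hr, hK] at hX
      have hd : dist (T.act w P) X.fst ≤ r := by
        rw [dist_comm]
        exact le_of_sq_le_sq (by nlinarith [sq_nonneg (X.snd - K.snd)]) hr
      refine ⟨?_, ?_⟩
      · rw [← T.act_apply_inv w X.fst, (T.act w).dist_eq] at hd
        rw [← T.act_apply_inv w X.fst]
        change T.act w⁻¹ X.fst ∈ T.act w ⁻¹' T.cell (T.act w P)
        rw [T.preimage_cell_act]
        intro v
        rcases T.act_eq_or_le_dist_act hP.1.le (hP.2 i hik) (hP.2 j hjk)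
          (fin_three_eq_or hij hik hjk) v with h | h
        · rw [h]
        · rw [← hcosh, Real.cosh_le_cosh, abs_of_pos (by linarith), abs_of_nonneg dist_nonneg] at h
          have := dist_triangle_right P (T.act v P) (T.act w⁻¹ X.fst)
          linarith
      · exact (abs_le_of_sq_le_sq (by nlinarith [sq_nonneg (dist X.fst (T.act w P))]) hr).trans hr1
  rw [packingRadius, hset, csSup_Icc (le_min (by linarith) hρ0.le)]

theorem packingDensity_eq (hadm : AdmissibleParams p₁ p₂) (hh : 0 < h) (hij : i ≠ j)
    (hik : i ≠ k) (hjk : j ≠ k) (hP : T.IsVertex k P)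
    (w : (triangleMatrix p₁ p₂ h₁ h₂).Group) (hK : K.fst = T.act w P) :
    packingDensity (spaceGroup p₁ A B h) K =
      2 * min (h / 2) (Real.arsinh (T.ℓ k P)) / h *
      (ballProfile (min (h / 2) (Real.arsinh (T.ℓ k P))) /
        (2 * (triangleMatrix p₁ p₂ h₁ h₂) i j * (1 / 2 - 1 / p₁ - 1 / p₂))) := by
  have hρ0 : 0 < Real.arsinh (T.ℓ k P) := Real.arsinh_pos_iff.2 hP.1
  rw [packingDensity, T.packingRadius_eq hh hij hik hjk hP w hK,
    T.volH2R_real_dvCell hadm hh hij hik hjk hP w hK,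
    volH2R_real_closedBall K (lt_min (by linarith) hρ0)]
  have e : Real.pi / 2 - Real.pi / p₁ - Real.pi / p₂ =
      Real.pi * (1 / 2 - 1 / p₁ - 1 / p₂) := by ring
  rw [e, div_mul_div_comm]
  set r := min (h / 2) (Real.arsinh (T.ℓ k P))
  rw [show 2 * Real.pi * r * ballProfile r = Real.pi * (2 * r * ballProfile r) by ring,
    show 2 * ((triangleMatrix p₁ p₂ h₁ h₂) i j : ℝ) * (Real.pi * (1 / 2 - 1 / p₁ - 1 / p₂)) * h =
      Real.pi * (h * (2 * ((triangleMatrix p₁ p₂ h₁ h₂) i j : ℝ) *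
        (1 / 2 - 1 / p₁ - 1 / p₂))) by ring, mul_div_mul_left _ _ Real.pi_pos.ne']

/-- With `r = min (h / 2) ρ`, the factor `2 r / h` is at most `1` and the profile increases with `r
≤ ρ`. Both bounds are reached at `h = 2 ρ`, which removes `h` from the problem. -/
theorem packingDensity_le (hadm : AdmissibleParams p₁ p₂) (hh : 0 < h) (hij : i ≠ j)
    (hik : i ≠ k) (hjk : j ≠ k) (hP : T.IsVertex k P)
    (w : (triangleMatrix p₁ p₂ h₁ h₂).Group) (hK : K.fst = T.act w P) :
    packingDensity (spaceGroup p₁ A B h) K ≤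
      ballProfile (Real.arsinh (T.ℓ k P)) /
        (2 * (triangleMatrix p₁ p₂ h₁ h₂) i j * (1 / 2 - 1 / p₁ - 1 / p₂)) := by
  rw [T.packingDensity_eq hadm hh hij hik hjk hP w hK]
  have hρ0 : 0 < Real.arsinh (T.ℓ k P) := Real.arsinh_pos_iff.2 hP.1
  have h3 : (0 : ℝ) < 1 / 2 - 1 / p₁ - 1 / p₂ := by linarith [hadm.2.2]
  have h4 : 0 < min (h / 2) (Real.arsinh (T.ℓ k P)) := lt_min (by linarith) hρ0
  have h5 := ballProfile_nonneg (min (h / 2) (Real.arsinh (T.ℓ k P)))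
  have h6 : 2 * min (h / 2) (Real.arsinh (T.ℓ k P)) / h ≤ 1 := by
    rw [div_le_one hh]
    linarith [min_le_left (h / 2) (Real.arsinh (T.ℓ k P))]
  refine (mul_le_of_le_one_left (by positivity) h6).trans ?_
  gcongr
  exact ballProfile_mono h4.le (min_le_right _ _)

theorem packingDensity_eq_of_height (hadm : AdmissibleParams p₁ p₂) (hij : i ≠ j)
    (hik : i ≠ k) (hjk : j ≠ k) (hP : T.IsVertex k P) (hh : h = 2 * Real.arsinh (T.ℓ k P))
    (hK : K.fst = P) :
    packingDensity (spaceGroup p₁ A B h) K =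
      ballProfile (Real.arsinh (T.ℓ k P)) /
        (2 * (triangleMatrix p₁ p₂ h₁ h₂) i j * (1 / 2 - 1 / p₁ - 1 / p₂)) := by
  have hρ0 : 0 < Real.arsinh (T.ℓ k P) := Real.arsinh_pos_iff.2 hP.1
  rw [T.packingDensity_eq hadm (by linarith) hij hik hjk hP 1 (by rw [hK, map_one]; rfl),
    show h / 2 = Real.arsinh (T.ℓ k P) by linarith, min_self, hh, div_self (by positivity), one_mul]

/-- The fixed points of rotations lie over the orbits of the vertices. -/
theorem exists_eq_act_vertex (hadm : AdmissibleParams p₁ p₂)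
    (hK : IsMultiplyTransitive (spaceGroup p₁ A B h) K) :
    ∃ k w, K.fst = T.act w (T.vertex k) := by
  obtain ⟨g, hg, hgK, hg1⟩ := hK
  obtain ⟨v, n, hv, rfl⟩ := T.exists_of_mem_spaceGroup hg
  have e1 : T.act v K.fst = K.fst := congrArg (fun X : H2R => X.fst) hgK
  have e2 : K.snd + n * h = K.snd := congrArg (fun X : H2R => X.snd) hgK
  have e3 : (n : ℝ) * h = 0 := by linarith
  have hv1 : v ≠ 1 := by
    rintro rfl
    apply hg1
    rw [e3, map_one]
    exact map_one screwHom
  -- The translation part of a stabilizing element vanishes, so its plane part is a nontrivial even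
  -- element. Conjugation moves the fixed point into the chamber, where it must lie on two mirrors.
  obtain ⟨w, hw⟩ := T.exists_act_mem_chamber (T.openChamber_nonempty hadm) K.fst
  obtain ⟨i, j, hij, hi, hj⟩ := T.exists_ne_of_act_eq (w := w * v * w⁻¹) hw
    (by rw [MirrorSystem.act_mul_apply, MirrorSystem.act_inv_apply, MirrorSystem.act_mul_apply, e1])
    (by rw [map_mul, map_mul, map_inv, hv, mul_one, mul_inv_cancel])
    (by rwa [Ne, conj_eq_one_iff])
  obtain ⟨k, hik, hjk⟩ := (by decide : ∀ i j : Fin 3, ∃ k, i ≠ k ∧ j ≠ k) i j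
  refine ⟨k, w⁻¹, ?_⟩
  have hP := T.isVertex_vertex k
  rw [← T.eq_of_ℓ_eq_zero i j hij _ _ hi hj (hP.2 i hik) (hP.2 j hjk), MirrorSystem.act_inv_apply]

theorem hypRotation_B_self (T : TriangleMirrors p₁ p₂ h₁ h₂ A B C) :
    hypRotation B (2 * Real.pi / p₁) B = B := by
  rw [← T.s_zero_mul_s_two]
  change T.s 0 (T.s 2 B) = B
  rw [T.s_eq_of_ℓ_eq_zero (T.isVertex_B.2 2 (by decide)),
    T.s_eq_of_ℓ_eq_zero (T.isVertex_B.2 0 (by decide))]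

theorem isMultiplyTransitive_B (T : TriangleMirrors p₁ p₂ h₁ h₂ A B C)
    (hadm : AdmissibleParams p₁ p₂) (t : ℝ) :
    IsMultiplyTransitive (spaceGroup p₁ A B h) (WithLp.toLp 2 (B, t)) := by
  refine ⟨screwMotion (hypRotation B (2 * Real.pi / p₁)) 0,
    Subgroup.subset_closure (by simp), ?_, ?_⟩
  · change WithLp.toLp 2 (hypRotation B (2 * Real.pi / p₁) B, t + 0) = _
    rw [T.hypRotation_B_self, add_zero]
  -- Otherwise the rotation would fix an interior point of the chamber and be trivial in the Coxeter
  -- group, although its order there exceeds `1`.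
  · intro h0
    have hne := T.openChamber_nonempty hadm
    have h1 := T.pow_ne_one (i := 0) (j := 2) (by decide) hne (n := 1) one_pos
      (by change 1 < p₁; have := hadm.1; omega)
    apply h1
    obtain ⟨x, hx⟩ := hne
    apply T.eq_one_of_act_mem_openChamber (T.openChamber_subset hx)
    rw [pow_one, T.act_simple_zero_two]
    have : hypRotation B (2 * Real.pi / p₁) x = x :=
      congrArg (fun X : H2R => X.fst) (DFunLike.congr_fun h0 (WithLp.toLp 2 (x, 0)))
    rwa [this]

theorem exists_mem_spaceGroup_fst_eq (k : Fin 3) (w : (triangleMatrix p₁ p₂ h₁ h₂).Group)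
    (hK : K.fst = T.act w (T.vertex k)) :
    ∃ g ∈ spaceGroup p₁ A B h, (g K).fst = T.vertex k := by
  obtain ⟨i, hik⟩ := exists_ne k
  obtain ⟨u, hu, hu'⟩ := T.exists_even_act_eq hik (T.isVertex_vertex k) 1 w
  refine ⟨_, T.screwMotion_mem_spaceGroup hu 0, ?_⟩
  change T.act u K.fst = _
  rw [hK, hu', map_one]; rfl

/-- The third chamber vertex is `C` or its image under the half-turn about `A`, which belongs to the
group. -/
theorem exists_mem_spaceGroup_fst_eq_C (w : (triangleMatrix p₁ p₂ h₁ h₂).Group)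
    (hK : K.fst = T.act w (T.vertex 2)) :
    ∃ g ∈ spaceGroup p₁ A B h, (g K).fst = C := by
  obtain ⟨g, hg, hgK⟩ := T.exists_mem_spaceGroup_fst_eq (h := h) 2 w hK
  change _ = T.vertexC at hgK
  rcases T.vertexC_eq with h | h
  · exact ⟨g, hg, hgK.trans h⟩
  · refine ⟨screwMotion (hypRotation A Real.pi) 0 * g,
      Subgroup.mul_mem _ (Subgroup.subset_closure (by simp)) hg, ?_⟩
    change hypRotation A Real.pi (g K).fst = C
    rw [hgK, h, ← T.s_one_mul_s_two]
    have h2 : (T.s 1 * T.s 2) ^ 2 = 1 := T.s_mul_s_pow 1 2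
    rw [sq] at h2
    exact DFunLike.congr_fun h2 C

end TriangleMirrors

end UpperHalfPlane

/-! ### Estimates for the volume of balls -/

open scoped Nat in
/-- The partial sums of the series of `cosh √x`. -/
def coshSum (n : ℕ) (x : ℝ) : ℝ := ∑ k ∈ Finset.range n, x ^ k / (2 * k)!

open scoped Nat in
theorem hasSum_cosh_sub (n : ℕ) (r : ℝ) :
    HasSum (fun k => (r ^ 2) ^ (k + n) / ((2 * (k + n))! : ℝ))
      (Real.cosh r - coshSum n (r ^ 2)) := by
  have h := (hasSum_nat_add_iff' n).2 (Real.hasSum_cosh r)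
  simp only [pow_mul] at h
  exact h

theorem coshSum_le_cosh (n : ℕ) (r : ℝ) : coshSum n (r ^ 2) ≤ Real.cosh r := by
  have := (hasSum_cosh_sub n r).nonneg fun k => by positivity
  linarith

/-- Each term of the remainder has order at least `2 n`, so replacing `r` by `r * v` gains a factor
of at most `v ^ (2 n)`. -/
theorem cosh_mul_le (n : ℕ) {r v : ℝ} (hv0 : 0 ≤ v) (hv : v ≤ 1) :
    Real.cosh (r * v) ≤ coshSum n ((r * v) ^ 2) +
      (v ^ 2) ^ n * (Real.cosh r - coshSum n (r ^ 2)) := by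
  have h1 := hasSum_cosh_sub n (r * v)
  have h2 := (hasSum_cosh_sub n r).mul_left ((v ^ 2) ^ n)
  have := hasSum_le (fun k => ?_) h1 h2
  · linarith
  · rw [mul_pow, mul_pow, ← mul_div_assoc, mul_comm]
    refine div_le_div_of_nonneg_right (mul_le_mul_of_nonneg_right ?_ (by positivity))
      (by positivity)
    exact pow_le_pow_of_le_one (sq_nonneg v) (pow_le_one₀ hv0 hv) (by omega)

/-- The integral of `(1 - u ^ 2) ^ k` over `[-1, 1]`. -/
def wallisIntegral (k : ℕ) : ℝ := ∫ u in (-1 : ℝ)..1, (1 - u ^ 2) ^ k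

/-- The function `u (1 - u ^ 2) ^ (k + 1)` vanishes at both ends, so its derivative has integral
zero. -/
theorem wallisIntegral_succ (k : ℕ) :
    (2 * k + 3) * wallisIntegral (k + 1) = (2 * k + 2) * wallisIntegral k := by
  have hc : ∀ k : ℕ, IntervalIntegrable (fun u : ℝ => (1 - u ^ 2) ^ k) volume (-1) 1 :=
    fun k => (by fun_prop : Continuous fun u : ℝ => (1 - u ^ 2) ^ k).intervalIntegrable _ _
  have hd : ∀ u ∈ Set.uIcc (-1 : ℝ) 1, HasDerivAt (fun u : ℝ => u * (1 - u ^ 2) ^ (k + 1))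
      ((2 * k + 3) * (1 - u ^ 2) ^ (k + 1) - (2 * k + 2) * (1 - u ^ 2) ^ k) u := by
    intro u _
    have h0 : HasDerivAt (fun u : ℝ => 1 - u ^ 2) (-(2 * u)) u := by
      simpa using (hasDerivAt_pow 2 u).const_sub 1
    have h1 := (hasDerivAt_id u).mul (h0.pow (k + 1))
    convert! h1 using 1
    simp only [id, Pi.pow_apply, Nat.add_sub_cancel]
    push_cast
    ring
  have h := intervalIntegral.integral_eq_sub_of_hasDerivAt hd
    (((hc (k + 1)).const_mul _).sub ((hc k).const_mul _))
  rw [intervalIntegral.integral_sub ((hc (k + 1)).const_mul _) ((hc k).const_mul _),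
    intervalIntegral.integral_const_mul, intervalIntegral.integral_const_mul] at h
  norm_num at h
  unfold wallisIntegral
  linarith

theorem wallisIntegral_zero : wallisIntegral 0 = 2 := by
  norm_num [wallisIntegral]

theorem wallisIntegral_one : wallisIntegral 1 = 4 / 3 := by
  have := wallisIntegral_succ 0
  rw [wallisIntegral_zero] at this
  norm_num at this; linarith

theorem wallisIntegral_two : wallisIntegral 2 = 16 / 15 := by
  have := wallisIntegral_succ 1
  rw [wallisIntegral_one] at this
  norm_num at this; linarith

theorem wallisIntegral_three : wallisIntegral 3 = 32 / 35 := by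
  have := wallisIntegral_succ 2
  rw [wallisIntegral_two] at this
  norm_num at this; linarith

theorem wallisIntegral_four : wallisIntegral 4 = 256 / 315 := by
  have := wallisIntegral_succ 3
  rw [wallisIntegral_three] at this
  norm_num at this; linarith

open scoped Nat in
theorem integral_coshSum (n : ℕ) (x : ℝ) :
    IntervalIntegrable (fun u : ℝ => coshSum n (x * (1 - u ^ 2))) volume (-1) 1 ∧
    ∫ u in (-1 : ℝ)..1, coshSum n (x * (1 - u ^ 2)) =
      ∑ k ∈ Finset.range n, x ^ k / (2 * k)! * wallisIntegral k := by
  constructor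
  · refine Continuous.intervalIntegrable ?_ _ _
    unfold coshSum
    fun_prop
  · unfold coshSum
    rw [intervalIntegral.integral_finsetSum]
    · refine Finset.sum_congr rfl fun k _ => ?_
      rw [wallisIntegral, ← intervalIntegral.integral_const_mul]
      refine intervalIntegral.integral_congr fun u _ => ?_
      rw [mul_pow]; ring
    · intro k _
      exact Continuous.intervalIntegrable (by fun_prop) _ _

theorem ballProfile_eq (r : ℝ) :
    IntervalIntegrable (fun u : ℝ => Real.cosh (r * √(1 - u ^ 2))) volume (-1) 1 ∧
    ballProfile r = (∫ u in (-1 : ℝ)..1, Real.cosh (r * √(1 - u ^ 2))) - 2 := by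
  have hi : IntervalIntegrable (fun u : ℝ => Real.cosh (r * √(1 - u ^ 2))) volume (-1) 1 := by
    have := Real.continuous_cosh
    exact Continuous.intervalIntegrable (by fun_prop) _ _
  refine ⟨hi, ?_⟩
  rw [ballProfile, intervalIntegral.integral_sub hi intervalIntegrable_const]
  norm_num

theorem mul_sqrt_sq {r u : ℝ} (hu : u ∈ Set.Icc (-1 : ℝ) 1) :
    √(1 - u ^ 2) ^ 2 = 1 - u ^ 2 ∧ √(1 - u ^ 2) ≤ 1 ∧
      (r * √(1 - u ^ 2)) ^ 2 = r ^ 2 * (1 - u ^ 2) := by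
  have h : 0 ≤ 1 - u ^ 2 := by nlinarith [hu.1, hu.2]
  refine ⟨Real.sq_sqrt h, ?_, by rw [mul_pow, Real.sq_sqrt h]⟩
  exact Real.sqrt_le_one.2 (by nlinarith [sq_nonneg u])

open scoped Nat in
theorem le_ballProfile (n : ℕ) (r : ℝ) :
    ∑ k ∈ Finset.range n, (r ^ 2) ^ k / (2 * k)! * wallisIntegral k - 2 ≤ ballProfile r := by
  obtain ⟨h1, h2⟩ := integral_coshSum n (r ^ 2)
  obtain ⟨h3, h4⟩ := ballProfile_eq r
  rw [h4, ← h2]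
  have := intervalIntegral.integral_mono_on (by norm_num) h1 h3 fun u hu => by
    rw [← (mul_sqrt_sq (r := r) hu).2.2]
    exact coshSum_le_cosh n _
  linarith

-- The exact remainder of `cosh r` multiplies the last moment, giving a bound that is linear in
-- `cosh r` and polynomial in `r ^ 2`, without error terms.
open scoped Nat in
theorem ballProfile_le (n : ℕ) (r : ℝ) :
    ballProfile r ≤ ∑ k ∈ Finset.range n, (r ^ 2) ^ k / (2 * k)! * wallisIntegral k - 2 +
      wallisIntegral n * (Real.cosh r - coshSum n (r ^ 2)) := by
  obtain ⟨h1, h2⟩ := integral_coshSum n (r ^ 2)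
  obtain ⟨h3, h4⟩ := ballProfile_eq r
  have h5 : IntervalIntegrable
      (fun u : ℝ => (1 - u ^ 2) ^ n * (Real.cosh r - coshSum n (r ^ 2))) volume (-1) 1 :=
    Continuous.intervalIntegrable (by fun_prop) _ _
  rw [h4, ← h2, wallisIntegral, ← intervalIntegral.integral_mul_const]
  have := intervalIntegral.integral_mono_on (by norm_num) h3 (h1.add h5) fun u hu => by
    obtain ⟨e1, e2, e3⟩ := mul_sqrt_sq (r := r) hu
    have := cosh_mul_le n (r := r) (Real.sqrt_nonneg (1 - u ^ 2)) e2
    rw [e3, e1] at this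
    exact this
  rw [intervalIntegral.integral_add h1 h5] at this
  linarith

theorem ballProfile_le_one (r : ℝ) : ballProfile r ≤ 4 / 3 * (Real.cosh r - 1) := by
  have := ballProfile_le 1 r
  simp only [coshSum, Finset.sum_range_one, wallisIntegral_zero, wallisIntegral_one] at this
  norm_num at this
  linarith

/-- A linear estimate, almost sharp for `cosh r = 2`. -/
theorem ballProfile_le_linear (r : ℝ) :
    ballProfile r ≤ 2 * (0.64845 + 0.63316 * (Real.cosh r - 2)) := by
  have h1 := ballProfile_le 3 r
  have h2 := coshSum_le_cosh 4 r
  simp only [coshSum, Finset.sum_range_succ, Finset.sum_range_zero, wallisIntegral_zero,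
    wallisIntegral_one, wallisIntegral_two, wallisIntegral_three] at h1 h2
  norm_num [Nat.factorial] at h1 h2
  -- The difference of the two bounds is controlled by a cubic in `r ^ 2` that nearly touches zero
  -- at `r ^ 2 = arcosh 2 ^ 2 ≈ 1.734`.
  have h3 : 0 ≤ (r ^ 2 - 1.735) ^ 2 * (r ^ 2 + 20.5) := by positivity
  have h0 := sq_nonneg r
  nlinarith

/-- The series bound turns `cosh r ≤ c` into `r ^ 2 ≤ x`; in applications `x` is a decimal just
above `r ^ 2`. -/
theorem ballProfile_le_of_cosh_le {r x c : ℝ} (hc : Real.cosh r ≤ c)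
    (hx : c ≤ coshSum 5 x) (hx0 : 0 ≤ x) :
    ballProfile r ≤ x / 2 * (4 / 3 - 256 / 315) + x ^ 2 / 24 * (16 / 15 - 256 / 315) +
      x ^ 3 / 720 * (32 / 35 - 256 / 315) + 256 / 315 * (c - 1) := by
  have h0 := sq_nonneg r
  have hxr : r ^ 2 ≤ x := by
    by_contra! hlt
    have h2 := coshSum_le_cosh 5 r
    have h3 : coshSum 5 x < coshSum 5 (r ^ 2) := by
      simp only [coshSum, Finset.sum_range_succ, Finset.sum_range_zero]
      norm_num [Nat.factorial]
      gcongr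
    linarith
  have h1 := ballProfile_le 4 r
  simp only [coshSum, Finset.sum_range_succ, Finset.sum_range_zero, wallisIntegral_zero,
    wallisIntegral_one, wallisIntegral_two, wallisIntegral_three, wallisIntegral_four] at h1
  norm_num [Nat.factorial] at h1
  have h2 : (r ^ 2) ^ 2 ≤ x ^ 2 := by gcongr
  have h3 : (r ^ 2) ^ 3 ≤ x ^ 3 := by gcongr
  linarith

theorem cosh_one_lt : Real.cosh 1 < 1.54308064 := by
  rw [Real.cosh_eq, Real.exp_neg]
  have h1 := Real.exp_one_gt_d9
  have h2 := Real.exp_one_lt_d9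
  have h3 : (Real.exp 1)⁻¹ < 1 / 2.7182818283 := by
    rw [← one_div]
    exact one_div_lt_one_div_of_lt (by norm_num) h1
  have h4 : (1 : ℝ) / 2.7182818283 < 0.367879442 := by norm_num
  linarith

/-- Here `x` is a lower estimate of `r ^ 2`. The remainder of `cosh √x` is compared with that of
`cosh 1`, for which a numerical bound is known. -/
theorem le_ballProfile_of_le_cosh {r x c : ℝ} (hr : 0 ≤ r) (hx0 : 0 ≤ x) (hx1 : x ≤ 1)
    (hc : c ≤ Real.cosh r)
    (hx : coshSum 4 x + x ^ 4 * (1.54308064 - coshSum 4 1) ≤ c) :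
    x / 2 * (4 / 3) + x ^ 2 / 24 * (16 / 15) + x ^ 3 / 720 * (32 / 35) +
      x ^ 4 / 40320 * (256 / 315) ≤ ballProfile r := by
  have hxr : x ≤ r ^ 2 := by
    have h1 := cosh_mul_le 4 (r := 1) (Real.sqrt_nonneg x) (Real.sqrt_le_one.2 hx1)
    rw [one_mul, Real.sq_sqrt hx0, one_pow] at h1
    have h2 : Real.cosh √x ≤ Real.cosh r := by
      have := cosh_one_lt
      have h3 : x ^ 4 * (Real.cosh 1 - coshSum 4 1) ≤ x ^ 4 * (1.54308064 - coshSum 4 1) := by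
        gcongr
      linarith
    rw [Real.cosh_le_cosh, abs_of_nonneg (Real.sqrt_nonneg x), abs_of_nonneg hr] at h2
    exact (Real.sqrt_le_left hr).1 h2
  have h1 := le_ballProfile 5 r
  simp only [Finset.sum_range_succ, Finset.sum_range_zero, wallisIntegral_zero,
    wallisIntegral_one, wallisIntegral_two, wallisIntegral_three, wallisIntegral_four] at h1
  norm_num [Nat.factorial] at h1
  have h2 : x ^ 2 ≤ (r ^ 2) ^ 2 := by gcongr
  have h3 : x ^ 3 ≤ (r ^ 2) ^ 3 := by gcongr
  have h4 : x ^ 4 ≤ (r ^ 2) ^ 4 := by gcongr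
  linarith

/-! ### Estimates for the densities -/

/-- The relation `cos 4θ = -cos 3θ` makes `cos θ` a root of a cubic, which localises it. -/
theorem lt_sin_pi_div_seven : 0.43386 < Real.sin (Real.pi / 7) := by
  have hp := Real.pi_pos
  set θ := Real.pi / 7 with hθ
  have hs : 0 < Real.sin θ := Real.sin_pos_of_pos_of_lt_pi (by positivity) (by rw [hθ]; linarith)
  have hC : 0 < Real.cos θ :=
    Real.cos_pos_of_mem_Ioo ⟨by rw [hθ]; linarith, by rw [hθ]; linarith⟩
  have h1 : Real.cos (2 * (2 * θ)) = -Real.cos (3 * θ) := by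
    rw [← Real.cos_pi_sub]; congr 1; rw [hθ]; ring
  rw [Real.cos_two_mul, Real.cos_two_mul, Real.cos_three_mul] at h1
  have h2 : (Real.cos θ + 1) *
      (8 * Real.cos θ ^ 3 - 4 * Real.cos θ ^ 2 - 4 * Real.cos θ + 1) = 0 := by
    linear_combination h1
  have h3 := (mul_eq_zero.1 h2).resolve_left (by positivity)
  have h4 : Real.cos θ < 0.90098 := by
    by_contra! h
    nlinarith [mul_nonneg (sub_nonneg.2 h) (sub_nonneg.2 h),
      mul_nonneg (mul_nonneg (sub_nonneg.2 h) (sub_nonneg.2 h)) hC.le]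
  have h5 := Real.sin_sq_add_cos_sq θ
  apply lt_of_pow_lt_pow_left₀ 2 hs.le
  nlinarith

theorem lt_sin_pi_div_eight : 0.3826833 < Real.sin (Real.pi / 8) := by
  rw [Real.sin_pi_div_eight, lt_div_iff₀ two_pos]
  apply Real.lt_sqrt_of_sq_lt
  have : √2 < 1.41421357 := by rw [Real.sqrt_lt' (by norm_num)]; norm_num
  norm_num at this ⊢
  linarith

/-- The triple angle formula gives `3 s - 4 s ^ 3 = √3 / 2`, and the cubic is increasing for `s ≤ 1
/ 2`. -/
theorem lt_sin_pi_div_nine : 0.34202014 < Real.sin (Real.pi / 9) ∧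
    Real.sin (Real.pi / 9) < 0.34202015 := by
  have hp := Real.pi_pos
  have h1 := Real.sin_three_mul (Real.pi / 9)
  rw [show 3 * (Real.pi / 9) = Real.pi / 3 by ring, Real.sin_pi_div_three] at h1
  have hs : 0 < Real.sin (Real.pi / 9) :=
    Real.sin_pos_of_pos_of_lt_pi (by positivity) (by linarith)
  have h2 : Real.sin (Real.pi / 9) ≤ 1 / 2 := by
    rw [← Real.sin_pi_div_six]
    exact Real.sin_le_sin_of_le_of_le_pi_div_two (by linarith) (by linarith) (by linarith)
  have h3 : 1.7320508075 < √3 := Real.lt_sqrt_of_sq_lt (by norm_num)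
  have h4 : √3 < 1.7320508076 := by rw [Real.sqrt_lt' (by norm_num)]; norm_num
  set s := Real.sin (Real.pi / 9)
  constructor
  · by_contra! h
    have : 0 ≤ (0.34202014 - s) * (3 - 4 * (s ^ 2 + s * 0.34202014 + 0.34202014 ^ 2)) :=
      mul_nonneg (by linarith) (by nlinarith)
    nlinarith
  · by_contra! h
    have : 0 ≤ (s - 0.34202015) * (3 - 4 * (s ^ 2 + s * 0.34202015 + 0.34202015 ^ 2)) :=
      mul_nonneg (by linarith) (by nlinarith)
    nlinarith

theorem lt_sin_pi_div_ten : 0.30901 < Real.sin (Real.pi / 10) := by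
  have hp := Real.pi_pos
  have h1 := Real.cos_two_mul_eq_one_sub (Real.pi / 10)
  rw [show 2 * (Real.pi / 10) = Real.pi / 5 by ring, Real.cos_pi_div_five] at h1
  have hs : 0 < Real.sin (Real.pi / 10) :=
    Real.sin_pos_of_pos_of_lt_pi (by positivity) (by linarith)
  have h4 : √5 < 2.23607 := by rw [Real.sqrt_lt' (by norm_num)]; norm_num
  apply lt_of_pow_lt_pow_left₀ 2 hs.le
  norm_num at h4 ⊢
  linarith

theorem cosh_lt_of_lt_sin {r s c σ : ℝ} (h : Real.cosh r * s = 1 / 2) (hσ : 0 < σ) (hs : σ < s)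
    (hc : 1 / 2 ≤ c * σ) : Real.cosh r ≤ c := by
  have h1 := Real.cosh_pos r
  have h2 : Real.cosh r * σ ≤ c * σ := by nlinarith
  exact le_of_mul_le_mul_right h2 hσ

/-- For `q = 3` the denominator of the density is `p / 3 - 2`, so `p = 7, 8, 9, 10` have the
denominators `1/3, 2/3, 1, 4/3`. -/
theorem ballProfile_lt_seven {r : ℝ} (h : Real.cosh r * Real.sin (Real.pi / 7) = 1 / 2) :
    ballProfile r < 0.607267 / 3 := by
  refine (ballProfile_le_of_cosh_le (x := 0.29751)
    (cosh_lt_of_lt_sin (c := 1.15245) h (by norm_num) lt_sin_pi_div_seven (by norm_num))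
    ?_ (by norm_num)).trans_lt ?_
  · norm_num [coshSum, Finset.sum_range_succ, Nat.factorial]
  · norm_num

theorem ballProfile_lt_eight {r : ℝ} (h : Real.cosh r * Real.sin (Real.pi / 8) = 1 / 2) :
    ballProfile r < 0.607267 * 2 / 3 := by
  refine (ballProfile_le_of_cosh_le (x := 0.5841334)
    (cosh_lt_of_lt_sin (c := 1.3065635) h (by norm_num) lt_sin_pi_div_eight (by norm_num))
    ?_ (by norm_num)).trans_lt ?_
  · norm_num [coshSum, Finset.sum_range_succ, Nat.factorial]
  · norm_num

theorem ballProfile_lt_nine {r : ℝ} (h : Real.cosh r * Real.sin (Real.pi / 9) = 1 / 2) :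
    ballProfile r < 0.607268 := by
  refine (ballProfile_le_of_cosh_le (x := 0.8603281)
    (cosh_lt_of_lt_sin (c := 1.46190222) h (by norm_num) lt_sin_pi_div_nine.1 (by norm_num))
    ?_ (by norm_num)).trans_lt ?_
  · norm_num [coshSum, Finset.sum_range_succ, Nat.factorial]
  · norm_num

theorem lt_ballProfile_nine {r : ℝ} (hr : 0 ≤ r)
    (h : Real.cosh r * Real.sin (Real.pi / 9) = 1 / 2) : 0.607267 < ballProfile r := by
  have hc : 1.46190217 ≤ Real.cosh r := by
    have h1 := Real.cosh_pos r
    have h2 := lt_sin_pi_div_nine.2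
    nlinarith
  refine lt_of_lt_of_le ?_ (le_ballProfile_of_le_cosh (x := 0.8603275) hr (by norm_num)
    (by norm_num) hc ?_)
  · norm_num
  · norm_num [coshSum, Finset.sum_range_succ, Nat.factorial]

theorem ballProfile_lt_ten {r : ℝ} (h : Real.cosh r * Real.sin (Real.pi / 10) = 1 / 2) :
    ballProfile r < 0.607267 * 4 / 3 := by
  refine (ballProfile_le_of_cosh_le (x := 1.1264)
    (cosh_lt_of_lt_sin (c := 1.61808) h (by norm_num) lt_sin_pi_div_ten (by norm_num))
    ?_ (by norm_num)).trans_lt ?_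
  · norm_num [coshSum, Finset.sum_range_succ, Nat.factorial]
  · norm_num

/-- As `b` tends to `0`, the linear bound makes the left side tend to `0.63316` and the right side
to about `0.6359`. The cruder factor `4 / 3` would lead to `2 / 3` and fail. -/
theorem ballProfile_mul_lt_three {r b : ℝ} (hb0 : 0 < b) (hb : b ≤ Real.pi / 11)
    (h : Real.cosh r * Real.sin b = 1 / 2) :
    ballProfile r * b < 0.607267 * (2 * (Real.pi / 2 - Real.pi / 3 - b)) := by
  have hp1 := Real.pi_gt_d6
  have hp2 := Real.pi_lt_d6
  have hb1 : b < 0.28561 := by linarith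
  have h1 := Real.sin_ge_sub_cube hb0.le
  have h2 := ballProfile_le_linear r
  have h3 := Real.cosh_pos r
  have h4 : Real.cosh r * b * (1 - b ^ 2 / 6) ≤ 1 / 2 := by
    have := mul_le_mul_of_nonneg_left h1 h3.le
    linarith
  have hbb : b ^ 2 < 0.28561 ^ 2 := by gcongr
  -- The coefficient `0.1691` slightly exceeds `1 / 6`, enough to absorb the fourth-order term for
  -- `b < 0.28561`.
  have h5 : 1 ≤ (1 + 0.1691 * b ^ 2) * (1 - b ^ 2 / 6) := by nlinarith [sq_nonneg b]
  have h6 : Real.cosh r * b ≤ (1 + 0.1691 * b ^ 2) / 2 := by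
    have : 0 < 1 - b ^ 2 / 6 := by nlinarith
    refine le_of_mul_le_mul_right (h4.trans ?_) this
    linarith
  have h7 := mul_le_mul_of_nonneg_right h2 hb0.le
  have h8 : 0 ≤ b * (0.28561 - b) := mul_nonneg hb0.le (by linarith)
  nlinarith

theorem ballProfile_mul_lt_four {r b : ℝ} (hb0 : 0 < b) (hb : b ≤ Real.pi / 5)
    (h : Real.cosh r * Real.sin b = √2 / 2) :
    ballProfile r * b < 0.607267 * (2 * (Real.pi / 2 - Real.pi / 4 - b)) := by
  have hp1 := Real.pi_gt_d4
  have hp2 := Real.pi_lt_d4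
  have hb1 : b < 0.6284 := by linarith
  have h1 := Real.sin_ge_sub_cube hb0.le
  have h2 := ballProfile_le_one r
  have h3 := Real.cosh_pos r
  have hs2 : √2 < 1.41422 := by rw [Real.sqrt_lt' (by norm_num)]; norm_num
  have hbb : b ^ 2 < 0.6284 ^ 2 := by gcongr
  have hpos : 0 < 1 - b ^ 2 / 6 := by nlinarith
  have h4 : Real.cosh r * b * (1 - b ^ 2 / 6) ≤ 0.70711 := by
    have := mul_le_mul_of_nonneg_left h1 h3.le
    linarith
  -- The linear factor approximates `0.607267 * (π / 4 - b) + 2 / 3 * b`, which is what `2 / 3 *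
  -- cosh r * b` has to stay below.
  have h5 : 2 / 3 * 0.70711 < (0.47694 + 0.0594 * b) * (1 - b ^ 2 / 6) := by
    nlinarith [mul_pos hb0 (sub_pos.2 hb1), mul_pos (mul_pos hb0 hb0) (sub_pos.2 hb1)]
  have h6 : 2 / 3 * (Real.cosh r * b) < 0.47694 + 0.0594 * b := by
    refine lt_of_mul_lt_mul_right (lt_of_le_of_lt ?_ h5) hpos.le
    linarith
  have h7 := mul_le_mul_of_nonneg_right h2 hb0.le
  nlinarith

/-- Used with `κ = 3 π / 20` and `t = b / 2 ≤ π / 6`. The constant `0.91` is admissible because `4 /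
3 * 0.91 < 2 * 0.607267`. -/
theorem cos_mul_le {κ t : ℝ} (hκ0 : 0.4707 ≤ κ) (hκ1 : κ ≤ Real.pi / 4) (ht0 : 0 < t)
    (ht : t ≤ 0.53) :
    Real.cos (κ + t) * t ≤ 0.91 * (Real.sin t * Real.cos t) := by
  have hp2 := Real.pi_lt_d4
  have h1 := Real.sin_ge_sub_cube ht0.le
  have hc1 := Real.cos_le_one t
  have hc0 : 0 ≤ Real.cos t :=
    Real.cos_nonneg_of_mem_Icc ⟨by linarith [Real.pi_gt_three], by linarith [Real.pi_gt_three]⟩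
  have hκs : 0.45 ≤ Real.sin κ := by
    have h2 : Real.sin 0.4707 ≤ Real.sin κ :=
      Real.sin_le_sin_of_le_of_le_pi_div_two (by linarith [Real.pi_gt_three]) (by linarith) hκ0
    have h3 := Real.sin_ge_sub_cube (x := 0.4707) (by norm_num)
    norm_num at h2 h3 ⊢
    linarith
  have hκc : Real.cos κ ≤ 0.9 := by
    have := Real.sin_sq_add_cos_sq κ
    nlinarith
  have hst : 0 ≤ Real.sin t := by nlinarith [mul_pos ht0 ht0, mul_pos (mul_pos ht0 ht0) ht0]
  have h2 : Real.cos (κ + t) ≤ 0.9 * Real.cos t - 0.45 * Real.sin t := by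
    rw [Real.cos_add]
    gcongr
  have h3 := mul_le_mul_of_nonneg_right h2 ht0.le
  have h4 := mul_le_mul_of_nonneg_right h1 hc0
  have h5 := mul_le_mul_of_nonneg_right h1 ht0.le
  have h6 : Real.cos t * t ^ 3 ≤ t ^ 3 := mul_le_of_le_one_left (by positivity) hc1
  have h7 : 0 ≤ Real.cos t * t := by positivity
  have h8 : 0 ≤ t ^ 2 * (0.53 - t) := mul_nonneg (by positivity) (by linarith)
  have h9 : 0 ≤ t ^ 3 * (0.53 - t) := mul_nonneg (by positivity) (by linarith)
  nlinarith

theorem ballProfile_mul_lt_five {r a b : ℝ} (ha0 : 0 < a) (ha : a ≤ Real.pi / 5) (hb0 : 0 < b)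
    (hb : b ≤ Real.pi / 3) (hab : a + b < Real.pi / 2)
    (h : Real.cosh r * Real.sin b = Real.cos a) :
    ballProfile r * b < 0.607267 * (2 * (Real.pi / 2 - a - b)) := by
  have hp1 := Real.pi_gt_d4
  have hp2 := Real.pi_lt_d4
  have hsb : 0 < Real.sin b := Real.sin_pos_of_pos_of_lt_pi hb0 (by linarith)
  have h1 : Real.cos a - Real.sin b ≤
      Real.cos (3 * Real.pi / 20 + b / 2) * (Real.pi / 2 - a - b) := by
    rw [← Real.sin_pi_div_two_sub, Real.sin_sub_sin]
    have h2 : Real.sin ((Real.pi / 2 - a - b) / 2) ≤ (Real.pi / 2 - a - b) / 2 :=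
      Real.sin_le (by linarith)
    -- Since `a ≤ π / 5`, the half-sum is at least `π / 4 - π / 10 + b / 2`.
    have h3 : Real.cos ((Real.pi / 2 - a + b) / 2) ≤ Real.cos (3 * Real.pi / 20 + b / 2) :=
      Real.cos_le_cos_of_nonneg_of_le_pi (by positivity) (by linarith) (by linarith)
    have h4 : 0 ≤ Real.cos ((Real.pi / 2 - a + b) / 2) :=
      Real.cos_nonneg_of_mem_Icc ⟨by linarith, by linarith⟩
    calc _ ≤ 2 * ((Real.pi / 2 - a - b) / 2) * Real.cos ((Real.pi / 2 - a + b) / 2) := by gcongr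
      _ = Real.cos ((Real.pi / 2 - a + b) / 2) * (Real.pi / 2 - a - b) := by ring
      _ ≤ _ := by gcongr; linarith
  have h2 := cos_mul_le (κ := 3 * Real.pi / 20) (t := b / 2) (by linarith) (by linarith)
    (by linarith) (by linarith)
  have h3 : Real.sin b = 2 * (Real.sin (b / 2) * Real.cos (b / 2)) := by
    rw [← mul_assoc, ← Real.sin_two_mul]; congr 1; ring
  have h4 : Real.cos (3 * Real.pi / 20 + b / 2) * b ≤ 0.91 * Real.sin b := by
    rw [h3]; linarith
  have h5 : (Real.cos a - Real.sin b) * b ≤ 0.91 * Real.sin b * (Real.pi / 2 - a - b) :=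
    calc _ ≤ Real.cos (3 * Real.pi / 20 + b / 2) * (Real.pi / 2 - a - b) * b := by gcongr
      _ = Real.cos (3 * Real.pi / 20 + b / 2) * b * (Real.pi / 2 - a - b) := by ring
      _ ≤ _ := by gcongr; linarith
  have h6 : (Real.cosh r - 1) * b ≤ 0.91 * (Real.pi / 2 - a - b) := by
    refine le_of_mul_le_mul_left ?_ hsb
    calc _ = (Real.cosh r * Real.sin b - Real.sin b) * b := by ring
      _ ≤ _ := by rw [h]; linarith
  have h7 := mul_le_mul_of_nonneg_right (ballProfile_le_one r) hb0.le
  linarith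

section

variable {p q : ℕ} {r : ℝ}

theorem pi_div_le {n : ℕ} (hn : 0 < n) (hp : n ≤ p) : Real.pi / p ≤ Real.pi / n := by
  have := Real.pi_pos
  have : (0 : ℝ) < n := by exact_mod_cast hn
  gcongr

theorem ballProfile_div_lt_of_mul_lt (hp : 0 < p)
    (hpq : (1 : ℝ) / p + 1 / q < 1 / 2)
    (h : ballProfile r * (Real.pi / p) <
      0.607267 * (2 * (Real.pi / 2 - Real.pi / q - Real.pi / p))) :
    ballProfile r / (2 * p * (1 / 2 - 1 / p - 1 / q)) < 0.607267 := by
  have hπ := Real.pi_pos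
  have hp' : (0 : ℝ) < p := by exact_mod_cast hp
  rw [div_lt_iff₀ (mul_pos (by positivity) (by linarith))]
  have e : 0.607267 * (2 * (Real.pi / 2 - Real.pi / q - Real.pi / p)) =
      0.607267 * (2 * p * (1 / 2 - 1 / p - 1 / q)) * (Real.pi / p) := by
    have e1 : Real.pi / 2 - Real.pi / q - Real.pi / p =
      p * (1 / 2 - 1 / p - 1 / q) * (Real.pi / p) := by field_simp; ring
    rw [e1]; ring
  rw [e] at h
  exact lt_of_mul_lt_mul_right h (by positivity)

/-- The densities of the packings with balls centred at a vertex with the angle `π / p`. -/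
theorem ballProfile_div_lt (hp : 3 ≤ p) (hq : 3 ≤ q) (hpq : (1 : ℝ) / p + 1 / q < 1 / 2)
    (hne : ¬(p = 9 ∧ q = 3)) (hr : Real.cosh r * Real.sin (Real.pi / p) = Real.cos (Real.pi / q)) :
    ballProfile r / (2 * p * (1 / 2 - 1 / p - 1 / q)) < 0.607267 := by
  have hπ := Real.pi_pos
  have hp0 : (0 : ℝ) < p := by exact_mod_cast (by omega : 0 < p)
  have hq0 : (0 : ℝ) < q := by exact_mod_cast (by omega : 0 < q)
  have hb0 : 0 < Real.pi / p := by positivity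
  obtain rfl | rfl | hq5 : q = 3 ∨ q = 4 ∨ 5 ≤ q := by omega
  · have hp7 : 7 ≤ p := by
      by_contra! h
      have h6 : (p : ℝ) ≤ 6 := by exact_mod_cast (by omega : p ≤ 6)
      have := one_div_le_one_div_of_le hp0 h6
      norm_num at hpq this
      linarith
    rw [Nat.cast_ofNat, Real.cos_pi_div_three] at hr
    by_cases hp11 : 11 ≤ p
    · refine ballProfile_div_lt_of_mul_lt (by omega) hpq ?_
      exact ballProfile_mul_lt_three hb0 (pi_div_le (by norm_num) hp11) hr
    · obtain rfl | rfl | rfl | rfl : p = 7 ∨ p = 8 ∨ p = 9 ∨ p = 10 := by omega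
      · have := ballProfile_lt_seven (by exact_mod_cast hr)
        norm_num at this ⊢; linarith
      · have := ballProfile_lt_eight (by exact_mod_cast hr)
        norm_num at this ⊢; linarith
      · exact absurd ⟨rfl, rfl⟩ hne
      · have := ballProfile_lt_ten (by exact_mod_cast hr)
        norm_num at this ⊢; linarith
  · have hp5 : 5 ≤ p := by
      by_contra! h
      have h6 : (p : ℝ) ≤ 4 := by exact_mod_cast (by omega : p ≤ 4)
      have := one_div_le_one_div_of_le hp0 h6
      norm_num at hpq this
      linarith
    rw [Nat.cast_ofNat, Real.cos_pi_div_four] at hr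
    refine ballProfile_div_lt_of_mul_lt (by omega) hpq ?_
    exact ballProfile_mul_lt_four hb0 (pi_div_le (by norm_num) hp5) hr
  · refine ballProfile_div_lt_of_mul_lt (by omega) hpq ?_
    refine ballProfile_mul_lt_five (by positivity) (pi_div_le (by norm_num) hq5) hb0
      (pi_div_le (by norm_num) hp) ?_ hr
    have := mul_lt_mul_of_pos_left hpq hπ
    calc Real.pi / q + Real.pi / p = Real.pi * (1 / p + 1 / q) := by ring
      _ < _ := this
      _ = _ := by ring

/-- The densities of the packings with balls centred at the vertex with the right angle. -/
theorem ballProfile_div_lt_of_right_angle (hp : 3 ≤ p) (hq : 3 ≤ q)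
    (hpq : (1 : ℝ) / p + 1 / q < 1 / 2)
    (hr : Real.cosh r ^ 2 = Real.cos (Real.pi / p) ^ 2 + Real.cos (Real.pi / q) ^ 2) :
    ballProfile r / (2 * 2 * (1 / 2 - 1 / p - 1 / q)) < 0.607267 := by
  have hπ := Real.pi_pos
  have hp0 : (0 : ℝ) < p := by exact_mod_cast (by omega : 0 < p)
  have hq0 : (0 : ℝ) < q := by exact_mod_cast (by omega : 0 < q)
  rw [div_lt_iff₀ (mul_pos (by norm_num) (by linarith))]
  have hd : Real.pi / 2 - (Real.pi / p + Real.pi / q) = Real.pi * (1 / 2 - 1 / p - 1 / q) := by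
    ring
  have hd0 : 0 < Real.pi * (1 / 2 - 1 / p - 1 / q) := mul_pos hπ (by linarith)
  have h0 : 0 < Real.pi / p + Real.pi / q := by positivity
  have h1 : Real.cos (Real.pi / p + Real.pi / q) ≤ Real.pi * (1 / 2 - 1 / p - 1 / q) := by
    rw [← Real.sin_pi_div_two_sub, hd]
    exact Real.sin_le hd0.le
  have h1' : 0 ≤ Real.cos (Real.pi / p + Real.pi / q) :=
    Real.cos_nonneg_of_mem_Icc ⟨by linarith, by linarith⟩
  -- The product form shows that `cosh r ^ 2 - 1` is at most the angle defect. The density is then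
  -- at most about `π / 6`, well below the threshold.
  have h2 : Real.cosh r ^ 2 - 1 =
      Real.cos (Real.pi / p + Real.pi / q) * Real.cos (Real.pi / p - Real.pi / q) := by
    rw [hr, Real.cos_add, Real.cos_sub]
    linear_combination Real.sin (Real.pi / p) ^ 2 * Real.sin_sq_add_cos_sq (Real.pi / q) +
      (1 - Real.cos (Real.pi / q) ^ 2) * Real.sin_sq_add_cos_sq (Real.pi / p)
  have h3 : Real.cosh r ^ 2 - 1 ≤ Real.pi * (1 / 2 - 1 / p - 1 / q) := by
    rw [h2]
    exact (mul_le_of_le_one_right h1' (Real.cos_le_one _)).trans h1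
  have h4 := Real.one_le_cosh r
  have h5 : 2 * (Real.cosh r - 1) ≤ Real.cosh r ^ 2 - 1 := by nlinarith
  have h6 := ballProfile_le_one r
  have h7 := Real.pi_lt_d2
  have h8 : Real.pi * (1 / 2 - 1 / p - 1 / q) ≤ 3.15 * (1 / 2 - 1 / p - 1 / q) := by
    gcongr
    linarith
  have h9 : (0 : ℝ) < 1 / 2 - 1 / p - 1 / q := by linarith
  linarith

end

/-! ### Comparison of all densities with the optimal one. -/

namespace UpperHalfPlane.TriangleMirrors

variable {p₁ p₂ : ℕ} {h₁ : p₁ ≠ 1} {h₂ : p₂ ≠ 1} {A B C : UpperHalfPlane} {h : ℝ} {K : H2R}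

theorem cosh_arsinh_sq (x : ℝ) : Real.cosh (Real.arsinh x) ^ 2 = 1 + x ^ 2 := by
  rw [Real.cosh_sq, Real.sinh_arsinh, add_comm]

theorem cosh_arsinh_mul_sin {p q : ℕ} (hp : 3 ≤ p) (hq : 3 ≤ q) {x : ℝ}
    (hx : Real.sin (Real.pi / p) ^ 2 * (1 + x ^ 2) = Real.cos (Real.pi / q) ^ 2) :
    Real.cosh (Real.arsinh x) * Real.sin (Real.pi / p) = Real.cos (Real.pi / q) := by
  have h1 := sin_pi_div_pos hp
  have h2 := cos_pi_div_pos hq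
  have h3 := Real.cosh_pos (Real.arsinh x)
  apply (sq_eq_sq₀ (by positivity) h2.le).1
  rw [mul_pow, cosh_arsinh_sq, ← hx, mul_comm]

/-- All packings other than the optimal ones have a density less than `0.607267`. -/
theorem packingDensity_lt (T : TriangleMirrors p₁ p₂ h₁ h₂ A B C) (hadm : AdmissibleParams p₁ p₂)
    (hh : 0 < h) (k : Fin 3) (w : (triangleMatrix p₁ p₂ h₁ h₂).Group)
    (hK : K.fst = T.act w (T.vertex k)) (hB : ¬(k = 1 ∧ p₁ = 9 ∧ p₂ = 3))
    (hC : ¬(k = 2 ∧ p₂ = 9 ∧ p₁ = 3)) :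
    packingDensity (spaceGroup p₁ A B h) K < 0.607267 := by
  obtain ⟨hp, hq, hpq⟩ := id hadm
  fin_cases k
  · refine (T.packingDensity_le hadm hh (i := 1) (j := 2) (by decide) (by decide) (by decide)
      T.isVertex_A w hK).trans_lt ?_
    change _ / (2 * ((2 : ℕ) : ℝ) * _) < _
    exact ballProfile_div_lt_of_right_angle hp hq hpq (by rw [cosh_arsinh_sq, T.ℓ_A]; ring)
  · refine (T.packingDensity_le hadm hh (i := 0) (j := 2) (by decide) (by decide) (by decide)
      T.isVertex_B w hK).trans_lt ?_
    change _ / (2 * (p₁ : ℝ) * _) < _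
    exact ballProfile_div_lt hp hq hpq (fun h => hB ⟨rfl, h⟩) (cosh_arsinh_mul_sin hp hq T.ℓ_B)
  · refine (T.packingDensity_le hadm hh (i := 0) (j := 1) (by decide) (by decide) (by decide)
      T.isVertex_vertexC w hK).trans_lt ?_
    change _ / (2 * (p₂ : ℝ) * _) < _
    rw [sub_right_comm]
    exact ballProfile_div_lt hq hp (by linarith) (fun h => hC ⟨rfl, h⟩)
      (cosh_arsinh_mul_sin hq hp T.ℓ_C)

/-- The radius of the optimal balls. -/
def optimalRadius : ℝ :=
  Real.arsinh √(Real.cos (Real.pi / (3 : ℕ)) ^ 2 / Real.sin (Real.pi / (9 : ℕ)) ^ 2 - 1)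

theorem arsinh_eq_optimalRadius {x : ℝ} (hx0 : 0 < x)
    (hx : Real.sin (Real.pi / (9 : ℕ)) ^ 2 * (1 + x ^ 2) = Real.cos (Real.pi / (3 : ℕ)) ^ 2) :
    Real.arsinh x = optimalRadius := by
  have h1 := sin_pi_div_pos (p := 9) (by norm_num)
  rw [optimalRadius, ← hx, mul_div_cancel_left₀ _ (pow_pos h1 2).ne', add_sub_cancel_left,
    Real.sqrt_sq hx0.le]

theorem packingDensity_le_optimal_B {h₁ : 9 ≠ 1} {h₂ : 3 ≠ 1}
    (T : TriangleMirrors 9 3 h₁ h₂ A B C)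
    (hadm : AdmissibleParams 9 3) (hh : 0 < h) (w : (triangleMatrix 9 3 h₁ h₂).Group)
    (hK : K.fst = T.act w (T.vertex 1)) :
    packingDensity (spaceGroup 9 A B h) K ≤ ballProfile optimalRadius := by
  refine (T.packingDensity_le hadm hh (i := 0) (j := 2) (by decide) (by decide) (by decide)
    T.isVertex_B w hK).trans_eq ?_
  change _ / (2 * ((9 : ℕ) : ℝ) * _) = _
  rw [arsinh_eq_optimalRadius T.isVertex_B.1 T.ℓ_B]
  norm_num

theorem packingDensity_le_optimal_C {h₁ : 3 ≠ 1} {h₂ : 9 ≠ 1}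
    (T : TriangleMirrors 3 9 h₁ h₂ A B C)
    (hadm : AdmissibleParams 3 9) (hh : 0 < h) (w : (triangleMatrix 3 9 h₁ h₂).Group)
    (hK : K.fst = T.act w (T.vertex 2)) :
    packingDensity (spaceGroup 3 A B h) K ≤ ballProfile optimalRadius := by
  refine (T.packingDensity_le hadm hh (i := 0) (j := 1) (by decide) (by decide) (by decide)
    T.isVertex_vertexC w hK).trans_eq ?_
  change _ / (2 * ((9 : ℕ) : ℝ) * _) = _
  rw [arsinh_eq_optimalRadius T.isVertex_vertexC.1 T.ℓ_C]
  norm_num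

theorem packingDensity_eq_optimal {h₁ : 9 ≠ 1} {h₂ : 3 ≠ 1}
    (T : TriangleMirrors 9 3 h₁ h₂ A B C)
    (hadm : AdmissibleParams 9 3) :
    packingDensity (spaceGroup 9 A B (2 * optimalRadius)) (WithLp.toLp 2 (B, 0)) =
      ballProfile optimalRadius := by
  have e := arsinh_eq_optimalRadius T.isVertex_B.1 T.ℓ_B
  rw [T.packingDensity_eq_of_height hadm (i := 0) (j := 2) (k := 1) (by decide) (by decide)
    (by decide) T.isVertex_B (by rw [e]) rfl, e]
  change _ / (2 * ((9 : ℕ) : ℝ) * _) = _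
  norm_num

theorem optimalRadius_pos : 0 < optimalRadius ∧
    Real.cosh optimalRadius * Real.sin (Real.pi / 9) = 1 / 2 := by
  have h1 := sin_pi_div_pos (p := 9) (by norm_num)
  have h2 := lt_sin_pi_div_nine.2
  rw [Nat.cast_ofNat] at h1
  have h3 : (0 : ℝ) < Real.cos (Real.pi / (3 : ℕ)) ^ 2 / Real.sin (Real.pi / (9 : ℕ)) ^ 2 - 1 := by
    rw [Nat.cast_ofNat, Nat.cast_ofNat, Real.cos_pi_div_three, sub_pos,
      one_lt_div (by positivity)]
    nlinarith
  have h4 := Real.sqrt_pos.2 h3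
  refine ⟨Real.arsinh_pos_iff.2 h4, ?_⟩
  have := cosh_arsinh_mul_sin (p := 9) (q := 3) (by norm_num) (by norm_num)
    (x := √(Real.cos (Real.pi / (3 : ℕ)) ^ 2 / Real.sin (Real.pi / (9 : ℕ)) ^ 2 - 1))
    (by rw [Real.sq_sqrt h3.le, add_sub_cancel, mul_div_cancel₀]
        rw [Nat.cast_ofNat]; positivity)
  rw [optimalRadius]
  rw [← Real.cos_pi_div_three]
  exact_mod_cast this

end UpperHalfPlane.TriangleMirrors
end

theorem theorem4p4 :
    ∃ δ : ℝ,
      -- `δ` is the maximal density, over all groups, fibre lattices and kernel points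
      IsGreatest {d : ℝ | ∃ (p₁ p₂ : ℕ) (A B C : UpperHalfPlane) (h : ℝ) (K : H2R),
        IsMultiplyTransitiveConfig p₁ p₂ A B C h K ∧
          d = packingDensity (spaceGroup p₁ A B h) K} δ ∧
      0.607267 ≤ δ ∧ δ < 0.607268 ∧
      -- it is attained for the parameters `(2, 9, 3)` with the ball centred at `B`
      (∃ A B C : UpperHalfPlane, IsTriangle 9 3 A B C) ∧
      (∀ A B C : UpperHalfPlane, IsTriangle 9 3 A B C →
        ∃ h : ℝ, IsMultiplyTransitiveConfig 9 3 A B C h (WithLp.toLp 2 (B, 0)) ∧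
          packingDensity (spaceGroup 9 A B h) (WithLp.toLp 2 (B, 0)) = δ) ∧
      -- and, up to exchanging the roles of `(p₁, B)` and `(p₂, C)`, only there
      (∀ (p₁ p₂ : ℕ) (A B C : UpperHalfPlane) (h : ℝ) (K : H2R),
        IsMultiplyTransitiveConfig p₁ p₂ A B C h K →
        packingDensity (spaceGroup p₁ A B h) K = δ →
          (p₁ = 9 ∧ p₂ = 3 ∧ ∃ g ∈ spaceGroup p₁ A B h, (g K).fst = B) ∨
          (p₁ = 3 ∧ p₂ = 9 ∧ ∃ g ∈ spaceGroup p₁ A B h, (g K).fst = C)) := by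
  have hadm : AdmissibleParams 9 3 := ⟨by norm_num, by norm_num, by norm_num⟩
  obtain ⟨hr0, hr⟩ := UpperHalfPlane.TriangleMirrors.optimalRadius_pos
  set ρ := UpperHalfPlane.TriangleMirrors.optimalRadius
  have hlow := lt_ballProfile_nine hr0.le hr
  have hconf : ∀ A B C : UpperHalfPlane, IsTriangle 9 3 A B C →
      IsMultiplyTransitiveConfig 9 3 A B C (2 * ρ) (WithLp.toLp 2 (B, 0)) ∧
        packingDensity (spaceGroup 9 A B (2 * ρ)) (WithLp.toLp 2 (B, 0)) = ballProfile ρ := by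
    intro A B C hT
    obtain ⟨T⟩ := UpperHalfPlane.nonempty_triangleMirrors (by norm_num) (by norm_num) hT
    exact ⟨⟨hadm, hT, by positivity, T.isMultiplyTransitive_B hadm 0⟩,
      T.packingDensity_eq_optimal hadm⟩
  have hex : ∃ A B C : UpperHalfPlane, IsTriangle 9 3 A B C :=
    UpperHalfPlane.exists_isTriangle (by norm_num) (by norm_num) (by norm_num)
  -- This dichotomy gives both maximality and uniqueness: either the density is below `0.607267`,
  -- which the optimum exceeds, or the configuration is one of the two optimal types.
  have key : ∀ (p₁ p₂ : ℕ) (A B C : UpperHalfPlane) (h : ℝ) (K : H2R),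
      IsMultiplyTransitiveConfig p₁ p₂ A B C h K →
      packingDensity (spaceGroup p₁ A B h) K < 0.607267 ∨
      packingDensity (spaceGroup p₁ A B h) K ≤ ballProfile ρ ∧
        ((p₁ = 9 ∧ p₂ = 3 ∧ ∃ g ∈ spaceGroup p₁ A B h, (g K).fst = B) ∨
          (p₁ = 3 ∧ p₂ = 9 ∧ ∃ g ∈ spaceGroup p₁ A B h, (g K).fst = C)) := by
    rintro p₁ p₂ A B C h K ⟨hadm, hT, hh, hK⟩
    obtain ⟨T⟩ := UpperHalfPlane.nonempty_triangleMirrors hadm.1 hadm.2.1 hT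
    obtain ⟨k, w, hw⟩ := T.exists_eq_act_vertex hadm hK
    by_cases hB : k = 1 ∧ p₁ = 9 ∧ p₂ = 3
    · obtain ⟨rfl, rfl, rfl⟩ := hB
      exact Or.inr ⟨T.packingDensity_le_optimal_B hadm hh w hw,
        Or.inl ⟨rfl, rfl, T.exists_mem_spaceGroup_fst_eq 1 w hw⟩⟩
    by_cases hC : k = 2 ∧ p₂ = 9 ∧ p₁ = 3
    · obtain ⟨rfl, rfl, rfl⟩ := hC
      exact Or.inr ⟨T.packingDensity_le_optimal_C hadm hh w hw,
        Or.inr ⟨rfl, rfl, T.exists_mem_spaceGroup_fst_eq_C w hw⟩⟩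
    exact Or.inl (T.packingDensity_lt hadm hh k w hw hB hC)
  refine ⟨ballProfile ρ, ⟨?_, ?_⟩, hlow.le, ballProfile_lt_nine hr, hex, ?_, ?_⟩
  · obtain ⟨A, B, C, hT⟩ := hex
    exact ⟨9, 3, A, B, C, _, _, (hconf A B C hT).1, (hconf A B C hT).2.symm⟩
  · rintro d ⟨p₁, p₂, A, B, C, h, K, hc, rfl⟩
    rcases key p₁ p₂ A B C h K hc with hlt | ⟨hle, -⟩
    · exact (hlt.trans hlow).le
    · exact hle
  · exact fun A B C hT => ⟨_, hconf A B C hT⟩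
  · intro p₁ p₂ A B C h K hc heq
    rcases key p₁ p₂ A B C h K hc with hlt | ⟨-, h⟩
    · rw [heq] at hlt
      exact absurd hlt hlow.not_gt
    · exact h
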